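/- Let $X$ be a real Banach space admitting a $C^1$ Lipschitz bump function (a $C^1$ smooth Lipschitz function $b:X\to\mathbb R$ with bounded non-empty support). Let $M$ be a connected paracompact Hausdorff $C^1$ Banach manifold modeled on $X$, endowed with a Finsler structure in the sense of Palais: a continuous map $\|\cdot\|_M:TM\to[0,\infty)$ whose restriction $\|\cdot\|_x$ to each $T_xM$ is a norm such that (P1) for every chart $\varphi:U\to X$ and every $x\in U$ the norm $v\mapsto\|d\varphi^{-1}(\varphi(x))(v)\|_x$ is equivalent to the norm of $X$, and (P2) for every $x_0\in M$, $\varepsilon>0$ and every chart $\varphi:U\to X$ with $x_0\in U$ there is an open neighbourhood $W\subset U$ of $x_0$ with $$\tfrac1{1+\varepsilon}\|d\varphi^{-1}(\varphi(x_0))(v)\|_{x_0}\le\|d\varphi^{-1}(\varphi(x))(v)\|_x\le(1+\varepsilon)\|d\varphi^{-1}(\varphi(x_0))(v)\|_{x_0}\qquad(x\in W,\ v\in X).$$ Let $d$ be the Finsler distance on $M$, i.e. $d(p,q)$ is the infimum of the lengths $\int_a^b\|c'(t)\|_{c(t)}\,dt$ of piecewise $C^1$ paths $c:[a,b]\to M$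 from $p$ to $q$, and assume that $(M,d)$ is complete. For $\Delta\in T_xM^*$ let $\|\Delta\|_x=\sup\{|\Delta(\xi)|:\xi\in T_xM,\ \|\xi\|_x=1\}$. Let $H:[0,\infty)\times M\times\mathbb R\to\mathbb R$ be continuous and satisfy condition (A): there are a constant $C\ge0$ and a continuous function $\omega:[0,\infty)\times\mathbb R\times\mathbb R\to\mathbb R$ with $\omega(0,0,0)=0$ such that for all $t_1,t_2\in[0,\infty)$, $x_1,x_2\in M$, $r_1,r_2\in\mathbb R$, $$|H(t_1,x_1,r_1)-H(t_2,x_2,r_2)|\le\omega(|t_1-t_2|,d(x_1,x_2),r_1-r_2)+C\max\{|r_1|,|r_2|\}\,(|t_1-t_2|+d(x_1,x_2)).$$ Let $h:M\to\mathbb R$ be bounded and $L$-Lipschitz for $d$ ($L\ge0$), and consider the problem $$(\mathrm E)\qquad u_t+H(t,x,\|u_x\|_x)=0\ \ (t>0),\qquad u(0,x)=h(x).$$ For $u:[0,\infty)\times M\to\mathbb R$, $t>0$ and $x\in M$, let $D^+u(t,x)$ (resp. $D^-u(t,x)$) be the set of the differentials $(\alpha,\Delta)=dg(t,x)\in\mathbb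 R\times T_xM^*$ of $C^1$ functions $g:(0,\infty)\times M\to\mathbb R$ such that $u-g$ attains a local maximum (resp. minimum) at $(t,x)$. The function $u$ is a viscosity subsolution of (E) if it is upper semicontinuous on $[0,\infty)\times M$, $\alpha+H(t,x,\|\Delta\|_x)\le0$ for all $t>0$, $x\in M$, $(\alpha,\Delta)\in D^+u(t,x)$, and $u(0,x)\le h(x)$ for all $x\in M$; it is a viscosity supersolution if it is lower semicontinuous on $[0,\infty)\times M$, $\alpha+H(t,x,\|\Delta\|_x)\ge0$ for all $t>0$, $x\in M$, $(\alpha,\Delta)\in D^-u(t,x)$, and $u(0,x)\ge h(x)$ for all $x\in M$; it is a viscosity solution if it is both. For $v:[0,\infty)\times M\to\mathbb R$, the envelope $v^*$ (resp. $v_*$) is the pointwise infimum (resp. supremum) of the continuous functions $f:[0,\infty)\times M\to\mathbb R$ with $f\ge v$ (resp. $f\le v$). Assume that $$K_0=\inf\{H(t,x,m):(t,x)\in(0,\infty)\times M,\ |m|\le L\}\quad\text{and}\quad K_1=\sup\{H(t,x,m):(t,x)\in(0,\infty)\times M,\ |m|\le L\}$$ are finite. Let $\mathcal F$ be the set of the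 viscosity subsolutions $w:[0,\infty)\times M\to\mathbb R$ of (E) with $-K_1t+h(x)\le w(t,x)\le-K_0t+h(x)$ for all $(t,x)\in(0,\infty)\times M$, and let $u=\sup\mathcal F$ pointwise on $[0,\infty)\times M$. Then $u^*$ is a viscosity subsolution of (E) and $(u^*)_*$ is a viscosity supersolution of (E). Moreover: (1) if $u^*$ is continuous, then $u^*=(u^*)_*$ and $u^*$ is a viscosity solution of (E); (2) if $u^*$ is locally Lipschitz on $[0,\infty)\times M$ (for the distance $|s-t|+d(x,y)$), then $u^*$ is the unique viscosity solution of (E) that is bounded on $[0,T)\times M$ for every $T>0$. -/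

import Mathlib

open Set Filter Topology MeasureTheory
open scoped Manifold NNReal ENNReal

noncomputable section

/-- The normed space `E` admits a `C^1` Lipschitz bump function: a `C^1` smooth Lipschitz function
`b : E → ℝ` with bounded, non-empty support. -/
def HasC1LipschitzBump (E : Type*) [NormedAddCommGroup E] [NormedSpace ℝ E] : Prop :=
  ∃ b : E → ℝ, ContDiff ℝ 1 b ∧ (∃ K : ℝ≥0, LipschitzWith K b) ∧
    Bornology.IsBounded (tsupport b) ∧ (tsupport b).Nonempty

/-- A Finsler structure in the sense of Palais on a `C^1` Banach manifold `M` modeled on `E`.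
A chart is an element of the maximal `C^1` atlas, and for a chart `φ` the vector
`dφ⁻¹(φ(x))(v)` lives in the tangent space at `φ.symm (φ x)`, that is, at `x`. -/
structure PalaisFinsler (E : Type*) [NormedAddCommGroup E] [NormedSpace ℝ E]
    (M : Type*) [TopologicalSpace M] [ChartedSpace E M] [IsManifold 𝓘(ℝ, E) 1 M] where
  /-- the norm `‖v‖_x` of a tangent vector `v` at `x` -/
  tnorm : (x : M) → TangentSpace 𝓘(ℝ, E) x → ℝ
  continuous_tnorm : Continuous fun p : TangentBundle 𝓘(ℝ, E) M => tnorm p.proj p.snd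
  nonneg : ∀ x v, 0 ≤ tnorm x v
  eq_zero : ∀ x v, tnorm x v = 0 → v = 0
  smul : ∀ (x : M) (c : ℝ) (v : TangentSpace 𝓘(ℝ, E) x), tnorm x (c • v) = |c| * tnorm x v
  add_le : ∀ (x : M) (v w : TangentSpace 𝓘(ℝ, E) x), tnorm x (v + w) ≤ tnorm x v + tnorm x w
  /-- (P1): in every chart the norm at `x` is equivalent to the norm of the model space. -/
  equivalent : ∀ φ ∈ IsManifold.maximalAtlas 𝓘(ℝ, E) 1 M, ∀ x ∈ φ.source,
    ∃ K : ℝ, 1 ≤ K ∧ ∀ v : E,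
      K⁻¹ * ‖v‖ ≤ tnorm (φ.symm (φ x)) (mfderiv 𝓘(ℝ, E) 𝓘(ℝ, E) φ.symm (φ x) v) ∧
      tnorm (φ.symm (φ x)) (mfderiv 𝓘(ℝ, E) 𝓘(ℝ, E) φ.symm (φ x) v) ≤ K * ‖v‖
  /-- (P2): in every chart the norms at points near `x₀` are `(1 + ε)`-equivalent to the norm
  at `x₀`. -/
  palais : ∀ x₀ : M, ∀ ε : ℝ, 0 < ε → ∀ φ ∈ IsManifold.maximalAtlas 𝓘(ℝ, E) 1 M, x₀ ∈ φ.source →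
    ∃ W : Set M, IsOpen W ∧ x₀ ∈ W ∧ W ⊆ φ.source ∧ ∀ x ∈ W, ∀ v : E,
      (1 + ε)⁻¹ * tnorm (φ.symm (φ x₀)) (mfderiv 𝓘(ℝ, E) 𝓘(ℝ, E) φ.symm (φ x₀) v)
        ≤ tnorm (φ.symm (φ x)) (mfderiv 𝓘(ℝ, E) 𝓘(ℝ, E) φ.symm (φ x) v) ∧
      tnorm (φ.symm (φ x)) (mfderiv 𝓘(ℝ, E) 𝓘(ℝ, E) φ.symm (φ x) v)
        ≤ (1 + ε) * tnorm (φ.symm (φ x₀)) (mfderiv 𝓘(ℝ, E) 𝓘(ℝ, E) φ.symm (φ x₀) v)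

/-- `γ` restricted to `[a, b]` is a piecewise `C^1` smooth path: there is a finite subdivision of
`[a, b]` such that `γ` is `C^1` on each of its closed subintervals. -/
def IsPiecewiseC1 (E : Type*) [NormedAddCommGroup E] [NormedSpace ℝ E]
    {M : Type*} [TopologicalSpace M] [ChartedSpace E M] (γ : ℝ → M) (a b : ℝ) : Prop :=
  ∃ (n : ℕ) (s : ℕ → ℝ), Monotone s ∧ s 0 = a ∧ s n = b ∧
    ∀ i < n, ContMDiffOn 𝓘(ℝ, ℝ) 𝓘(ℝ, E) 1 γ (Icc (s i) (s (i + 1)))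

namespace PalaisFinsler

variable {E : Type*} [NormedAddCommGroup E] [NormedSpace ℝ E]
  {M : Type*} [TopologicalSpace M] [ChartedSpace E M] [IsManifold 𝓘(ℝ, E) 1 M]

/-- The length `∫_a^b ‖γ'(t)‖_{γ(t)} dt`. For a piecewise `C^1` path, `γ` is differentiable outside
of a finite set of times. -/
def length (F : PalaisFinsler E M) (γ : ℝ → M) (a b : ℝ) : ℝ≥0∞ :=
  ∫⁻ t in Icc a b, ENNReal.ofReal (F.tnorm (γ t) (mfderiv 𝓘(ℝ, ℝ) 𝓘(ℝ, E) γ t (1 : ℝ)))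

/-- The Finsler distance: the infimum of the lengths of the piecewise `C^1` paths from `x` to `y`
(which is finite when `M` is connected). -/
def fdist (F : PalaisFinsler E M) (x y : M) : ℝ :=
  (sInf {ℓ : ℝ≥0∞ | ∃ (γ : ℝ → M) (a b : ℝ), a ≤ b ∧ IsPiecewiseC1 E γ a b ∧ γ a = x ∧ γ b = y ∧
    ℓ = F.length γ a b}).toReal

/-- Completeness for the Finsler distance. -/
def IsComplete (F : PalaisFinsler E M) : Prop :=
  ∀ s : ℕ → M, (∀ ε : ℝ, 0 < ε → ∃ N : ℕ, ∀ m ≥ N, ∀ n ≥ N, F.fdist (s m) (s n) < ε) →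
    ∃ x : M, Tendsto (fun n => F.fdist (s n) x) atTop (𝓝 0)

/-- The dual norm `‖Δ‖_x` of a functional on the tangent space at `x`. -/
def dualNorm (F : PalaisFinsler E M) (x : M) (Δ : TangentSpace 𝓘(ℝ, E) x →L[ℝ] ℝ) : ℝ :=
  sSup {r : ℝ | ∃ ξ : TangentSpace 𝓘(ℝ, E) x, F.tnorm x ξ = 1 ∧ r = |Δ ξ|}

/-- `h` is `L`-Lipschitz for the Finsler distance. -/
def IsLipschitz (F : PalaisFinsler E M) (L : ℝ) (h : M → ℝ) : Prop :=
  ∀ y z : M, |h y - h z| ≤ L * F.fdist y z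

/-- `u : [0,∞) × M → ℝ` is locally Lipschitz for the distance `|s - t| + d(x, y)`. -/
def IsLocallyLipschitz (F : PalaisFinsler E M) (u : ℝ≥0 × M → ℝ) : Prop :=
  ∀ p : ℝ≥0 × M, ∃ K : ℝ, ∃ V ∈ 𝓝 p, ∀ q ∈ V, ∀ q' ∈ V,
    |u q - u q'| ≤ K * (|(q.1 : ℝ) - (q'.1 : ℝ)| + F.fdist q.2 q'.2)

/-- Condition (A) for a Hamiltonian `H : [0,∞) × M × ℝ → ℝ`. -/
def ConditionA (F : PalaisFinsler E M) (H : ℝ≥0 × M × ℝ → ℝ) : Prop :=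
  ∃ (C : ℝ) (w : ℝ≥0 × ℝ × ℝ → ℝ), 0 ≤ C ∧ Continuous w ∧ w (0, 0, 0) = 0 ∧
    ∀ (t₁ t₂ : ℝ≥0) (x₁ x₂ : M) (r₁ r₂ : ℝ),
      |H (t₁, x₁, r₁) - H (t₂, x₂, r₂)| ≤
        w (nndist t₁ t₂, F.fdist x₁ x₂, r₁ - r₂) +
          C * max |r₁| |r₂| * (|(t₁ : ℝ) - (t₂ : ℝ)| + F.fdist x₁ x₂)

end PalaisFinsler

/-- The pair `(α, Δ)` is the differential at `(t, x)` of `g : ℝ × M → ℝ`. -/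
def IsDiffPair {E : Type*} [NormedAddCommGroup E] [NormedSpace ℝ E]
    {M : Type*} [TopologicalSpace M] [ChartedSpace E M]
    (g : ℝ × M → ℝ) (t : ℝ) (x : M) (α : ℝ) (Δ : TangentSpace 𝓘(ℝ, E) x →L[ℝ] ℝ) : Prop :=
  ∀ (s : ℝ) (v : TangentSpace 𝓘(ℝ, E) x),
    (mfderiv (𝓘(ℝ, ℝ).prod 𝓘(ℝ, E)) 𝓘(ℝ, ℝ) g (t, x) (s, v) : ℝ) = s * α + Δ v

/-- `(α, Δ) ∈ D⁺u(t, x)`, for `t > 0`: it is the differential of some `C^1` function `g` on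
`(0,∞) × M` such that `u - g` has a local maximum at `(t, x)`. -/
def IsSuperdifferential {E : Type*} [NormedAddCommGroup E] [NormedSpace ℝ E]
    {M : Type*} [TopologicalSpace M] [ChartedSpace E M]
    (u : ℝ≥0 × M → ℝ) (t : ℝ≥0) (x : M) (α : ℝ) (Δ : TangentSpace 𝓘(ℝ, E) x →L[ℝ] ℝ) : Prop :=
  ∃ g : ℝ × M → ℝ,
    ContMDiffOn (𝓘(ℝ, ℝ).prod 𝓘(ℝ, E)) 𝓘(ℝ, ℝ) 1 g (Ioi 0 ×ˢ univ) ∧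
    IsLocalMax (fun p : ℝ≥0 × M => u p - g ((p.1 : ℝ), p.2)) (t, x) ∧
    IsDiffPair g (t : ℝ) x α Δ

/-- `(α, Δ) ∈ D⁻u(t, x)`, for `t > 0`: it is the differential of some `C^1` function `g` on
`(0,∞) × M` such that `u - g` has a local minimum at `(t, x)`. -/
def IsSubdifferential {E : Type*} [NormedAddCommGroup E] [NormedSpace ℝ E]
    {M : Type*} [TopologicalSpace M] [ChartedSpace E M]
    (u : ℝ≥0 × M → ℝ) (t : ℝ≥0) (x : M) (α : ℝ) (Δ : TangentSpace 𝓘(ℝ, E) x →L[ℝ] ℝ) : Prop :=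
  ∃ g : ℝ × M → ℝ,
    ContMDiffOn (𝓘(ℝ, ℝ).prod 𝓘(ℝ, E)) 𝓘(ℝ, ℝ) 1 g (Ioi 0 ×ˢ univ) ∧
    IsLocalMin (fun p : ℝ≥0 × M => u p - g ((p.1 : ℝ), p.2)) (t, x) ∧
    IsDiffPair g (t : ℝ) x α Δ

/-- The upper semicontinuous envelope `u^*`: the infimum of the continuous majorants of `u`. -/
def uscEnvelope {X : Type*} [TopologicalSpace X] (u : X → ℝ) (p : X) : ℝ :=
  sInf {r : ℝ | ∃ v : X → ℝ, Continuous v ∧ (∀ q, u q ≤ v q) ∧ r = v p}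

/-- The lower semicontinuous envelope `u_*`: the supremum of the continuous minorants of `u`. -/
def lscEnvelope {X : Type*} [TopologicalSpace X] (u : X → ℝ) (p : X) : ℝ :=
  sSup {r : ℝ | ∃ v : X → ℝ, Continuous v ∧ (∀ q, v q ≤ u q) ∧ r = v p}

/-- `u` is bounded on `[0,T) × M` for every `T > 0`. -/
def BoundedOnStrips {M : Type*} (u : ℝ≥0 × M → ℝ) : Prop :=
  ∀ T : ℝ, 0 < T → ∃ B : ℝ, ∀ (t : ℝ≥0) (x : M), (t : ℝ) < T → |u (t, x)| ≤ B

namespace PalaisFinsler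

variable {E : Type*} [NormedAddCommGroup E] [NormedSpace ℝ E]
  {M : Type*} [TopologicalSpace M] [ChartedSpace E M] [IsManifold 𝓘(ℝ, E) 1 M]

/-- Viscosity subsolutions of `u_t + H(t, x, ‖u_x‖_x) = 0` (for `t > 0`), `u(0, ·) = h`. -/
def IsViscositySubsolution (F : PalaisFinsler E M) (H : ℝ≥0 × M × ℝ → ℝ) (h : M → ℝ)
    (u : ℝ≥0 × M → ℝ) : Prop :=
  UpperSemicontinuous u ∧
  (∀ (t : ℝ≥0) (x : M), 0 < t → ∀ (α : ℝ) (Δ : TangentSpace 𝓘(ℝ, E) x →L[ℝ] ℝ),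
    IsSuperdifferential u t x α Δ → α + H (t, x, F.dualNorm x Δ) ≤ 0) ∧
  ∀ x : M, u (0, x) ≤ h x

/-- Viscosity supersolutions of `u_t + H(t, x, ‖u_x‖_x) = 0` (for `t > 0`), `u(0, ·) = h`. -/
def IsViscositySupersolution (F : PalaisFinsler E M) (H : ℝ≥0 × M × ℝ → ℝ) (h : M → ℝ)
    (u : ℝ≥0 × M → ℝ) : Prop :=
  LowerSemicontinuous u ∧
  (∀ (t : ℝ≥0) (x : M), 0 < t → ∀ (α : ℝ) (Δ : TangentSpace 𝓘(ℝ, E) x →L[ℝ] ℝ),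
    IsSubdifferential u t x α Δ → 0 ≤ α + H (t, x, F.dualNorm x Δ)) ∧
  ∀ x : M, h x ≤ u (0, x)

/-- Viscosity solutions: simultaneously sub- and supersolutions. -/
def IsViscositySolution (F : PalaisFinsler E M) (H : ℝ≥0 × M × ℝ → ℝ) (h : M → ℝ)
    (u : ℝ≥0 × M → ℝ) : Prop :=
  F.IsViscositySubsolution H h u ∧ F.IsViscositySupersolution H h u

/-- The family of the subsolutions `w` with `-K₁ t + h(x) ≤ w(t, x) ≤ -K₀ t + h(x)` on
`(0,∞) × M`. -/
def perronFamily (F : PalaisFinsler E M) (H : ℝ≥0 × M × ℝ → ℝ) (h : M → ℝ) (K₀ K₁ : ℝ) :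
    Set (ℝ≥0 × M → ℝ) :=
  {w | F.IsViscositySubsolution H h w ∧ ∀ (t : ℝ≥0) (x : M), 0 < t →
    -K₁ * (t : ℝ) + h x ≤ w (t, x) ∧ w (t, x) ≤ -K₀ * (t : ℝ) + h x}

/-- The pointwise supremum of the family above. -/
def perronSup (F : PalaisFinsler E M) (H : ℝ≥0 × M × ℝ → ℝ) (h : M → ℝ) (K₀ K₁ : ℝ)
    (p : ℝ≥0 × M) : ℝ :=
  sSup {r : ℝ | ∃ w ∈ F.perronFamily H h K₀ K₁, r = w p}

end PalaisFinsler

end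

/-! The local work is done in charts, on open sets of `ℝ × E`, where the equation becomes a function
`chartHam` of a point and a covector. It is jointly continuous, because (P1) and (P2) make the dual
norm continuous in the base point and the functional together (`continuousAt_chartDual`). The bump
function replaces local compactness: by `IsUnitBump.exists_perturbation_isMaxOn`, an upper
semicontinuous function that is bounded above on a closed set attains its maximum after adding a
perturbation that is small in `C¹`.

Existence is Perron's method. Since `h` is `L`-Lipschitz, its superdifferentials have dual norm at
most `L`, so `-K₁ t + h` is a subsolution and `-K₀ t + h` a supersolution. These barriers enclose
the family and coincide at time `0`, which fixes the initial value of every envelope. A strict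
violation of the subsolution inequality by `u^*` would be inherited by some member of the family
(`isSubsolutionAt_uscEnvelope`). If `(u^*)_*` violated the supersolution inequality, it would lie
strictly below the upper barrier, and `u^*` could be raised by pasting in a small smooth bump,
against maximality (`isSubsolutionAt_neg_uscEnvelope_neg`).

Uniqueness is the comparison principle `add_nonpos_of_isSubsolutionAt`. From the difference of a
subsolution and a supersolution one subtracts `η / (T - t)`. Completeness of `M` and Ekeland's
principle give a point that is maximal up to a slope `ε`. The fuzzy sum rule yields almost opposite
differentials of the two functions at nearby points. The local Lipschitz bound keeps these covectors
bounded, so condition (A) makes the two values of the Hamiltonian close, which contradicts the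
positive slope of `η / (T - t)`. -/

/-! ### Normalized bump functions -/

/-- A `C^1` Lipschitz bump function with values in `[0, 1]`, equal to `1` near the origin and
vanishing outside of the open unit ball. -/
structure IsUnitBump {Z : Type*} [NormedAddCommGroup Z] [NormedSpace ℝ Z] (b : Z → ℝ) (K : ℝ≥0) :
    Prop where
  contDiff : ContDiff ℝ 1 b
  lipschitz : LipschitzWith K b
  nonneg : ∀ z, 0 ≤ b z
  le_one : ∀ z, b z ≤ 1
  eventually_eq_one : ∀ᶠ z in 𝓝 0, b z = 1
  eq_zero : ∀ z, 1 ≤ ‖z‖ → b z = 0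

/-- The derivative is bounded on the compact interval `[-1, 2]`; at every other point the function
is locally constant. -/
theorem exists_lipschitzWith_smoothTransition : ∃ C : ℝ≥0, LipschitzWith C Real.smoothTransition := by
  have hd : ContDiff ℝ 1 Real.smoothTransition := Real.smoothTransition.contDiff
  obtain ⟨C, hC⟩ := (isCompact_Icc (a := (-1 : ℝ)) (b := 2)).exists_bound_of_continuousOn
    (hd.continuous_deriv le_rfl).continuousOn
  refine ⟨C.toNNReal, lipschitzWith_of_nnnorm_deriv_le (hd.differentiable one_ne_zero) fun x => ?_⟩
  rw [← NNReal.coe_le_coe, coe_nnnorm]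
  refine le_trans ?_ (Real.le_coe_toNNReal C)
  by_cases hx : x ∈ Icc (-1 : ℝ) 2
  · exact hC x hx
  · have hC0 : 0 ≤ C := (norm_nonneg _).trans (hC 0 (by constructor <;> norm_num))
    have : deriv Real.smoothTransition x = 0 := by
      rcases lt_or_ge x (-1) with h | h
      · have : Real.smoothTransition =ᶠ[𝓝 x] fun _ => (0 : ℝ) := by
          filter_upwards [Iio_mem_nhds h] with y hy
          exact Real.smoothTransition.zero_of_nonpos (by simp only [mem_Iio] at hy; linarith)
        rw [this.deriv_eq]; simp
      · have h2 : 2 < x := by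
          by_contra h'
          exact hx ⟨h, not_lt.1 h'⟩
        have : Real.smoothTransition =ᶠ[𝓝 x] fun _ => (1 : ℝ) := by
          filter_upwards [Ioi_mem_nhds h2] with y hy
          exact Real.smoothTransition.one_of_one_le (by simp only [mem_Ioi] at hy; linarith)
        rw [this.deriv_eq]; simp
    rw [this]; simpa using hC0

/-- The quotient `b / b x₀` is `1` at the centre. Composing twice this quotient with the smooth step
flattens it to `1` wherever it exceeds `1 / 2`, hence on a neighbourhood, and truncates it to `[0,
1]`. -/
theorem HasC1LipschitzBump.exists_isUnitBump {Z : Type*} [NormedAddCommGroup Z] [NormedSpace ℝ Z]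
    (hZ : HasC1LipschitzBump Z) : ∃ (b : Z → ℝ) (K : ℝ≥0), IsUnitBump b K := by
  obtain ⟨b, hb, ⟨K, hK⟩, hbd, hne⟩ := hZ
  obtain ⟨C, hC⟩ := exists_lipschitzWith_smoothTransition
  have hs : (Function.support b).Nonempty := by
    rw [tsupport, closure_nonempty_iff] at hne; exact hne
  obtain ⟨x₀, hx₀⟩ := hs
  rw [Function.mem_support] at hx₀
  obtain ⟨R, hR⟩ := hbd.exists_norm_le
  have hR0 : 0 ≤ R := (norm_nonneg _).trans (hR x₀ (subset_tsupport b hx₀))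
  -- With this scale, `‖z‖ ≥ 1` puts `x₀ + ρ • z` outside the ball of radius `R` that contains the
  -- support.
  set ρ : ℝ := R + ‖x₀‖ + 1 with hρ
  have hρ0 : 0 < ρ := by positivity
  have hlin : ContDiff ℝ 1 fun z : Z => x₀ + ρ • z := by fun_prop
  have hlinL : LipschitzWith ρ.toNNReal fun z : Z => x₀ + ρ • z := by
    refine LipschitzWith.of_dist_le_mul fun x y => ?_
    rw [dist_add_left, dist_smul₀, Real.coe_toNNReal _ hρ0.le, Real.norm_of_nonneg hρ0.le]
  have hmulL : LipschitzWith (2 / |b x₀|).toNNReal fun r : ℝ => 2 * (r / b x₀) := by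
    refine LipschitzWith.of_dist_le_mul fun x y => ?_
    rw [Real.coe_toNNReal _ (by positivity), Real.dist_eq, Real.dist_eq,
      show 2 * (x / b x₀) - 2 * (y / b x₀) = (2 / b x₀) * (x - y) by ring, abs_mul, abs_div,
      abs_of_pos (two_pos : (0 : ℝ) < 2)]
  refine ⟨fun z => Real.smoothTransition (2 * (b (x₀ + ρ • z) / b x₀)), _, ⟨?_,
    hC.comp (hmulL.comp (hK.comp hlinL)), fun z => Real.smoothTransition.nonneg _,
    fun z => Real.smoothTransition.le_one _, ?_, fun z hz => ?_⟩⟩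
  · exact (Real.smoothTransition.contDiff (n := 1)).comp
      (contDiff_const.mul ((hb.comp hlin).div_const _))
  · have hc : Continuous fun z : Z => 2 * (b (x₀ + ρ • z) / b x₀) :=
      continuous_const.mul ((hb.continuous.comp hlin.continuous).div_const _)
    have : ∀ᶠ z in 𝓝 (0 : Z), 1 < 2 * (b (x₀ + ρ • z) / b x₀) := by
      refine hc.continuousAt.eventually (lt_mem_nhds ?_)
      simp [hx₀]
    filter_upwards [this] with z hz using Real.smoothTransition.one_of_one_le hz.le
  · have : b (x₀ + ρ • z) = 0 := by
      by_contra h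
      have h1 := hR _ (subset_tsupport b h)
      have h2 : ρ * 1 ≤ ‖ρ • z‖ := by
        rw [norm_smul, Real.norm_of_nonneg hρ0.le]; gcongr
      have h3 : ‖ρ • z‖ ≤ ‖x₀ + ρ • z‖ + ‖x₀‖ := by
        simpa using norm_sub_le (x₀ + ρ • z) x₀
      linarith
    simp [this]

/-- Provides the time factor of the bumps on `ℝ × E`. -/
theorem hasC1LipschitzBump_real : HasC1LipschitzBump ℝ := by
  let f : ContDiffBump (0 : ℝ) := ⟨1, 2, one_pos, one_lt_two⟩
  have h1 : ContDiff ℝ 1 f := f.contDiff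
  obtain ⟨C, hC⟩ := h1.lipschitzWith_of_hasCompactSupport f.hasCompactSupport one_ne_zero
  refine ⟨f, h1, ⟨C, hC⟩, f.hasCompactSupport.isCompact.isBounded, ⟨0, subset_tsupport _ ?_⟩⟩
  rw [Function.mem_support, f.one_of_mem_closedBall (by simp [f.rIn_pos.le])]
  exact one_ne_zero

namespace IsUnitBump

variable {Z : Type*} [NormedAddCommGroup Z] [NormedSpace ℝ Z] {b : Z → ℝ} {K : ℝ≥0}

theorem map_zero (hb : IsUnitBump b K) : b 0 = 1 := hb.eventually_eq_one.self_of_nhds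

/-- The product norm is the maximum, so one factor vanishes as soon as the pair has norm at least
`1`. -/
theorem prod {Y : Type*} [NormedAddCommGroup Y] [NormedSpace ℝ Y] {b' : Y → ℝ} {K' : ℝ≥0}
    (hb : IsUnitBump b K) (hb' : IsUnitBump b' K') :
    IsUnitBump (fun p : Z × Y => b p.1 * b' p.2) (K + K') where
  contDiff := (hb.contDiff.comp contDiff_fst).mul (hb'.contDiff.comp contDiff_snd)
  lipschitz := by
    refine LipschitzWith.of_dist_le_mul fun p q => ?_
    have h1 := hb.lipschitz.dist_le_mul p.1 q.1
    have h2 := hb'.lipschitz.dist_le_mul p.2 q.2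
    rw [Real.dist_eq] at h1 h2 ⊢
    have e1 : dist p.1 q.1 ≤ dist p q := le_max_left _ _
    have e2 : dist p.2 q.2 ≤ dist p q := le_max_right _ _
    have : b p.1 * b' p.2 - b q.1 * b' q.2 =
        (b p.1 - b q.1) * b' p.2 + b q.1 * (b' p.2 - b' q.2) := by ring
    rw [this]
    refine (abs_add_le _ _).trans ?_
    rw [abs_mul, abs_mul, abs_of_nonneg (hb'.nonneg _), abs_of_nonneg (hb.nonneg _)]
    have h3 : |b p.1 - b q.1| * b' p.2 ≤ (K * dist p q) * 1 := by
      refine mul_le_mul (h1.trans (by gcongr)) (hb'.le_one _) (hb'.nonneg _) (by positivity)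
    have h4 : b q.1 * |b' p.2 - b' q.2| ≤ 1 * (K' * dist p q) := by
      refine mul_le_mul (hb.le_one _) (h2.trans (by gcongr)) (abs_nonneg _) zero_le_one
    push_cast
    linarith
  nonneg p := mul_nonneg (hb.nonneg _) (hb'.nonneg _)
  le_one p := mul_le_one₀ (hb.le_one _) (hb'.nonneg _) (hb'.le_one _)
  eventually_eq_one := by
    have h1 : Tendsto Prod.fst (𝓝 (0 : Z × Y)) (𝓝 0) := continuous_fst.tendsto _
    have h2 : Tendsto Prod.snd (𝓝 (0 : Z × Y)) (𝓝 0) := continuous_snd.tendsto _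
    filter_upwards [h1.eventually hb.eventually_eq_one, h2.eventually hb'.eventually_eq_one]
      with p h1 h2
    rw [h1, h2, one_mul]
  eq_zero p hp := by
    rw [Prod.norm_def, le_max_iff] at hp
    rcases hp with h | h
    · rw [hb.eq_zero _ h, zero_mul]
    · rw [hb'.eq_zero _ h, mul_zero]

/-! ### The smooth variational principle -/

theorem contDiff_rescale (hb : IsUnitBump b K) (c : ℝ) (y : Z) :
    ContDiff ℝ 1 fun z => b (c • (z - y)) :=
  hb.contDiff.comp (contDiff_const.smul (contDiff_id.sub contDiff_const))

theorem norm_fderiv_rescale_le (hb : IsUnitBump b K) {c : ℝ} (hc : 0 ≤ c) (y z : Z) :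
    ‖fderiv ℝ (fun z => b (c • (z - y))) z‖ ≤ c * K := by
  have : LipschitzWith (K * c.toNNReal) fun z => b (c • (z - y)) := by
    refine hb.lipschitz.comp (LipschitzWith.of_dist_le_mul fun x x' => ?_)
    rw [dist_smul₀, dist_sub_right, Real.coe_toNNReal _ hc, Real.norm_of_nonneg hc]
  refine (norm_fderiv_le_of_lipschitz ℝ this).trans_eq ?_
  push_cast
  rw [Real.coe_toNNReal _ hc, mul_comm]

/-- The smooth variational principle of Deville, Godefroy and Zizler. -/
theorem exists_perturbation_isMaxOn [CompleteSpace Z] (hb : IsUnitBump b K) {S : Set Z}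
    (hS : IsClosed S) (hne : S.Nonempty) {f : Z → ℝ} (hf : UpperSemicontinuousOn f S)
    (hbd : BddAbove (f '' S)) {ε : ℝ} (hε : 0 < ε) :
    ∃ ψ : Z → ℝ, ContDiff ℝ 1 ψ ∧ (∀ z, 0 ≤ ψ z ∧ ψ z ≤ ε) ∧ (∀ z, ‖fderiv ℝ ψ z‖ ≤ ε) ∧
      ∃ y ∈ S, ∀ z ∈ S, f z + ψ z ≤ f y + ψ y := by
  set c : ℝ := ε / (2 * (K + 1)) with hc
  have hK : (0 : ℝ) ≤ K := K.2
  have hc0 : 0 < c := by positivity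
  have hcε : c * 2 ≤ ε ∧ c * K * 2 ≤ ε := by
    have : c * (2 * (K + 1)) = ε := by rw [hc]; field_simp
    constructor <;> nlinarith
  -- Heights `8⁻ⁿ` on balls of radius `2⁻ⁿ` give slopes of order `4⁻ⁿ`, so the series of bumps
  -- converges in `C¹`; moreover each height dominates the sum of all later ones.
  set h : ℕ → ℝ := fun n => c / 8 ^ n with hh
  have h0 : ∀ n, 0 < h n := fun n => by positivity
  have hsucc : ∀ n, h (n + 1) = h n / 8 := fun n => by simp only [hh, pow_succ]; field_simp
  -- Near-maximality is only claimed under boundedness, so that the recursion can choose its points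
  -- before boundedness of the perturbed functions is proved.
  have pick : ∀ (n : ℕ) (φ : Z → ℝ), ∃ y ∈ S, BddAbove ((fun z => f z + φ z) '' S) →
      ∀ z ∈ S, f z + φ z ≤ f y + φ y + h n / 4 := by
    intro n φ
    by_cases hB : BddAbove ((fun z => f z + φ z) '' S)
    · have h4 : 0 < h n / 4 := by linarith [h0 n]
      obtain ⟨_, ⟨y, hy, rfl⟩, hlt⟩ := exists_lt_of_lt_csSup (hne.image fun z => f z + φ z)
        (sub_lt_self (sSup ((fun z => f z + φ z) '' S)) h4)
      refine ⟨y, hy, fun _ z hz => ?_⟩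
      have := le_csSup hB (mem_image_of_mem _ hz)
      simp only at this hlt
      linarith
    · obtain ⟨y, hy⟩ := hne
      exact ⟨y, hy, fun h => absurd h hB⟩
  choose pk hpkS hpk using pick
  let φ : ℕ → Z → ℝ := fun n => Nat.rec (motive := fun _ => Z → ℝ) (fun _ => 0)
    (fun n φ z => φ z + h n * b ((2 : ℝ) ^ n • (z - pk n φ))) n
  set y : ℕ → Z := fun n => pk n (φ n) with hy
  have hφ : ∀ n z, φ (n + 1) z = φ n z + h n * b ((2 : ℝ) ^ n • (z - y n)) := fun n z => rfl
  have hyS : ∀ n, y n ∈ S := fun n => hpkS _ _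
  set B : ℕ → Z → ℝ := fun n z => h n * b ((2 : ℝ) ^ n • (z - y n)) with hB
  have hB0 : ∀ n z, 0 ≤ B n z := fun n z => mul_nonneg (h0 n).le (hb.nonneg _)
  have hBh : ∀ n z, B n z ≤ h n := fun n z => mul_le_of_le_one_right (h0 n).le (hb.le_one _)
  have hφsum : ∀ n z, φ n z = ∑ k ∈ Finset.range n, B k z := by
    intro n z
    induction n with
    | zero => rfl
    | succ n ih => rw [Finset.sum_range_succ, ← ih, hφ]
  -- The factor `8 / 7` sums the geometric series: `h n + ⋯ + h (n + j - 1) = 8 / 7 * (h n - h (n +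
  -- j))`.
  have hup : ∀ n j z, φ (n + j) z ≤ φ n z + 8 / 7 * (h n - h (n + j)) := by
    intro n j z
    induction j with
    | zero => simp
    | succ j ih =>
      have h1 := hφ (n + j) z
      have h2 := hBh (n + j) z
      have h3 := hsucc (n + j)
      rw [← add_assoc, h1, h3]
      simp only [hB] at h2
      linarith
  have hφ0 : ∀ z, φ 0 z = 0 := fun z => rfl
  have hbddφ : ∀ n, BddAbove ((fun z => f z + φ n z) '' S) := by
    intro n
    obtain ⟨C, hC⟩ := hbd
    refine ⟨C + 8 / 7 * h 0, ?_⟩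
    rintro _ ⟨z, hz, rfl⟩
    have h1 := hC (mem_image_of_mem f hz)
    have h2 := hup 0 n z
    rw [hφ0, zero_add] at h2
    have := h0 n
    simp only
    linarith
  have hnear : ∀ n, ∀ z ∈ S, f z + φ n z ≤ f (y n) + φ n (y n) + h n / 4 := fun n =>
    hpk n (φ n) (hbddφ n)
  have hmono : ∀ n j z, φ n z ≤ φ (n + j) z := by
    intro n j z
    induction j with
    | zero => simp
    | succ j ih => rw [← add_assoc, hφ]; exact ih.trans (le_add_of_nonneg_right (hB0 _ _))
  have hhanti : Antitone h := antitone_nat_of_succ_le fun n => by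
    rw [hsucc]; linarith [h0 n]
  -- If `y m` were further than `2⁻ⁿ` from `y n`, the `n`-th bump would give it nothing and give `y
  -- n` the full `h n`. Later bumps recover at most `h n / 7`, and the near-maximality errors at
  -- most `h n / 4 + h n / 32`.
  have hclose : ∀ n m, n < m → ‖y m - y n‖ ≤ (1 / 2) ^ n := by
    intro n m hnm
    by_contra hcon
    obtain ⟨j, rfl⟩ := Nat.exists_eq_add_of_le (Nat.succ_le_of_lt hnm)
    set m := n.succ + j with hm
    have hz : b ((2 : ℝ) ^ n • (y m - y n)) = 0 := by
      refine hb.eq_zero _ ?_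
      rw [norm_smul, norm_pow, Real.norm_two]
      rw [not_le] at hcon
      calc (1 : ℝ) = 2 ^ n * (1 / 2) ^ n := by rw [← mul_pow]; norm_num
        _ ≤ _ := by gcongr
    have e1 := hup (n + 1) j (y m)
    have e2 := hφ n (y m)
    rw [hz, mul_zero, add_zero] at e2
    have e3 := hnear n (y m) (hyS m)
    have e4 := hnear m (y n) (hyS n)
    have e5 := hmono (n + 1) j (y n)
    have e6 := hφ n (y n)
    rw [sub_self, smul_zero, hb.map_zero, mul_one] at e6
    have e7 := hsucc n
    have e8 : h m ≤ h (n + 1) := hhanti (Nat.le_add_right _ _)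
    have e9 := h0 n
    have e10 := h0 m
    change φ m (y m) ≤ φ (n + 1) (y m) + 8 / 7 * (h (n + 1) - h m) at e1
    change φ (n + 1) (y n) ≤ φ m (y n) at e5
    linarith
  have hcau : CauchySeq y := by
    refine cauchySeq_of_le_tendsto_0' (fun n => (1 / 2 : ℝ) ^ n) (fun n m hnm => ?_)
      (tendsto_pow_atTop_nhds_zero_of_lt_one (by norm_num) (by norm_num))
    rcases hnm.eq_or_lt with rfl | hlt
    · simp
    · rw [dist_comm, dist_eq_norm]; exact hclose n m hlt
  obtain ⟨y', hy'⟩ := cauchySeq_tendsto_of_complete hcau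
  have hy'S : y' ∈ S := hS.mem_of_tendsto hy' (Eventually.of_forall hyS)
  have hBd : ∀ n, ContDiff ℝ 1 (B n) := fun n => contDiff_const.mul (hb.contDiff_rescale _ _)
  have hh2 : ∀ n, h n ≤ c * (1 / 2) ^ n ∧ h n * 2 ^ n ≤ c * (1 / 2) ^ n := by
    intro n
    have e : (8 : ℝ) ^ n = 2 ^ n * (2 ^ n * 2 ^ n) := by
      rw [← mul_pow, ← mul_pow]; norm_num
    have e1 : (1 : ℝ) ≤ 2 ^ n := one_le_pow₀ (by norm_num)
    have e2 : (1 / 2 : ℝ) ^ n = 1 / 2 ^ n := by rw [div_pow, one_pow]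
    simp only [hh]
    rw [e, e2]
    constructor
    · rw [div_eq_mul_one_div]
      gcongr
      nlinarith [mul_le_mul e1 e1 zero_le_one (zero_le_one.trans e1)]
    · rw [show c / (2 ^ n * (2 ^ n * 2 ^ n)) * 2 ^ n = c / (2 ^ n * 2 ^ n) by field_simp]
      rw [div_eq_mul_one_div]
      gcongr
      nlinarith
  have hB1 : ∀ n z, ‖B n z‖ ≤ c * (1 / 2) ^ n := fun n z => by
    rw [Real.norm_of_nonneg (hB0 n z)]; exact (hBh n z).trans (hh2 n).1
  have hB2 : ∀ n z, ‖fderiv ℝ (B n) z‖ ≤ c * K * (1 / 2) ^ n := fun n z => by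
    have : fderiv ℝ (B n) z = h n • fderiv ℝ (fun z => b ((2 : ℝ) ^ n • (z - y n))) z :=
      fderiv_const_mul ((hb.contDiff_rescale _ _).differentiable one_ne_zero z) _
    rw [this, norm_smul, Real.norm_of_nonneg (h0 n).le]
    calc _ ≤ h n * (2 ^ n * K) := by
          exact mul_le_mul_of_nonneg_left (hb.norm_fderiv_rescale_le (by positivity) _ _) (h0 n).le
      _ = (h n * 2 ^ n) * K := by ring
      _ ≤ (c * (1 / 2) ^ n) * K := mul_le_mul_of_nonneg_right (hh2 n).2 hK
      _ = _ := by ring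
  have hg := hasSum_geometric_two
  have hsB : ∀ z, Summable fun n => B n z := fun z =>
    Summable.of_norm_bounded (hg.summable.mul_left c) fun n => hB1 n z
  have hψB : ∀ z, ∑' n, B n z ≤ c * 2 := fun z =>
    (le_abs_self _).trans (tsum_of_norm_bounded (hg.mul_left c) fun n => hB1 n z)
  have htend : ∀ z, Tendsto (fun n => φ n z) atTop (𝓝 (∑' n, B n z)) := fun z => by
    simp_rw [hφsum]; exact (hsB z).hasSum.tendsto_sum_nat
  have hψd : ContDiff ℝ 1 fun z => ∑' n, B n z := by
    refine contDiff_tsum (N := 1) (v := fun k n => if k = 0 then c * (1 / 2) ^ n else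
      c * K * (1 / 2) ^ n) hBd ?_ ?_
    · intro k _
      by_cases hk : k = 0
      · simpa only [hk, if_true] using hg.summable.mul_left c
      · simpa only [hk, if_false] using hg.summable.mul_left (c * K)
    · intro k n z hk
      by_cases hk0 : k = 0
      · subst hk0
        rw [norm_iteratedFDeriv_zero, if_pos rfl]; exact hB1 n z
      · have : k = 1 := by
          have : k ≤ 1 := by exact_mod_cast hk
          omega
        subst this
        rw [norm_iteratedFDeriv_one, if_neg one_ne_zero]; exact hB2 n z
  refine ⟨fun z => ∑' n, B n z, hψd, fun z => ⟨tsum_nonneg fun n => hB0 n z,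
    (hψB z).trans hcε.1⟩, fun z => ?_, y', hy'S, fun z hz => ?_⟩
  · rw [fderiv_tsum (hg.summable.mul_left (c * K))
      (fun n => (hBd n).differentiable one_ne_zero) hB2 (hsB z)]
    exact (tsum_of_norm_bounded (hg.mul_left (c * K)) fun n => hB2 n z).trans hcε.2
  -- The factor `2` covers the tail `8 / 7` plus the error `1 / 4`. Passing to the limit along `y n`
  -- then uses only upper semicontinuity at `y'`.
  · have hlow : ∀ n, f z + ∑' n, B n z - 2 * h n ≤ f (y n) + ∑' k, B k (y n) := by
      intro n
      have e1 : ∑' n, B n z ≤ φ n z + 8 / 7 * h n := by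
        refine le_of_tendsto (htend z) (eventually_atTop.2 ⟨n, fun m hm => ?_⟩)
        obtain ⟨j, rfl⟩ := Nat.exists_eq_add_of_le hm
        linarith [hup n j z, h0 (n + j)]
      have e2 : φ n (y n) ≤ ∑' k, B k (y n) := by
        refine ge_of_tendsto (htend (y n)) (eventually_atTop.2 ⟨n, fun m hm => ?_⟩)
        obtain ⟨j, rfl⟩ := Nat.exists_eq_add_of_le hm
        exact hmono n j _
      linarith [hnear n z hz, h0 n]
    have husc : UpperSemicontinuousOn (fun z => f z + ∑' n, B n z) S :=
      hf.add (hψd.continuous.upperSemicontinuous.upperSemicontinuousOn S)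
    have hh0 : Tendsto (fun n => 2 * h n) atTop (𝓝 0) := by
      have : Tendsto (fun n => 2 * (c * (1 / 2 : ℝ) ^ n)) atTop (𝓝 (2 * (c * 0))) :=
        (tendsto_const_nhds.mul (tendsto_const_nhds.mul
          (tendsto_pow_atTop_nhds_zero_of_lt_one (by norm_num) (by norm_num))))
      rw [mul_zero, mul_zero] at this
      exact squeeze_zero (fun n => by linarith [h0 n]) (fun n => by linarith [(hh2 n).1]) this
    refine le_of_forall_pos_lt_add fun δ hδ => ?_
    have h1 := husc y' hy'S (f y' + ∑' n, B n y' + δ / 2) (by simp only; linarith)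
    have h2 : Tendsto y atTop (𝓝[S] y') :=
      tendsto_nhdsWithin_iff.2 ⟨hy', Eventually.of_forall hyS⟩
    obtain ⟨n, hn1, hn2⟩ := ((h2.eventually h1).and
      (hh0.eventually (gt_mem_nhds (by linarith : 0 < δ / 2)))).exists
    have := hlow n
    simp only at hn1
    linarith

end IsUnitBump

/-! ### The fuzzy sum rule -/

/-- Fuzzy sum rule for superdifferentials: at a strong maximum of `f₁ + f₂ + f₃`, with `f₂` and
`f₃` Lipschitz, there are nearby superdifferentials of the three functions with almost vanishing
sum. -/
theorem IsUnitBump.fuzzy_sum_rule {Z : Type*} [NormedAddCommGroup Z] [NormedSpace ℝ Z]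
    [CompleteSpace Z] {b : Z → ℝ} {K : ℝ≥0} (hb : IsUnitBump b K) {f₁ f₂ f₃ : Z → ℝ} {q₀ : Z}
    {r : ℝ} (hr : 0 < r) {C : ℝ≥0}
    (hf₁ : UpperSemicontinuousOn f₁ (Metric.closedBall q₀ r))
    (hf₁b : BddAbove (f₁ '' Metric.closedBall q₀ r))
    (hf₂ : LipschitzOnWith C f₂ (Metric.closedBall q₀ r))
    (hf₃ : LipschitzOnWith C f₃ (Metric.closedBall q₀ r))
    (hmax : ∀ s > 0, ∃ κ > 0, ∀ q ∈ Metric.closedBall q₀ r, s ≤ ‖q - q₀‖ →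
      f₁ q + f₂ q + f₃ q ≤ f₁ q₀ + f₂ q₀ + f₃ q₀ - κ) {σ : ℝ} (hσ : 0 < σ) :
    ∃ (q₁ q₂ q₃ : Z) (G₁ G₂ G₃ : Z → ℝ),
      (q₁ ∈ Metric.ball q₀ σ ∧ ContDiff ℝ 1 G₁ ∧ IsLocalMax (fun q => f₁ q - G₁ q) q₁) ∧
      (q₂ ∈ Metric.ball q₀ σ ∧ ContDiff ℝ 1 G₂ ∧ IsLocalMax (fun q => f₂ q - G₂ q) q₂) ∧
      (q₃ ∈ Metric.ball q₀ σ ∧ ContDiff ℝ 1 G₃ ∧ IsLocalMax (fun q => f₃ q - G₃ q) q₃) ∧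
      ‖fderiv ℝ G₁ q₁ + fderiv ℝ G₂ q₂ + fderiv ℝ G₃ q₃‖ ≤ σ := by
  set s : ℝ := min σ r / 2 with hs
  have hs0 : 0 < s := by positivity
  have hsσ : 2 * s ≤ σ := by rw [hs]; linarith [min_le_left σ r]
  have hsr : 2 * s ≤ r := by rw [hs]; linarith [min_le_right σ r]
  obtain ⟨κ, hκ, hmax⟩ := hmax s hs0
  obtain ⟨B, hB⟩ := hf₁b
  have hq₀ : q₀ ∈ Metric.closedBall q₀ r := Metric.mem_closedBall_self hr.le
  set F : Z → ℝ := fun q => f₁ q + f₂ q + f₃ q with hF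
  have hC : (0 : ℝ) ≤ C := C.2
  -- Moving `q₂` and `q₃` to `q₁` will cost at most `2 C τ ≤ κ / 2`; with the loss `ε ≤ κ / 4` of
  -- the perturbation this stays below the gap `κ`.
  set τ : ℝ := min s (κ / (4 * (C + 1))) with hτ
  have hτ0 : 0 < τ := by positivity
  have hτs : τ ≤ s := min_le_left _ _
  have hτC : 2 * C * τ ≤ κ / 2 := by
    have h1 : τ ≤ κ / (4 * (C + 1)) := min_le_right _ _
    rw [le_div_iff₀ (by positivity)] at h1
    nlinarith
  -- The height of the penalty is such that a triple with a coordinate difference of norm at least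
  -- `τ` has value at most `F q₀ - 1`, too little for an `ε`-almost maximum.
  set N : ℝ := B + f₂ q₀ + f₃ q₀ + 2 * C * r - F q₀ + 1 with hN
  have hN1 : 1 ≤ N := by
    have := hB (mem_image_of_mem f₁ hq₀)
    have : 0 ≤ C * r := by positivity
    simp only [hN, hF]
    linarith
  -- `D` vanishes on the diagonal, so the penalty will not contribute to the sum of the three
  -- derivatives, however steep it is.
  set D : Z × Z × Z →L[ℝ] Z × Z :=
    ((ContinuousLinearMap.fst ℝ Z Z ∘L ContinuousLinearMap.snd ℝ Z (Z × Z)) -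
      ContinuousLinearMap.fst ℝ Z (Z × Z)).prod
    ((ContinuousLinearMap.snd ℝ Z Z ∘L ContinuousLinearMap.snd ℝ Z (Z × Z)) -
      ContinuousLinearMap.fst ℝ Z (Z × Z)) with hD
  have hDapp : ∀ a b c : Z, D (a, b, c) = (b - a, c - a) := fun a b c => rfl
  have hbb := hb.prod hb
  set β : Z × Z → ℝ := fun p => b p.1 * b p.2 with hβ
  set pen : Z × Z → ℝ := fun p => N * (1 - β (τ⁻¹ • (p - 0))) with hpen
  have hpend : ContDiff ℝ 1 pen :=
    contDiff_const.mul (contDiff_const.sub (hbb.contDiff_rescale τ⁻¹ 0))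
  have hpen0 : ∀ p, 0 ≤ pen p := fun p =>
    mul_nonneg (zero_le_one.trans hN1) (sub_nonneg.2 (hbb.le_one _))
  have hpenN : ∀ p, τ ≤ ‖p‖ → pen p = N := by
    intro p hp
    have : β (τ⁻¹ • (p - 0)) = 0 := by
      refine hbb.eq_zero _ ?_
      rw [sub_zero, norm_smul, Real.norm_of_nonneg (by positivity), ← div_eq_inv_mul,
        le_div_iff₀ hτ0, one_mul]
      exact hp
    simp only [hpen]
    rw [this, sub_zero, mul_one]
  set S : Set (Z × Z × Z) := Metric.closedBall q₀ r ×ˢ Metric.closedBall q₀ r ×ˢ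
    Metric.closedBall q₀ r with hS
  have hScl : IsClosed S :=
    Metric.isClosed_closedBall.prod (Metric.isClosed_closedBall.prod Metric.isClosed_closedBall)
  set f : Z × Z × Z → ℝ := fun p => f₁ p.1 + (f₂ p.2.1 + f₃ p.2.2 - pen (D p)) with hf
  have hfu : UpperSemicontinuousOn f S := by
    refine UpperSemicontinuousOn.add ?_ (ContinuousOn.upperSemicontinuousOn ?_)
    · exact hf₁.comp continuous_fst.continuousOn fun p hp => hp.1
    · refine ContinuousOn.sub (ContinuousOn.add ?_ ?_)
        (hpend.continuous.comp D.continuous).continuousOn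
      · exact hf₂.continuousOn.comp (by fun_prop) fun p hp => hp.2.1
      · exact hf₃.continuousOn.comp (by fun_prop) fun p hp => hp.2.2
  have hL : ∀ {g : Z → ℝ}, LipschitzOnWith C g (Metric.closedBall q₀ r) →
      ∀ q ∈ Metric.closedBall q₀ r, ∀ q' ∈ Metric.closedBall q₀ r, g q ≤ g q' + C * ‖q - q'‖ := by
    intro g hg q hq q' hq'
    have := hg.dist_le_mul q hq q' hq'
    rw [Real.dist_eq, dist_eq_norm] at this
    linarith [le_abs_self (g q - g q')]
  have hLr : ∀ {g : Z → ℝ}, LipschitzOnWith C g (Metric.closedBall q₀ r) →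
      ∀ q ∈ Metric.closedBall q₀ r, g q ≤ g q₀ + C * r := by
    intro g hg q hq
    refine (hL hg q hq q₀ hq₀).trans ?_
    have := mem_closedBall_iff_norm.1 hq
    gcongr
  have hfle : ∀ p ∈ S, f p ≤ B + f₂ q₀ + f₃ q₀ + 2 * C * r - pen (D p) := by
    intro p hp
    have e1 := hB (mem_image_of_mem f₁ hp.1)
    have e2 := hLr hf₂ _ hp.2.1
    have e3 := hLr hf₃ _ hp.2.2
    simp only [hf]
    linarith
  have hfb : BddAbove (f '' S) := by
    refine ⟨B + f₂ q₀ + f₃ q₀ + 2 * C * r, ?_⟩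
    rintro _ ⟨p, hp, rfl⟩
    linarith [hfle p hp, hpen0 (D p)]
  have hbbb := hb.prod hbb
  set ε : ℝ := min σ (min (κ / 4) (1 / 2)) with hε
  have hε0 : 0 < ε := by positivity
  have hεσ : ε ≤ σ := min_le_left _ _
  have hεκ : ε ≤ κ / 4 := (min_le_right _ _).trans (min_le_left _ _)
  have hε1 : ε ≤ 1 / 2 := (min_le_right _ _).trans (min_le_right _ _)
  have hp₀S : (q₀, q₀, q₀) ∈ S := ⟨hq₀, hq₀, hq₀⟩
  obtain ⟨ψ, hψ, hψε, hψd, ⟨q₁, q₂, q₃⟩, ⟨hq₁, hq₂, hq₃⟩, hpmax⟩ :=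
    hbbb.exists_perturbation_isMaxOn hScl ⟨_, hp₀S⟩ hfu hfb hε0
  simp only at hq₁ hq₂ hq₃
  have hf0 : f (q₀, q₀, q₀) = F q₀ := by
    have : pen (0, 0) = 0 := by
      have : β 0 = 1 := hbb.map_zero
      simp only [hpen, sub_zero]
      rw [show ((0 : Z), (0 : Z)) = 0 from rfl, smul_zero, this]; ring
    simp only [hf, hF, hDapp, sub_self, this]; ring
  have hval : F q₀ - ε ≤ f (q₁, q₂, q₃) := by
    have h1 := hpmax _ hp₀S
    have h2 := (hψε (q₀, q₀, q₀)).1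
    have h3 := (hψε (q₁, q₂, q₃)).2
    rw [hf0] at h1
    linarith
  have hclose : ‖q₂ - q₁‖ < τ ∧ ‖q₃ - q₁‖ < τ := by
    have : ‖D (q₁, q₂, q₃)‖ < τ := by
      by_contra hcon
      have h1 := hfle (q₁, q₂, q₃) ⟨hq₁, hq₂, hq₃⟩
      rw [hpenN _ (not_lt.1 hcon), hN] at h1
      linarith
    rw [hDapp, Prod.norm_def, max_lt_iff] at this
    exact this
  -- Since `f₁` is only semicontinuous, the comparison is made at `q₁`, and the Lipschitz terms `f₂`
  -- and `f₃` are transported there.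
  have hF1 : F q₀ - κ < F q₁ := by
    have e2 := hL hf₂ q₂ hq₂ q₁ hq₁
    have e3 := hL hf₃ q₃ hq₃ q₁ hq₁
    have e4 : C * ‖q₂ - q₁‖ ≤ C * τ := by gcongr; exact hclose.1.le
    have e5 : C * ‖q₃ - q₁‖ ≤ C * τ := by gcongr; exact hclose.2.le
    have e6 := hpen0 (D (q₁, q₂, q₃))
    simp only [hf] at hval
    simp only [hF] at hval ⊢
    linarith
  have hn1 : ‖q₁ - q₀‖ < s := by
    by_contra hcon
    exact absurd hF1 (not_lt.2 (hmax q₁ hq₁ (not_lt.1 hcon)))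
  have hn2 : ‖q₂ - q₀‖ < 2 * s := by
    linarith [norm_sub_le_norm_sub_add_norm_sub q₂ q₁ q₀, hclose.1]
  have hn3 : ‖q₃ - q₀‖ < 2 * s := by
    linarith [norm_sub_le_norm_sub_add_norm_sub q₃ q₁ q₀, hclose.2]
  -- Freezing two coordinates at the maximum leaves a test function for the remaining `fᵢ`; all
  -- three are slices of `Q`.
  set Q : Z × Z × Z → ℝ := fun p => pen (D p) - ψ p with hQ
  have hQd : ContDiff ℝ 1 Q := (hpend.comp D.contDiff).sub hψ
  have hnhds : ∀ q, ‖q - q₀‖ < r → ∀ᶠ q' in 𝓝 q, q' ∈ Metric.closedBall q₀ r := fun q hq =>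
    mem_of_superset (Metric.isOpen_ball.mem_nhds (mem_ball_iff_norm.2 hq))
      Metric.ball_subset_closedBall
  have hQf : HasFDerivAt Q (fderiv ℝ Q (q₁, q₂, q₃)) (q₁, q₂, q₃) :=
    (hQd.differentiable one_ne_zero _).hasFDerivAt
  refine ⟨q₁, q₂, q₃, fun q => Q (q, q₂, q₃), fun q => Q (q₁, q, q₃), fun q => Q (q₁, q₂, q),
    ⟨mem_ball_iff_norm.2 (by linarith), hQd.comp (by fun_prop), ?_⟩,
    ⟨mem_ball_iff_norm.2 (by linarith), hQd.comp (by fun_prop), ?_⟩,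
    ⟨mem_ball_iff_norm.2 (by linarith), hQd.comp (by fun_prop), ?_⟩, ?_⟩
  · filter_upwards [hnhds q₁ (by linarith)] with q hq
    have := hpmax (q, q₂, q₃) ⟨hq, hq₂, hq₃⟩
    simp only [hf, hQ] at this ⊢
    linarith
  · filter_upwards [hnhds q₂ (by linarith)] with q hq
    have := hpmax (q₁, q, q₃) ⟨hq₁, hq, hq₃⟩
    simp only [hf, hQ] at this ⊢
    linarith
  · filter_upwards [hnhds q₃ (by linarith)] with q hq
    have := hpmax (q₁, q₂, q) ⟨hq₁, hq₂, hq⟩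
    simp only [hf, hQ] at this ⊢
    linarith
  · have d1 : HasFDerivAt (fun q => Q (q, q₂, q₃)) (fderiv ℝ Q (q₁, q₂, q₃) ∘L
        ((ContinuousLinearMap.id ℝ Z).prod 0)) q₁ :=
      HasFDerivAt.comp q₁ (f := fun q => (q, q₂, q₃)) hQf
        ((hasFDerivAt_id q₁).prodMk (hasFDerivAt_const (q₂, q₃) q₁))
    have d2 : HasFDerivAt (fun q => Q (q₁, q, q₃)) (fderiv ℝ Q (q₁, q₂, q₃) ∘L
        ((0 : Z →L[ℝ] Z).prod ((ContinuousLinearMap.id ℝ Z).prod 0))) q₂ :=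
      HasFDerivAt.comp q₂ (f := fun q => (q₁, q, q₃)) hQf
        ((hasFDerivAt_const q₁ q₂).prodMk ((hasFDerivAt_id q₂).prodMk (hasFDerivAt_const q₃ q₂)))
    have d3 : HasFDerivAt (fun q => Q (q₁, q₂, q)) (fderiv ℝ Q (q₁, q₂, q₃) ∘L
        ((0 : Z →L[ℝ] Z).prod ((0 : Z →L[ℝ] Z).prod (ContinuousLinearMap.id ℝ Z)))) q₃ :=
      HasFDerivAt.comp q₃ (f := fun q => (q₁, q₂, q)) hQf
        ((hasFDerivAt_const q₁ q₃).prodMk ((hasFDerivAt_const q₂ q₃).prodMk (hasFDerivAt_id q₃)))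
    have dQ : fderiv ℝ Q (q₁, q₂, q₃) = fderiv ℝ pen (D (q₁, q₂, q₃)) ∘L D -
        fderiv ℝ ψ (q₁, q₂, q₃) :=
      (((hpend.differentiable one_ne_zero _).hasFDerivAt.comp _ D.hasFDerivAt).sub
        (hψ.differentiable one_ne_zero _).hasFDerivAt).fderiv
    rw [d1.fderiv, d2.fderiv, d3.fderiv]
    refine ContinuousLinearMap.opNorm_le_bound _ hσ.le fun z => ?_
    -- The sum of the partial derivatives is the derivative of `Q` along the diagonal, where only
    -- `-ψ` survives.
    have : (fderiv ℝ Q (q₁, q₂, q₃) ∘L ((ContinuousLinearMap.id ℝ Z).prod 0) +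
        fderiv ℝ Q (q₁, q₂, q₃) ∘L ((0 : Z →L[ℝ] Z).prod ((ContinuousLinearMap.id ℝ Z).prod 0)) +
        fderiv ℝ Q (q₁, q₂, q₃) ∘L ((0 : Z →L[ℝ] Z).prod ((0 : Z →L[ℝ] Z).prod
          (ContinuousLinearMap.id ℝ Z)))) z = - fderiv ℝ ψ (q₁, q₂, q₃) (z, z, z) := by
      have e : fderiv ℝ Q (q₁, q₂, q₃) (z, z, z) = - fderiv ℝ ψ (q₁, q₂, q₃) (z, z, z) := by
        rw [dQ]
        simp [hDapp]
        exact (fderiv ℝ pen (q₂ - q₁, q₃ - q₁)).map_zero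
      rw [← e]
      simp only [_root_.add_apply, ContinuousLinearMap.comp_apply,
        ContinuousLinearMap.prod_apply, ContinuousLinearMap.id_apply,
        _root_.zero_apply]
      rw [← map_add, ← map_add]
      simp
    rw [this, norm_neg]
    refine ((fderiv ℝ ψ (q₁, q₂, q₃)).le_opNorm _).trans ?_
    have : ‖(z, z, z)‖ = ‖z‖ := by simp [Prod.norm_def]
    rw [this]
    gcongr
    exact (hψd _).trans hεσ

/-! ### Finsler norms in charts and lengths of paths -/

namespace PalaisFinsler

variable {E : Type*} [NormedAddCommGroup E] [NormedSpace ℝ E]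
  {M : Type*} [TopologicalSpace M] [ChartedSpace E M] [IsManifold 𝓘(ℝ, E) 1 M]

/-- The norm at the point of coordinate `y`, read in the preferred chart at `x₀`. -/
noncomputable def chartNorm (F : PalaisFinsler E M) (x₀ : M) (y v : E) : ℝ :=
  F.tnorm ((chartAt E x₀).symm y) (mfderiv 𝓘(ℝ, E) 𝓘(ℝ, E) (chartAt E x₀).symm y v)

/-- Every tangent space is the model space `E` by definition, so a vector can be moved along an
equality of base points by substitution. -/
theorem tnorm_congr (F : PalaisFinsler E M) {x x' : M} {v v' : E} (hx : x = x') (hv : v = v') :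
    F.tnorm x v = F.tnorm x' v' := by subst hx hv; rfl

theorem tnorm_neg (F : PalaisFinsler E M) (x : M) (v : TangentSpace 𝓘(ℝ, E) x) :
    F.tnorm x (-v) = F.tnorm x v := by
  have := F.smul x (-1) v
  rwa [neg_one_smul, abs_neg, abs_one, one_mul] at this

theorem mdifferentiable_chartAt (x₀ : M) :
    (chartAt E x₀).MDifferentiable 𝓘(ℝ, E) 𝓘(ℝ, E) :=
  _root_.mdifferentiable_chart x₀

theorem mfderiv_chartAt_symm_apply (x₀ : M) {y : E} (hy : y ∈ (chartAt E x₀).target) (v : E) :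
    (mfderiv 𝓘(ℝ, E) 𝓘(ℝ, E) (chartAt E x₀) ((chartAt E x₀).symm y)
      (mfderiv 𝓘(ℝ, E) 𝓘(ℝ, E) (chartAt E x₀).symm y v) : E) = v :=
  DFunLike.congr_fun ((mdifferentiable_chartAt (E := E) x₀).comp_symm_deriv hy) v

theorem mfderiv_symm_chartAt_apply (x₀ : M) {x : M} (hx : x ∈ (chartAt E x₀).source)
    (ξ : TangentSpace 𝓘(ℝ, E) x) :
    (mfderiv 𝓘(ℝ, E) 𝓘(ℝ, E) (chartAt E x₀).symm (chartAt E x₀ x)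
      (mfderiv 𝓘(ℝ, E) 𝓘(ℝ, E) (chartAt E x₀) x ξ) : E) = ξ :=
  DFunLike.congr_fun ((mdifferentiable_chartAt (E := E) x₀).symm_comp_deriv hx) ξ

theorem chartNorm_mfderiv (F : PalaisFinsler E M) (x₀ : M) {x : M}
    (hx : x ∈ (chartAt E x₀).source) (ξ : TangentSpace 𝓘(ℝ, E) x) :
    F.chartNorm x₀ (chartAt E x₀ x) (mfderiv 𝓘(ℝ, E) 𝓘(ℝ, E) (chartAt E x₀) x ξ) = F.tnorm x ξ :=
  F.tnorm_congr ((chartAt E x₀).left_inv hx) (mfderiv_symm_chartAt_apply x₀ hx ξ)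

theorem chartNorm_nonneg (F : PalaisFinsler E M) (x₀ : M) (y v : E) : 0 ≤ F.chartNorm x₀ y v :=
  F.nonneg _ _

theorem chartNorm_smul (F : PalaisFinsler E M) (x₀ : M) (y v : E) (c : ℝ) :
    F.chartNorm x₀ y (c • v) = |c| * F.chartNorm x₀ y v :=
  (F.tnorm_congr rfl (map_smul (mfderiv 𝓘(ℝ, E) 𝓘(ℝ, E) (chartAt E x₀).symm y) c v)).trans
    (F.smul _ c _)

theorem chartNorm_equiv (F : PalaisFinsler E M) (x₀ : M) {y : E}
    (hy : y ∈ (chartAt E x₀).target) :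
    ∃ K : ℝ, 1 ≤ K ∧ ∀ v, ‖v‖ ≤ K * F.chartNorm x₀ y v ∧ F.chartNorm x₀ y v ≤ K * ‖v‖ := by
  obtain ⟨K, hK, h⟩ := F.equivalent (chartAt E x₀) (IsManifold.chart_mem_maximalAtlas x₀)
    ((chartAt E x₀).symm y) ((chartAt E x₀).map_target hy)
  rw [(chartAt E x₀).right_inv hy] at h
  refine ⟨K, hK, fun v => ⟨?_, (h v).2⟩⟩
  have := (h v).1
  rwa [inv_mul_le_iff₀ (by linarith)] at this

theorem eventually_chartNorm_le (F : PalaisFinsler E M) (x₀ : M) {y : E}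
    (hy : y ∈ (chartAt E x₀).target) {ε : ℝ} (hε : 0 < ε) :
    ∀ᶠ z in 𝓝 y, z ∈ (chartAt E x₀).target ∧ ∀ v,
      F.chartNorm x₀ y v ≤ (1 + ε) * F.chartNorm x₀ z v ∧
      F.chartNorm x₀ z v ≤ (1 + ε) * F.chartNorm x₀ y v := by
  obtain ⟨W, hWo, hyW, hWs, h⟩ := F.palais ((chartAt E x₀).symm y) ε hε (chartAt E x₀)
    (IsManifold.chart_mem_maximalAtlas x₀) ((chartAt E x₀).map_target hy)
  have h1 := ((chartAt E x₀).continuousAt_symm hy).preimage_mem_nhds (hWo.mem_nhds hyW)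
  filter_upwards [h1, (chartAt E x₀).open_target.mem_nhds hy] with z hz hzt
  refine ⟨hzt, fun v => ?_⟩
  have := h _ hz v
  rw [(chartAt E x₀).right_inv hy, (chartAt E x₀).right_inv hzt, inv_mul_le_iff₀ (by linarith)]
    at this
  exact this

/-- The speed of a path. -/
noncomputable def speed (F : PalaisFinsler E M) (γ : ℝ → M) (t : ℝ) : ℝ :=
  F.tnorm (γ t) (mfderiv 𝓘(ℝ, ℝ) 𝓘(ℝ, E) γ t (1 : ℝ))

theorem length_eq (F : PalaisFinsler E M) (γ : ℝ → M) (a b : ℝ) :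
    F.length γ a b = ∫⁻ t in Icc a b, ENNReal.ofReal (F.speed γ t) := rfl

theorem speed_congr (F : PalaisFinsler E M) {γ γ' : ℝ → M} {t : ℝ} (h : γ =ᶠ[𝓝 t] γ') :
    F.speed γ t = F.speed γ' t :=
  F.tnorm_congr h.eq_of_nhds (DFunLike.congr_fun (h.mfderiv_eq (I := 𝓘(ℝ, ℝ)) (I' := 𝓘(ℝ, E))) _)

/-- The endpoints are negligible, so paths can be glued without matching one-sided derivatives. -/
theorem length_congr (F : PalaisFinsler E M) {γ γ' : ℝ → M} {a b : ℝ}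
    (h : EqOn γ γ' (Ioo a b)) : F.length γ a b = F.length γ' a b := by
  rw [length_eq, length_eq, ← setLIntegral_congr Ioo_ae_eq_Icc, ← setLIntegral_congr Ioo_ae_eq_Icc]
  refine setLIntegral_congr_fun measurableSet_Ioo fun t ht => ?_
  rw [F.speed_congr (h.eventuallyEq_of_mem (Ioo_mem_nhds ht.1 ht.2))]

theorem length_add (F : PalaisFinsler E M) (γ : ℝ → M) {a b c : ℝ} (h : a ≤ b) (h' : b ≤ c) :
    F.length γ a b + F.length γ b c = F.length γ a c := by
  have : Icc a c = Icc a b ∪ Ioc b c := (Icc_union_Ioc_eq_Icc h h').symm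
  rw [length_eq F γ a c, this, lintegral_union measurableSet_Ioc, length_eq, length_eq,
    setLIntegral_congr (Ioc_ae_eq_Icc (a := b))]
  exact disjoint_iff_forall_ne.mpr (fun a ha b hb ↦ (ha.2.trans_lt hb.1).ne)

/-- At points of differentiability this is the chain rule. Elsewhere both derivatives take the
default value `0`: a second reflection shows that the two sides are differentiable together. -/
theorem speed_reflect (F : PalaisFinsler E M) (γ : ℝ → M) (e t : ℝ) :
    F.speed (fun s => γ (e - s)) t = F.speed γ (e - t) := by
  have hr : ∀ t : ℝ, HasMFDerivAt 𝓘(ℝ, ℝ) 𝓘(ℝ, ℝ) (fun s : ℝ => e - s) t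
      (-ContinuousLinearMap.id ℝ ℝ) := fun t =>
    ((hasFDerivAt_id t).const_sub e).hasMFDerivAt
  have key : ∀ (γ : ℝ → M) (t : ℝ), MDifferentiableAt 𝓘(ℝ, ℝ) 𝓘(ℝ, E) γ (e - t) →
      MDifferentiableAt 𝓘(ℝ, ℝ) 𝓘(ℝ, E) (fun s => γ (e - s)) t ∧
      F.speed (fun s => γ (e - s)) t = F.speed γ (e - t) := by
    intro γ t h
    have h1 := HasMFDerivAt.comp t (g := γ) (f := fun s : ℝ => e - s) h.hasMFDerivAt (hr t)
    refine ⟨h1.mdifferentiableAt, ?_⟩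
    refine Eq.trans ?_ (F.tnorm_neg _ _)
    refine F.tnorm_congr rfl ?_
    rw [show (fun s => γ (e - s)) = γ ∘ fun s : ℝ => e - s from rfl, h1.mfderiv]
    exact map_neg (mfderiv 𝓘(ℝ, ℝ) 𝓘(ℝ, E) γ (e - t)) (1 : ℝ)
  by_cases h : MDifferentiableAt 𝓘(ℝ, ℝ) 𝓘(ℝ, E) γ (e - t)
  · exact (key γ t h).2
  · have h' : ¬ MDifferentiableAt 𝓘(ℝ, ℝ) 𝓘(ℝ, E) (fun s => γ (e - s)) t := by
      intro h'
      refine h ?_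
      have := (key (fun s => γ (e - s)) (e - t) (by rwa [sub_sub_cancel])).1
      simpa only [sub_sub_cancel] using this
    refine F.tnorm_congr rfl ?_
    rw [mfderiv_zero_of_not_mdifferentiableAt h, mfderiv_zero_of_not_mdifferentiableAt h']
    rfl

theorem length_reflect (F : PalaisFinsler E M) (γ : ℝ → M) (a b e : ℝ) :
    F.length (fun s => γ (e - s)) (e - b) (e - a) = F.length γ a b := by
  have h := (volume.measurePreserving_sub_left e).setLIntegral_comp_preimage_emb
    (Homeomorph.subLeft e).measurableEmbedding (fun t => ENNReal.ofReal (F.speed γ t)) (Icc a b)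
  rw [preimage_const_sub_Icc] at h
  rw [length_eq, length_eq, ← h]
  simp only [F.speed_reflect]

end PalaisFinsler

theorem IsPiecewiseC1.reflect {E : Type*} [NormedAddCommGroup E] [NormedSpace ℝ E]
    {M : Type*} [TopologicalSpace M] [ChartedSpace E M] {γ : ℝ → M} {a b : ℝ}
    (h : IsPiecewiseC1 E γ a b) (e : ℝ) :
    IsPiecewiseC1 E (fun s => γ (e - s)) (e - b) (e - a) := by
  obtain ⟨n, s, hs, h0, hn, hc⟩ := h
  refine ⟨n, fun i => e - s (n - i), fun i j hij => ?_, by simp [hn], by simp [h0], fun i hi => ?_⟩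
  · have := hs (Nat.sub_le_sub_left hij n)
    simp only
    linarith
  · have h1 := hc (n - (i + 1)) (by omega)
    rw [show n - (i + 1) + 1 = n - i by omega] at h1
    have h2 : ContMDiff 𝓘(ℝ, ℝ) 𝓘(ℝ, ℝ) 1 (fun s : ℝ => e - s) :=
      (contDiff_const.sub contDiff_id).contMDiff
    refine h1.comp h2.contMDiffOn fun t ht => ?_
    simp only [mem_preimage, mem_Icc] at ht ⊢
    constructor <;> linarith [ht.1, ht.2]

theorem IsPiecewiseC1.concat {E : Type*} [NormedAddCommGroup E] [NormedSpace ℝ E]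
    {M : Type*} [TopologicalSpace M] [ChartedSpace E M] {γ : ℝ → M} {a b c : ℝ}
    (h : IsPiecewiseC1 E γ a b) (h' : IsPiecewiseC1 E γ b c) : IsPiecewiseC1 E γ a c := by
  obtain ⟨n, s, hs, h0, hn, hc⟩ := h
  obtain ⟨n', s', hs', h0', hn', hc'⟩ := h'
  -- At index `n` the two subdivisions agree, which lets the subinterval number `n` be read as the
  -- first one of the second path.
  refine ⟨n + n', fun i => if i ≤ n then s i else s' (i - n), ?_, by simp [h0], ?_, fun i hi => ?_⟩
  · intro i j hij
    simp only
    split_ifs with hi hj hj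
    · exact hs hij
    · calc s i ≤ s n := hs hi
        _ = s' 0 := by rw [hn, h0']
        _ ≤ _ := hs' (Nat.zero_le _)
    · omega
    · exact hs' (by omega)
  · simp only
    split_ifs with h
    · have : n' = 0 := by omega
      subst this
      rw [add_zero, hn, ← h0', hn']
    · rw [Nat.add_sub_cancel_left, hn']
  · simp only
    by_cases h1 : i + 1 ≤ n
    · rw [if_pos h1, if_pos (by omega)]
      exact hc i (by omega)
    · have h2 : (if i ≤ n then s i else s' (i - n)) = s' (i - n) := by
        split_ifs with h
        · have : i = n := by omega
          rw [this, Nat.sub_self, hn, h0']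
        · rfl
      rw [if_neg h1, h2, show i + 1 - n = i - n + 1 by omega]
      exact hc' _ (by omega)

theorem IsPiecewiseC1.congr {E : Type*} [NormedAddCommGroup E] [NormedSpace ℝ E]
    {M : Type*} [TopologicalSpace M] [ChartedSpace E M] {γ γ' : ℝ → M} {a b : ℝ}
    (h : IsPiecewiseC1 E γ a b) (he : EqOn γ' γ (Icc a b)) : IsPiecewiseC1 E γ' a b := by
  obtain ⟨n, s, hs, h0, hn, hc⟩ := h
  refine ⟨n, s, hs, h0, hn, fun i hi => (hc i hi).congr fun t ht => he ⟨?_, ?_⟩⟩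
  · exact (h0 ▸ hs (Nat.zero_le i)).trans ht.1
  · exact ht.2.trans (hn ▸ hs (Nat.succ_le_of_lt hi))

/-! ### The Finsler distance -/

namespace PalaisFinsler

variable {E : Type*} [NormedAddCommGroup E] [NormedSpace ℝ E]
  {M : Type*} [TopologicalSpace M] [ChartedSpace E M] [IsManifold 𝓘(ℝ, E) 1 M]

/-- The Finsler distance with values in `[0, ∞]`. -/
noncomputable def fedist (F : PalaisFinsler E M) (x y : M) : ℝ≥0∞ :=
  sInf {ℓ : ℝ≥0∞ | ∃ (γ : ℝ → M) (a b : ℝ), a ≤ b ∧ IsPiecewiseC1 E γ a b ∧ γ a = x ∧ γ b = y ∧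
    ℓ = F.length γ a b}

theorem fdist_eq (F : PalaisFinsler E M) (x y : M) : F.fdist x y = (F.fedist x y).toReal := rfl

theorem fdist_nonneg (F : PalaisFinsler E M) (x y : M) : 0 ≤ F.fdist x y := ENNReal.toReal_nonneg

theorem fedist_le_length (F : PalaisFinsler E M) {γ : ℝ → M} {a b : ℝ} (hab : a ≤ b)
    (hγ : IsPiecewiseC1 E γ a b) : F.fedist (γ a) (γ b) ≤ F.length γ a b :=
  sInf_le ⟨γ, a, b, hab, hγ, rfl, rfl, rfl⟩

theorem fedist_self (F : PalaisFinsler E M) (x : M) : F.fedist x x = 0 := by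
  have h : IsPiecewiseC1 E (fun _ => x) (0 : ℝ) 0 :=
    ⟨0, fun _ => 0, monotone_const, rfl, rfl, fun i hi => absurd hi (Nat.not_lt_zero i)⟩
  have := F.fedist_le_length le_rfl h
  refine le_antisymm (this.trans_eq ?_) zero_le
  simp [length_eq]

theorem fedist_comm (F : PalaisFinsler E M) (x y : M) : F.fedist x y = F.fedist y x := by
  have key : ∀ x y, F.fedist x y ≤ F.fedist y x := by
    intro x y
    refine le_sInf ?_
    rintro _ ⟨γ, a, b, hab, hγ, rfl, rfl, rfl⟩
    have := F.fedist_le_length (by linarith) (hγ.reflect 0)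
    rw [F.length_reflect] at this
    simpa using this
  exact le_antisymm (key x y) (key y x)

theorem fedist_triangle (F : PalaisFinsler E M) (x y z : M) :
    F.fedist x z ≤ F.fedist x y + F.fedist y z := by
  unfold fedist
  rw [ENNReal.sInf_add]
  refine le_iInf₂ ?_
  rintro _ ⟨γ, a, b, hab, hγ, rfl, rfl, rfl⟩
  rw [add_comm, ENNReal.sInf_add]
  refine le_iInf₂ ?_
  rintro _ ⟨γ', c, d, hcd, hγ', hc, rfl, rfl⟩
  -- Two reflections compose to the translation that makes the second path start at time `b`.
  have h2 := (hγ'.reflect 0).reflect (b - c)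
  set γ'' : ℝ → M := fun s => (fun s => γ' (0 - s)) (b - c - s) with hγ''
  rw [show b - c - (0 - c) = b by ring] at h2
  set e := b - c - (0 - d) with he
  have hbe : b ≤ e := by rw [he]; linarith
  have hlen : F.length γ'' b e = F.length γ' c d := by
    rw [← F.length_reflect γ' c d 0, ← F.length_reflect _ (0 - d) (0 - c) (b - c),
      show b - c - (0 - c) = b by ring]
  have hγb : γ'' b = γ b := by
    simp only [hγ'']; rw [← hc]; congr 1; ring
  have hγe : γ'' e = γ' d := by
    simp only [hγ'', he]; congr 1; ring
  set Γ : ℝ → M := fun t => if t ≤ b then γ t else γ'' t with hΓ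
  have e1 : EqOn Γ γ (Icc a b) := fun t ht => if_pos ht.2
  have e2 : EqOn Γ γ'' (Icc b e) := by
    intro t ht
    simp only [hΓ]
    split_ifs with h
    · rw [le_antisymm h ht.1, hγb]
    · rfl
  have hpc : IsPiecewiseC1 E Γ a e := (hγ.congr e1).concat (h2.congr e2)
  have := F.fedist_le_length (hab.trans hbe) hpc
  rw [← F.length_add Γ hab hbe, F.length_congr (e1.mono Ioo_subset_Icc_self),
    F.length_congr (e2.mono Ioo_subset_Icc_self), hlen, e1 ⟨le_rfl, hab⟩, e2 ⟨hbe, le_rfl⟩, hγe]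
    at this
  rwa [add_comm]

/-- Short straight segments in a chart bound the Finsler distance from above. -/
theorem eventually_fedist_le (F : PalaisFinsler E M) (x₀ : M) {y : E}
    (hy : y ∈ (chartAt E x₀).target) {ε : ℝ} (hε : 0 < ε) :
    ∃ δ > 0, Metric.ball y δ ⊆ (chartAt E x₀).target ∧ ∀ z ∈ Metric.ball y δ,
      ∀ z' ∈ Metric.ball y δ, F.fedist ((chartAt E x₀).symm z) ((chartAt E x₀).symm z') ≤
        ENNReal.ofReal ((1 + ε) * F.chartNorm x₀ y (z' - z)) := by
  obtain ⟨δ, hδ, hball⟩ := Metric.eventually_nhds_iff_ball.1 (F.eventually_chartNorm_le x₀ hy hε)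
  refine ⟨δ, hδ, fun z hz => (hball z hz).1, fun z hz z' hz' => ?_⟩
  set φ := chartAt E x₀
  set ℓ : ℝ → E := fun t => z + t • (z' - z) with hℓ
  have hℓb : ∀ t ∈ Icc (0 : ℝ) 1, ℓ t ∈ Metric.ball y δ := fun t ht =>
    (convex_ball y δ).add_smul_sub_mem hz hz' ht
  have hℓd : ContDiff ℝ 1 ℓ := by fun_prop
  have hℓ' : ∀ t, HasFDerivAt ℓ (ContinuousLinearMap.smulRight (1 : ℝ →L[ℝ] ℝ) (z' - z)) t :=
    fun t => ((hasFDerivAt_id t).smul_const (z' - z)).const_add z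
  set γ : ℝ → M := fun t => φ.symm (ℓ t) with hγ
  have hγC : ContMDiffOn 𝓘(ℝ, ℝ) 𝓘(ℝ, E) 1 γ (Icc 0 1) :=
    (contMDiffOn_chart_symm (I := 𝓘(ℝ, E)) (n := 1) (x := x₀)).comp hℓd.contMDiff.contMDiffOn
      fun t ht => (hball _ (hℓb t ht)).1
  have hpc : IsPiecewiseC1 E γ 0 1 := by
    refine ⟨1, fun i => ((min i 1 : ℕ) : ℝ), fun i j hij => ?_, by simp, by simp, fun i hi => ?_⟩
    · simp only [Nat.cast_le]; omega
    · have : i = 0 := by omega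
      subst this
      simpa using hγC
  have h01 := F.fedist_le_length zero_le_one hpc
  have e0 : γ 0 = φ.symm z := by simp [hγ, hℓ]
  have e1 : γ 1 = φ.symm z' := by simp [hγ, hℓ]
  rw [e0, e1] at h01
  refine h01.trans ?_
  rw [length_eq]
  calc ∫⁻ t in Icc 0 1, ENNReal.ofReal (F.speed γ t)
      ≤ ∫⁻ _ in Icc (0 : ℝ) 1, ENNReal.ofReal ((1 + ε) * F.chartNorm x₀ y (z' - z)) := by
        -- In the chart the segment has constant velocity `z' - z`, and (P2) replaces the norm along
        -- it by the norm at `y` at the cost of a factor `1 + ε`.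
        refine setLIntegral_mono' measurableSet_Icc fun t ht => ENNReal.ofReal_le_ofReal ?_
        refine le_trans (le_of_eq ?_) ((hball _ (hℓb t ht)).2 (z' - z)).2
        refine F.tnorm_congr rfl ?_
        have h1 : HasMFDerivAt 𝓘(ℝ, ℝ) 𝓘(ℝ, E) γ t _ := HasMFDerivAt.comp t (g := φ.symm) (f := ℓ)
          ((mdifferentiable_chartAt x₀).mdifferentiableAt_symm (hball _ (hℓb t ht)).1).hasMFDerivAt
          (hℓ' t).hasMFDerivAt
        rw [h1.mfderiv]
        change mfderiv 𝓘(ℝ, E) 𝓘(ℝ, E) φ.symm (ℓ t) ((1 : ℝ) • (z' - z)) = _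
        rw [one_smul]
    _ = _ := by simp

/-- Nearby points are joined by a segment of finite length in a chart; being at finite distance is
symmetric and transitive, so connectedness spreads it to all pairs. -/
theorem fedist_ne_top [ConnectedSpace M] (F : PalaisFinsler E M) (x y : M) :
    F.fedist x y ≠ ⊤ := by
  have : ∀ x y, F.fedist x y < ⊤ := by
    refine PreconnectedSpace.induction₂' _ (fun x => ?_) ⟨fun x y z h h' =>
      (F.fedist_triangle x y z).trans_lt (ENNReal.add_lt_top.2 ⟨h, h'⟩)⟩
    obtain ⟨δ, hδ, -, h⟩ := F.eventually_fedist_le x (mem_chart_target E x) one_pos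
    have h1 := (chartAt E x).continuousAt (mem_chart_source E x) |>.preimage_mem_nhds
      (Metric.ball_mem_nhds _ hδ)
    filter_upwards [h1, (chartAt E x).open_source.mem_nhds (mem_chart_source E x)] with y hy hys
    have h2 := h _ (Metric.mem_ball_self hδ) _ hy
    rw [(chartAt E x).left_inv hys, (chartAt E x).left_inv (mem_chart_source E x)] at h2
    have h3 := h2.trans_lt ENNReal.ofReal_lt_top
    exact ⟨h3, by rwa [F.fedist_comm]⟩
  exact (this x y).ne

theorem fdist_self (F : PalaisFinsler E M) (x : M) : F.fdist x x = 0 := by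
  rw [fdist_eq, fedist_self, ENNReal.toReal_zero]

theorem fdist_comm (F : PalaisFinsler E M) (x y : M) : F.fdist x y = F.fdist y x := by
  rw [fdist_eq, fdist_eq, fedist_comm]

theorem fdist_triangle [ConnectedSpace M] (F : PalaisFinsler E M) (x y z : M) :
    F.fdist x z ≤ F.fdist x y + F.fdist y z := by
  rw [fdist_eq, fdist_eq, fdist_eq, ← ENNReal.toReal_add (F.fedist_ne_top _ _)
    (F.fedist_ne_top _ _)]
  exact ENNReal.toReal_mono (ENNReal.add_ne_top.2 ⟨F.fedist_ne_top _ _, F.fedist_ne_top _ _⟩)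
    (F.fedist_triangle x y z)

theorem exists_fdist_symm_le (F : PalaisFinsler E M) (x₀ : M) {y : E}
    (hy : y ∈ (chartAt E x₀).target) {ε : ℝ} (hε : 0 < ε) :
    ∃ δ > 0, Metric.ball y δ ⊆ (chartAt E x₀).target ∧ ∀ z ∈ Metric.ball y δ,
      ∀ z' ∈ Metric.ball y δ, F.fdist ((chartAt E x₀).symm z) ((chartAt E x₀).symm z') ≤
        (1 + ε) * F.chartNorm x₀ y (z' - z) := by
  obtain ⟨δ, hδ, hb, h⟩ := F.eventually_fedist_le x₀ hy hε
  exact ⟨δ, hδ, hb, fun z hz z' hz' => ENNReal.toReal_le_of_le_ofReal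
    (mul_nonneg (by linarith) (F.chartNorm_nonneg _ _ _)) (h z hz z' hz')⟩

theorem tendsto_fdist_nhds (F : PalaisFinsler E M) (x : M) :
    Tendsto (fun y => F.fdist x y) (𝓝 x) (𝓝 0) := by
  set φ := chartAt E x
  have hx : x ∈ φ.source := mem_chart_source E x
  obtain ⟨δ, hδ, -, h⟩ := F.exists_fdist_symm_le x (mem_chart_target E x) one_pos
  obtain ⟨K, hK, hKn⟩ := F.chartNorm_equiv x (mem_chart_target E x)
  have hc : Tendsto φ (𝓝 x) (𝓝 (φ x)) := φ.continuousAt hx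
  have hlim : Tendsto (fun y => (1 + 1) * (K * ‖φ y - φ x‖)) (𝓝 x) (𝓝 0) := by
    have : Tendsto (fun y => (1 + 1) * (K * ‖φ y - φ x‖)) (𝓝 x)
        (𝓝 ((1 + 1) * (K * ‖φ x - φ x‖))) :=
      tendsto_const_nhds.mul (tendsto_const_nhds.mul (hc.sub tendsto_const_nhds).norm)
    simpa using this
  refine squeeze_zero' (Eventually.of_forall fun y => F.fdist_nonneg _ _) ?_ hlim
  filter_upwards [hc.eventually (Metric.ball_mem_nhds _ hδ), φ.open_source.mem_nhds hx]
    with y hy hys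
  have h1 := h _ (Metric.mem_ball_self hδ) _ hy
  rw [φ.left_inv hys, φ.left_inv hx] at h1
  refine h1.trans ?_
  gcongr
  exact (hKn _).2

theorem IsLipschitz.continuous {F : PalaisFinsler E M} {L : ℝ} {h : M → ℝ}
    (hh : F.IsLipschitz L h) : Continuous h := by
  refine continuous_iff_continuousAt.2 fun y => ?_
  rw [ContinuousAt, tendsto_iff_dist_tendsto_zero]
  have : Tendsto (fun z => L * F.fdist y z) (𝓝 y) (𝓝 (L * 0)) :=
    tendsto_const_nhds.mul (F.tendsto_fdist_nhds y)
  rw [mul_zero] at this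
  refine squeeze_zero (fun _ => dist_nonneg) (fun z => ?_) this
  rw [dist_comm, Real.dist_eq]
  exact hh y z

end PalaisFinsler

/-! ### Cut-off functions and the topology of the Finsler distance -/

/-- The directional derivative of a real function on a manifold. -/
noncomputable def dirDeriv {E : Type*} [NormedAddCommGroup E] [NormedSpace ℝ E]
    {M : Type*} [TopologicalSpace M] [ChartedSpace E M] (f : M → ℝ) (z : M)
    (ξ : TangentSpace 𝓘(ℝ, E) z) : ℝ :=
  mfderiv 𝓘(ℝ, E) 𝓘(ℝ, ℝ) f z ξ

namespace PalaisFinsler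

variable {E : Type*} [NormedAddCommGroup E] [NormedSpace ℝ E]
  {M : Type*} [TopologicalSpace M] [ChartedSpace E M] [IsManifold 𝓘(ℝ, E) 1 M]

/-- `C^1` cut-off functions with bounded differential, supported in a given neighbourhood. -/
theorem exists_cutoff [RegularSpace M] (F : PalaisFinsler E M) {b : E → ℝ} {K : ℝ≥0}
    (hb : IsUnitBump b K) (x₀ : M) {x : M} (hx : x ∈ (chartAt E x₀).source) {U : Set M}
    (hU : U ∈ 𝓝 x) :
    ∃ χ : M → ℝ, ContMDiff 𝓘(ℝ, E) 𝓘(ℝ, ℝ) 1 χ ∧ (∀ᶠ z in 𝓝 x, χ z = 1) ∧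
      tsupport χ ⊆ U ∩ (chartAt E x₀).source ∧
      ∃ C > 0, ∀ z ξ, |dirDeriv χ z ξ| ≤ C * F.tnorm z ξ := by
  classical
  set φ := chartAt E x₀ with hφ
  have hy : φ x ∈ φ.target := φ.map_source hx
  obtain ⟨k, hk, hkn⟩ := F.chartNorm_equiv x₀ hy
  have hW : ∀ᶠ z in 𝓝 x, ∀ v, F.chartNorm x₀ (φ x) v ≤ (1 + 1) * F.chartNorm x₀ (φ z) v := by
    filter_upwards [(φ.continuousAt hx).eventually (F.eventually_chartNorm_le x₀ hy one_pos)]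
      with z hz v using (hz.2 v).1
  obtain ⟨N, ⟨hN, hNc⟩, hNsub⟩ := (closed_nhds_basis x).mem_iff.1
    (inter_mem (inter_mem hU (φ.open_source.mem_nhds hx)) hW)
  have hpre : φ.symm ⁻¹' N ∈ 𝓝 (φ x) :=
    (φ.continuousAt_symm hy).preimage_mem_nhds (by rwa [φ.left_inv hx])
  obtain ⟨ρ, hρ, hball⟩ := Metric.mem_nhds_iff.1 hpre
  set β : E → ℝ := fun v => b (ρ⁻¹ • (v - φ x)) with hβ
  have hβd : ContDiff ℝ 1 β := hb.contDiff_rescale _ _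
  set χ : M → ℝ := fun z => if z ∈ φ.source then β (φ z) else 0 with hχ
  have hsupp : Function.support χ ⊆ N := by
    intro z hz
    have hz' : χ z ≠ 0 := hz
    simp only [hχ] at hz'
    split_ifs at hz' with hzs
    · have : φ z ∈ Metric.ball (φ x) ρ := by
        by_contra hcon
        refine hz' (hb.eq_zero _ ?_)
        rw [mem_ball_iff_norm, not_lt] at hcon
        rw [norm_smul, Real.norm_of_nonneg (by positivity), ← div_eq_inv_mul, le_div_iff₀ hρ,
          one_mul]
        exact hcon
      have := hball this
      rwa [mem_preimage, φ.left_inv hzs] at this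
    · exact absurd rfl hz'
  have htsupp : tsupport χ ⊆ N := closure_minimal hsupp hNc
  have hloc : ∀ z ∈ φ.source, χ =ᶠ[𝓝 z] β ∘ φ := fun z hz => by
    filter_upwards [φ.open_source.mem_nhds hz] with w hw
    simp only [hχ, if_pos hw, Function.comp]
  refine ⟨χ, ?_, ?_, fun z hz => (hNsub (htsupp hz)).1, ρ⁻¹ * K * (k * (1 + 1)) + 1, by positivity,
    fun z ξ => ?_⟩
  · refine contMDiff_of_tsupport fun z hz => ?_
    have hzs : z ∈ φ.source := (hNsub (htsupp hz)).1.2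
    refine ContMDiffAt.congr_of_eventuallyEq ?_ (hloc z hzs)
    exact hβd.contMDiff.contMDiffAt.comp z
      ((contMDiffOn_chart (I := 𝓘(ℝ, E)) (n := 1) (x := x₀)).contMDiffAt
        (φ.open_source.mem_nhds hzs))
  · have h1 : Tendsto (fun z => ρ⁻¹ • (φ z - φ x)) (𝓝 x) (𝓝 0) := by
      have : Tendsto (fun z => ρ⁻¹ • (φ z - φ x)) (𝓝 x) (𝓝 (ρ⁻¹ • (φ x - φ x))) :=
        tendsto_const_nhds.smul (Tendsto.sub (φ.continuousAt hx) tendsto_const_nhds)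
      simpa using this
    filter_upwards [hloc x hx, h1.eventually hb.eventually_eq_one] with z hz h1
    rw [hz]; exact h1
  · have hnn := F.nonneg z ξ
    have hKk : 0 ≤ ρ⁻¹ * K * (k * (1 + 1)) := by positivity
    by_cases hz : z ∈ tsupport χ
    · have hzs : z ∈ φ.source := (hNsub (htsupp hz)).1.2
      have hd : HasMFDerivAt 𝓘(ℝ, E) 𝓘(ℝ, ℝ) χ z
          ((fderiv ℝ β (φ z)).comp (mfderiv 𝓘(ℝ, E) 𝓘(ℝ, E) φ z)) := by
        refine HasMFDerivAt.congr_of_eventuallyEq ?_ (hloc z hzs)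
        exact HasMFDerivAt.comp z (g := β) (f := φ)
          ((hβd.differentiable one_ne_zero _).hasFDerivAt.hasMFDerivAt)
          ((mdifferentiable_chartAt x₀).mdifferentiableAt hzs).hasMFDerivAt
      rw [dirDeriv, hd.mfderiv]
      set v : E := mfderiv 𝓘(ℝ, E) 𝓘(ℝ, E) φ z ξ with hv
      calc |(fderiv ℝ β (φ z) v : ℝ)| ≤ ‖fderiv ℝ β (φ z)‖ * ‖v‖ :=
            (fderiv ℝ β (φ z)).le_opNorm v
        _ ≤ (ρ⁻¹ * K) * (k * ((1 + 1) * F.chartNorm x₀ (φ z) v)) := by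
            refine mul_le_mul (hb.norm_fderiv_rescale_le (by positivity) _ _) ?_ (norm_nonneg _)
              (by positivity)
            refine (hkn v).1.trans ?_
            gcongr
            exact (hNsub (htsupp hz)).2 v
        _ = ρ⁻¹ * K * (k * (1 + 1)) * F.tnorm z ξ := by
            rw [hv, F.chartNorm_mfderiv x₀ hzs]; ring
        _ ≤ _ := by gcongr; linarith
    · have h0 : χ =ᶠ[𝓝 z] fun _ => 0 := notMem_tsupport_iff_eventuallyEq.1 hz
      have : dirDeriv χ z ξ = 0 := by
        rw [dirDeriv, h0.mfderiv_eq, mfderiv_const]; rfl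
      rw [this, abs_zero]
      positivity

/-- A function with bounded differential varies slowly along a path. -/
theorem enorm_sub_le_mul_length (F : PalaisFinsler E M) {f : M → ℝ}
    (hf : ContMDiff 𝓘(ℝ, E) 𝓘(ℝ, ℝ) 1 f) {C : ℝ} (hC : 0 ≤ C)
    (hfC : ∀ z ξ, |dirDeriv f z ξ| ≤ C * F.tnorm z ξ) {γ : ℝ → M} {a b : ℝ}
    (hγ : IsPiecewiseC1 E γ a b) :
    ‖f (γ b) - f (γ a)‖ₑ ≤ ENNReal.ofReal C * F.length γ a b := by
  obtain ⟨n, s, hs, rfl, rfl, hc⟩ := hγ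
  have key : ∀ m ≤ n, ‖f (γ (s m)) - f (γ (s 0))‖ₑ ≤ ENNReal.ofReal C * F.length γ (s 0) (s m) := by
    intro m
    induction m with
    | zero => intro _; simp
    | succ m ih =>
      intro hm
      have h1 := ih (by omega)
      have hle : s m ≤ s (m + 1) := hs (Nat.le_succ m)
      have hγm := hc m (by omega)
      have hg : ContDiffOn ℝ 1 (fun t => f (γ t)) (Icc (s m) (s (m + 1))) :=
        (hf.comp_contMDiffOn hγm).contDiffOn
      have h2 : ‖f (γ (s (m + 1))) - f (γ (s m))‖ₑ ≤
          ENNReal.ofReal C * F.length γ (s m) (s (m + 1)) := by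
        refine (enorm_sub_le_lintegral_deriv_of_contDiffOn_Icc hg hle).trans ?_
        rw [length_eq, ← lintegral_const_mul' _ _ ENNReal.ofReal_ne_top,
          ← setLIntegral_congr Ioo_ae_eq_Icc, ← setLIntegral_congr Ioo_ae_eq_Icc]
        refine setLIntegral_mono' measurableSet_Ioo fun t ht => ?_
        rw [← ENNReal.ofReal_mul hC, Real.enorm_eq_ofReal_abs]
        refine ENNReal.ofReal_le_ofReal ?_
        have hγt : MDifferentiableAt 𝓘(ℝ, ℝ) 𝓘(ℝ, E) γ t :=
          (hγm.contMDiffAt (Icc_mem_nhds ht.1 ht.2)).mdifferentiableAt one_ne_zero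
        have hft : MDifferentiableAt 𝓘(ℝ, E) 𝓘(ℝ, ℝ) f (γ t) :=
          (hf (γ t)).mdifferentiableAt one_ne_zero
        have hd : HasFDerivAt (fun t => f (γ t)) (_ : ℝ →L[ℝ] ℝ) t :=
          (HasMFDerivAt.comp t hft.hasMFDerivAt hγt.hasMFDerivAt).hasFDerivAt
        have : deriv (fun t => f (γ t)) t =
            dirDeriv f (γ t) (mfderiv 𝓘(ℝ, ℝ) 𝓘(ℝ, E) γ t (1 : ℝ)) := hd.hasDerivAt.deriv
        rw [this]
        exact hfC _ _
      rw [← F.length_add γ (hs (Nat.zero_le m)) hle, mul_add]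
      refine le_trans ?_ (add_le_add h1 h2)
      rw [add_comm ‖f (γ (s m)) - f (γ (s 0))‖ₑ]
      refine le_trans (le_of_eq ?_) (enorm_add_le _ _)
      rw [sub_add_sub_cancel]
  exact key n le_rfl

theorem abs_sub_le_mul_fdist [ConnectedSpace M] (F : PalaisFinsler E M) {f : M → ℝ}
    (hf : ContMDiff 𝓘(ℝ, E) 𝓘(ℝ, ℝ) 1 f) {C : ℝ} (hC : 0 < C)
    (hfC : ∀ z ξ, |dirDeriv f z ξ| ≤ C * F.tnorm z ξ) (x y : M) :
    |f x - f y| ≤ C * F.fdist x y := by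
  have hC' : ENNReal.ofReal C ≠ 0 := by simpa using hC
  have h1 : ‖f y - f x‖ₑ / ENNReal.ofReal C ≤ F.fedist x y := by
    refine le_sInf ?_
    rintro _ ⟨γ, a, b, hab, hγ, rfl, rfl, rfl⟩
    rw [ENNReal.div_le_iff hC' ENNReal.ofReal_ne_top, mul_comm]
    exact F.enorm_sub_le_mul_length hf hC.le hfC hγ
  have h2 := ENNReal.toReal_mono (F.fedist_ne_top x y) h1
  rw [← fdist_eq, ENNReal.toReal_div, ENNReal.toReal_ofReal hC.le, toReal_enorm, div_le_iff₀ hC,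
    mul_comm, Real.norm_eq_abs, abs_sub_comm] at h2
  exact h2

/-- A cut-off supported in `U` is `C`-Lipschitz for the Finsler distance and drops from `1` at `x`
to `0` off `U`, which takes a distance of at least `C⁻¹`. -/
theorem exists_fdist_lt_imp_mem [ConnectedSpace M] [RegularSpace M] (F : PalaisFinsler E M)
    {b : E → ℝ} {K : ℝ≥0} (hb : IsUnitBump b K) {x : M} {U : Set M} (hU : U ∈ 𝓝 x) :
    ∃ r > 0, ∀ y, F.fdist x y < r → y ∈ U := by
  obtain ⟨χ, hχ, h1, hsup, C, hC, hd⟩ := F.exists_cutoff hb x (mem_chart_source E x) hU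
  refine ⟨C⁻¹, by positivity, fun y hy => ?_⟩
  by_contra hyU
  have h0 : χ y = 0 := by
    by_contra h
    exact hyU (hsup (subset_tsupport χ h)).1
  have := F.abs_sub_le_mul_fdist hχ hC hd x y
  rw [h1.self_of_nhds, h0, sub_zero, abs_one] at this
  have h2 := mul_lt_mul_of_pos_left hy hC
  rw [mul_inv_cancel₀ hC.ne'] at h2
  linarith

theorem tendsto_of_tendsto_fdist [ConnectedSpace M] [RegularSpace M] (F : PalaisFinsler E M)
    {b : E → ℝ} {K : ℝ≥0} (hb : IsUnitBump b K) {x : M} {s : ℕ → M}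
    (hs : Tendsto (fun n => F.fdist (s n) x) atTop (𝓝 0)) : Tendsto s atTop (𝓝 x) := by
  intro U hU
  obtain ⟨r, hr, h⟩ := F.exists_fdist_lt_imp_mem hb hU
  rw [Filter.mem_map]
  filter_upwards [hs.eventually (gt_mem_nhds hr)] with n hn
  exact h _ (by rwa [F.fdist_comm])

end PalaisFinsler

/-! ### The equation read in charts -/

/-- Multiplication by a bump supported where `G` is `C¹` turns a locally defined test function into
a global one. -/
theorem IsUnitBump.exists_contDiff_eventuallyEq {Z : Type*} [NormedAddCommGroup Z]
    [NormedSpace ℝ Z] {b : Z → ℝ} {K : ℝ≥0} (hb : IsUnitBump b K) {G : Z → ℝ} {p : Z}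
    (hG : ContDiffAt ℝ 1 G p) : ∃ G' : Z → ℝ, ContDiff ℝ 1 G' ∧ G' =ᶠ[𝓝 p] G := by
  obtain ⟨r, hr, hball⟩ := Metric.eventually_nhds_iff_ball.1 (hG.eventually (by simp))
  set β : Z → ℝ := fun z => b ((r / 2)⁻¹ • (z - p)) with hβ
  have hβd : ContDiff ℝ 1 β := hb.contDiff_rescale _ _
  refine ⟨fun z => β z * G z, contDiff_iff_contDiffAt.2 fun z => ?_, ?_⟩
  · by_cases hz : z ∈ Metric.ball p r
    · exact hβd.contDiffAt.mul (hball z hz)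
    · have : (fun z => β z * G z) =ᶠ[𝓝 z] fun _ => 0 := by
        have hz' : z ∈ (Metric.closedBall p (r / 2))ᶜ := fun h =>
          hz (Metric.closedBall_subset_ball (by linarith) h)
        filter_upwards [Metric.isClosed_closedBall.isOpen_compl.mem_nhds hz'] with w hw
        have : β w = 0 := by
          refine hb.eq_zero _ ?_
          rw [mem_compl_iff, mem_closedBall_iff_norm, not_le] at hw
          rw [norm_smul, Real.norm_of_nonneg (by positivity), ← div_eq_inv_mul,
            le_div_iff₀ (by linarith), one_mul]
          exact hw.le
        rw [this, zero_mul]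
      exact contDiffAt_const.congr_of_eventuallyEq this
  · have h1 : Tendsto (fun z => (r / 2)⁻¹ • (z - p)) (𝓝 p) (𝓝 0) := by
      have : Continuous fun z => (r / 2)⁻¹ • (z - p) := by fun_prop
      simpa using this.tendsto p
    filter_upwards [h1.eventually hb.eventually_eq_one] with z hz
    simp only [hβ, hz, one_mul]

/-- Reading a function on `[0, ∞) × M` in a chart. -/
noncomputable def chartFun {E : Type*} [NormedAddCommGroup E] {M : Type*} [TopologicalSpace M]
    [ChartedSpace E M] (x₀ : M) (u : ℝ≥0 × M → ℝ) (q : ℝ × E) : ℝ :=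
  u (q.1.toNNReal, (chartAt E x₀).symm q.2)

namespace PalaisFinsler

variable {E : Type*} [NormedAddCommGroup E] [NormedSpace ℝ E]
  {M : Type*} [TopologicalSpace M] [ChartedSpace E M] [IsManifold 𝓘(ℝ, E) 1 M]

/-- The dual norm at the point of coordinate `y`, read in the preferred chart at `x₀`. -/
noncomputable def chartDual (F : PalaisFinsler E M) (x₀ : M) (y : E) (ℓ : E →L[ℝ] ℝ) : ℝ :=
  sSup {r : ℝ | ∃ v : E, F.chartNorm x₀ y v = 1 ∧ r = |ℓ v|}

theorem chartDual_nonneg (F : PalaisFinsler E M) (x₀ : M) (y : E) (ℓ : E →L[ℝ] ℝ) :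
    0 ≤ F.chartDual x₀ y ℓ :=
  Real.sSup_nonneg (by rintro _ ⟨v, -, rfl⟩; exact abs_nonneg _)

theorem chartDual_le (F : PalaisFinsler E M) {x₀ : M} {y : E} {ℓ : E →L[ℝ] ℝ} {c : ℝ}
    (hc : 0 ≤ c) (h : ∀ v, |ℓ v| ≤ c * F.chartNorm x₀ y v) : F.chartDual x₀ y ℓ ≤ c := by
  refine Real.sSup_le ?_ hc
  rintro _ ⟨v, hv, rfl⟩
  simpa [hv] using h v

/-- Homogeneity, with (P1) used twice: it bounds the set of values, so that the supremum is not a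
default value, and it forces `v = 0` when the norm of `v` vanishes. -/
theorem abs_le_chartDual_mul (F : PalaisFinsler E M) (x₀ : M) {y : E}
    (hy : y ∈ (chartAt E x₀).target) (ℓ : E →L[ℝ] ℝ) (v : E) :
    |ℓ v| ≤ F.chartDual x₀ y ℓ * F.chartNorm x₀ y v := by
  obtain ⟨K, hK, hKn⟩ := F.chartNorm_equiv x₀ hy
  have hbdd : BddAbove {r : ℝ | ∃ v : E, F.chartNorm x₀ y v = 1 ∧ r = |ℓ v|} := by
    refine ⟨‖ℓ‖ * K, ?_⟩
    rintro _ ⟨v, hv, rfl⟩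
    refine (ℓ.le_opNorm v).trans ?_
    gcongr
    simpa [hv] using (hKn v).1
  rcases (F.chartNorm_nonneg x₀ y v).eq_or_lt with h0 | hpos
  · have : v = 0 := by
      have := (hKn v).1
      rw [← h0, mul_zero] at this
      exact norm_le_zero_iff.1 this
    simp [this, F.chartNorm_nonneg, F.chartDual_nonneg, mul_nonneg]
  · set c := F.chartNorm x₀ y v
    have h1 : F.chartNorm x₀ y (c⁻¹ • v) = 1 := by
      rw [chartNorm_smul, abs_of_pos (inv_pos.2 hpos), inv_mul_cancel₀ hpos.ne']
    have h2 := le_csSup hbdd ⟨_, h1, rfl⟩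
    rw [map_smul, smul_eq_mul, abs_mul, abs_of_pos (inv_pos.2 hpos), inv_mul_le_iff₀ hpos,
      mul_comm] at h2
    exact h2

theorem chartDual_add_le (F : PalaisFinsler E M) (x₀ : M) {y : E}
    (hy : y ∈ (chartAt E x₀).target) (ℓ ℓ' : E →L[ℝ] ℝ) :
    F.chartDual x₀ y (ℓ + ℓ') ≤ F.chartDual x₀ y ℓ + F.chartDual x₀ y ℓ' := by
  refine F.chartDual_le (add_nonneg (F.chartDual_nonneg _ _ _) (F.chartDual_nonneg _ _ _))
    fun v => ?_
  rw [_root_.add_apply, add_mul]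
  exact (abs_add_le _ _).trans
    (add_le_add (F.abs_le_chartDual_mul x₀ hy ℓ v) (F.abs_le_chartDual_mul x₀ hy ℓ' v))

theorem chartDual_neg (F : PalaisFinsler E M) (x₀ : M) (y : E) (ℓ : E →L[ℝ] ℝ) :
    F.chartDual x₀ y (-ℓ) = F.chartDual x₀ y ℓ := by
  simp only [chartDual, _root_.neg_apply, abs_neg]

theorem exists_chartDual_le_norm (F : PalaisFinsler E M) (x₀ : M) {y : E}
    (hy : y ∈ (chartAt E x₀).target) :
    ∃ K : ℝ, 1 ≤ K ∧ ∀ ℓ : E →L[ℝ] ℝ, F.chartDual x₀ y ℓ ≤ K * ‖ℓ‖ := by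
  obtain ⟨K, hK, hKn⟩ := F.chartNorm_equiv x₀ hy
  refine ⟨K, hK, fun ℓ => F.chartDual_le (by positivity) fun v => (ℓ.le_opNorm v).trans ?_⟩
  rw [mul_comm K, mul_assoc]
  gcongr
  exact (hKn v).1

theorem eventually_chartDual_le (F : PalaisFinsler E M) (x₀ : M) {y : E}
    (hy : y ∈ (chartAt E x₀).target) {ε : ℝ} (hε : 0 < ε) :
    ∀ᶠ z in 𝓝 y, ∀ ℓ : E →L[ℝ] ℝ,
      F.chartDual x₀ y ℓ ≤ (1 + ε) * F.chartDual x₀ z ℓ ∧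
      F.chartDual x₀ z ℓ ≤ (1 + ε) * F.chartDual x₀ y ℓ := by
  filter_upwards [F.eventually_chartNorm_le x₀ hy hε] with z ⟨hz, h⟩ ℓ
  have h0 := F.chartDual_nonneg x₀ z ℓ
  have h1 := F.chartDual_nonneg x₀ y ℓ
  constructor
  · refine F.chartDual_le (by positivity) fun v => (F.abs_le_chartDual_mul x₀ hz ℓ v).trans ?_
    rw [mul_comm (1 + ε), mul_assoc]
    gcongr
    exact (h v).2
  · refine F.chartDual_le (by positivity) fun v => (F.abs_le_chartDual_mul x₀ hy ℓ v).trans ?_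
    rw [mul_comm (1 + ε), mul_assoc]
    gcongr
    exact (h v).1

/-- (P2) controls a change of base point by a factor, (P1) a change of functional by an additive
term. Joint continuity lets strict inequalities for the operator survive small changes of both. -/
theorem continuousAt_chartDual (F : PalaisFinsler E M) (x₀ : M) {y : E}
    (hy : y ∈ (chartAt E x₀).target) (ℓ : E →L[ℝ] ℝ) :
    ContinuousAt (fun p : E × (E →L[ℝ] ℝ) => F.chartDual x₀ p.1 p.2) (y, ℓ) := by
  obtain ⟨K, hK, hKn⟩ := F.exists_chartDual_le_norm x₀ hy
  rw [Metric.continuousAt_iff']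
  intro ε hε
  set N := F.chartDual x₀ y ℓ with hN
  have hN0 : 0 ≤ N := F.chartDual_nonneg _ _ _
  set κ : ℝ := min 1 (ε / (4 * (N + 1))) with hκ
  have hκ0 : 0 < κ := by positivity
  have hκ1 : κ ≤ 1 := min_le_left _ _
  have hκN : κ * N ≤ ε / 4 := by
    have : κ ≤ ε / (4 * (N + 1)) := min_le_right _ _
    rw [le_div_iff₀ (by positivity)] at this
    nlinarith
  have h1 : ∀ᶠ p : E × (E →L[ℝ] ℝ) in 𝓝 (y, ℓ), K * ‖p.2 - ℓ‖ < ε / 4 := by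
    have : Continuous fun p : E × (E →L[ℝ] ℝ) => K * ‖p.2 - ℓ‖ := by fun_prop
    refine this.continuousAt.eventually (gt_mem_nhds ?_)
    simp only [sub_self, norm_zero, mul_zero]; linarith
  filter_upwards [h1, (continuous_fst.tendsto (y, ℓ)).eventually
    (F.eventually_chartDual_le x₀ hy hκ0)] with p hp1 hp2
  have a1 := (hp2 p.2).1
  have a2 := (hp2 p.2).2
  have a3 := F.chartDual_add_le x₀ hy (p.2 - ℓ) ℓ
  have a4 := F.chartDual_add_le x₀ hy (-(p.2 - ℓ)) p.2
  rw [sub_add_cancel] at a3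
  rw [neg_sub, sub_add_cancel, ← neg_sub, chartDual_neg] at a4
  have a5 := hKn (p.2 - ℓ)
  have a6 := F.chartDual_nonneg x₀ p.1 p.2
  have a7 := F.chartDual_nonneg x₀ y p.2
  rw [Real.dist_eq, abs_sub_lt_iff]
  constructor
  · nlinarith
  · have : F.chartDual x₀ y p.2 - κ * F.chartDual x₀ y p.2 ≤ F.chartDual x₀ p.1 p.2 := by
      nlinarith [mul_nonneg (mul_nonneg hκ0.le hκ0.le) a6]
    nlinarith

/-- The differential of the inverse chart is a bijection between the two unit spheres, so both
suprema are over the same set of reals. -/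
theorem dualNorm_symm (F : PalaisFinsler E M) (x₀ : M) {y : E} (hy : y ∈ (chartAt E x₀).target)
    (Δ : TangentSpace 𝓘(ℝ, E) ((chartAt E x₀).symm y) →L[ℝ] ℝ) {ℓ : E →L[ℝ] ℝ}
    (hℓ : ∀ v, ℓ v = Δ (mfderiv 𝓘(ℝ, E) 𝓘(ℝ, E) (chartAt E x₀).symm y v)) :
    F.dualNorm ((chartAt E x₀).symm y) Δ = F.chartDual x₀ y ℓ := by
  unfold dualNorm chartDual
  congr 1
  ext r
  constructor
  · rintro ⟨ξ, h1, rfl⟩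
    have h := mfderiv_symm_chartAt_apply x₀ ((chartAt E x₀).map_target hy) ξ
    rw [(chartAt E x₀).right_inv hy] at h
    refine ⟨mfderiv 𝓘(ℝ, E) 𝓘(ℝ, E) (chartAt E x₀) _ ξ, ?_, ?_⟩
    · rw [← h1]; exact F.tnorm_congr rfl h
    · exact (congrArg abs ((hℓ _).trans (congrArg Δ h))).symm
  · rintro ⟨v, h1, rfl⟩
    exact ⟨_, h1, by rw [hℓ]⟩

/-- The Hamilton-Jacobi operator, read in a chart. -/
noncomputable def chartHam (F : PalaisFinsler E M) (H : ℝ≥0 × M × ℝ → ℝ) (x₀ : M) (q : ℝ × E)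
    (ζ : ℝ × E →L[ℝ] ℝ) : ℝ :=
  ζ (1, 0) + H (q.1.toNNReal, (chartAt E x₀).symm q.2,
    F.chartDual x₀ q.2 (ζ ∘L ContinuousLinearMap.inr ℝ ℝ E))

theorem continuousAt_chartHam (F : PalaisFinsler E M) {H : ℝ≥0 × M × ℝ → ℝ} (hH : Continuous H)
    (x₀ : M) {q : ℝ × E} (hq : q.2 ∈ (chartAt E x₀).target) (ζ : ℝ × E →L[ℝ] ℝ) :
    ContinuousAt (fun p : (ℝ × E) × (ℝ × E →L[ℝ] ℝ) => F.chartHam H x₀ p.1 p.2) (q, ζ) := by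
  unfold chartHam
  have h1 : Continuous fun p : (ℝ × E) × (ℝ × E →L[ℝ] ℝ) => p.2 (1, 0) :=
    (ContinuousLinearMap.apply ℝ ℝ ((1, 0) : ℝ × E)).continuous.comp continuous_snd
  have h2 : Continuous fun p : (ℝ × E) × (ℝ × E →L[ℝ] ℝ) =>
      (p.1.2, p.2 ∘L ContinuousLinearMap.inr ℝ ℝ E) :=
    (continuous_snd.comp continuous_fst).prodMk (continuous_snd.clm_comp continuous_const)
  have h3 : ContinuousAt (fun p : (ℝ × E) × (ℝ × E →L[ℝ] ℝ) => (chartAt E x₀).symm p.1.2)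
      (q, ζ) :=
    ContinuousAt.comp (f := fun p : (ℝ × E) × (ℝ × E →L[ℝ] ℝ) => p.1.2)
      ((chartAt E x₀).continuousAt_symm hq)
      (continuous_snd.comp continuous_fst).continuousAt
  have h4 : ContinuousAt (fun p : (ℝ × E) × (ℝ × E →L[ℝ] ℝ) =>
      F.chartDual x₀ p.1.2 (p.2 ∘L ContinuousLinearMap.inr ℝ ℝ E)) (q, ζ) :=
    ContinuousAt.comp (g := fun p : E × (E →L[ℝ] ℝ) => F.chartDual x₀ p.1 p.2)
      (f := fun p : (ℝ × E) × (ℝ × E →L[ℝ] ℝ) => (p.1.2, p.2 ∘L ContinuousLinearMap.inr ℝ ℝ E))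
      (F.continuousAt_chartDual x₀ hq _) h2.continuousAt
  have h5 : Continuous fun p : (ℝ × E) × (ℝ × E →L[ℝ] ℝ) => p.1.1.toNNReal :=
    continuous_real_toNNReal.comp (continuous_fst.comp continuous_fst)
  exact h1.continuousAt.add (ContinuousAt.comp (f := fun p : (ℝ × E) × (ℝ × E →L[ℝ] ℝ) =>
    (p.1.1.toNNReal, (chartAt E x₀).symm p.1.2,
      F.chartDual x₀ p.1.2 (p.2 ∘L ContinuousLinearMap.inr ℝ ℝ E))) hH.continuousAt
    (h5.continuousAt.prodMk (h3.prodMk h4)))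

/-- The subsolution condition at a single point. -/
def IsSubsolutionAt (F : PalaisFinsler E M) (H : ℝ≥0 × M × ℝ → ℝ) (u : ℝ≥0 × M → ℝ) (t : ℝ≥0)
    (x : M) : Prop :=
  ∀ (α : ℝ) (Δ : TangentSpace 𝓘(ℝ, E) x →L[ℝ] ℝ),
    IsSuperdifferential u t x α Δ → α + H (t, x, F.dualNorm x Δ) ≤ 0

end PalaisFinsler

theorem ContinuousLinearMap.apply_real_prod {E : Type*} [NormedAddCommGroup E] [NormedSpace ℝ E]
    (ζ : ℝ × E →L[ℝ] ℝ) (s : ℝ) (v : E) : ζ (s, v) = s * ζ (1, 0) + ζ (0, v) := by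
  rw [← smul_eq_mul, ← map_smul, ← map_add]
  simp

theorem hasMFDerivAt_id_prodMap {E : Type*} [NormedAddCommGroup E] [NormedSpace ℝ E]
    {M N : Type*} [TopologicalSpace M] [ChartedSpace E M] [TopologicalSpace N] [ChartedSpace E N]
    {f : M → N} (t : ℝ) {y : M} (hf : MDifferentiableAt 𝓘(ℝ, E) 𝓘(ℝ, E) f y) :
    HasMFDerivAt (𝓘(ℝ, ℝ).prod 𝓘(ℝ, E)) (𝓘(ℝ, ℝ).prod 𝓘(ℝ, E)) (Prod.map (id : ℝ → ℝ) f) (t, y)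
      ((ContinuousLinearMap.id ℝ ℝ).prodMap (mfderiv 𝓘(ℝ, E) 𝓘(ℝ, E) f y)) := by
  have h := HasMFDerivAt.prodMap (p := (t, y)) (hasMFDerivAt_id (I := 𝓘(ℝ, ℝ)) t) hf.hasMFDerivAt
  have e : mfderiv 𝓘(ℝ, ℝ) 𝓘(ℝ, ℝ) (id : ℝ → ℝ) t = ContinuousLinearMap.id ℝ ℝ := mfderiv_id
  exact e ▸ h

namespace PalaisFinsler

variable {E : Type*} [NormedAddCommGroup E] [NormedSpace ℝ E]
  {M : Type*} [TopologicalSpace M] [ChartedSpace E M] [IsManifold 𝓘(ℝ, E) 1 M]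

/-- Test functions which are smooth in a chart are enough for the subsolution condition. -/
theorem IsSubsolutionAt.chartHam_le [RegularSpace M] {F : PalaisFinsler E M} {b : E → ℝ}
    {K : ℝ≥0} (hb : IsUnitBump b K) {H : ℝ≥0 × M × ℝ → ℝ} {u : ℝ≥0 × M → ℝ} {t : ℝ≥0} {x₀ : M}
    {y : E} (hy : y ∈ (chartAt E x₀).target)
    (h : F.IsSubsolutionAt H u t ((chartAt E x₀).symm y)) {G : ℝ × E → ℝ} (hG : ContDiff ℝ 1 G)
    (hmax : IsLocalMax (fun q => chartFun x₀ u q - G q) ((t : ℝ), y)) :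
    F.chartHam H x₀ ((t : ℝ), y) (fderiv ℝ G ((t : ℝ), y)) ≤ 0 := by
  set φ := chartAt E x₀ with hφ
  have hx : φ.symm y ∈ φ.source := φ.map_target hy
  have hsrc := φ.open_source.mem_nhds hx
  obtain ⟨χ, hχ, hχ1, hχs, -⟩ := F.exists_cutoff hb x₀ hx univ_mem
  set θ : ℝ × M → ℝ × E := Prod.map id φ with hθ
  -- Test functions must be `C¹` on all of `(0, ∞) × M`; the cut-off allows `G ∘ θ` to be extended
  -- by zero and leaves it unchanged near the point.
  set g : ℝ × M → ℝ := fun p => χ p.2 * G (θ p) with hg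
  have hGm : ContMDiff (𝓘(ℝ, ℝ).prod 𝓘(ℝ, E)) 𝓘(ℝ, ℝ) 1 G := by
    rw [← modelWithCornersSelf_prod, chartedSpaceSelf_prod]
    exact hG.contMDiff
  have hgC : ContMDiff (𝓘(ℝ, ℝ).prod 𝓘(ℝ, E)) 𝓘(ℝ, ℝ) 1 g := by
    intro p
    by_cases hp : p.2 ∈ φ.source
    · have h1 : ContMDiffAt (𝓘(ℝ, ℝ).prod 𝓘(ℝ, E)) 𝓘(ℝ, ℝ) 1 (fun p : ℝ × M => χ p.2) p :=
        (hχ p.2).comp p contMDiffAt_snd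
      have h2 : ContMDiffAt (𝓘(ℝ, ℝ).prod 𝓘(ℝ, E)) (𝓘(ℝ, ℝ).prod 𝓘(ℝ, E)) 1 θ p :=
        contMDiffAt_id.prodMap'
          ((contMDiffOn_chart (I := 𝓘(ℝ, E)) (n := 1) (x := x₀)).contMDiffAt
            (φ.open_source.mem_nhds hp))
      exact h1.mul ((hGm (θ p)).comp p h2)
    · have hp' : p.2 ∉ tsupport χ := fun h => hp (hχs h).2
      have h0 : χ =ᶠ[𝓝 p.2] fun _ => 0 := notMem_tsupport_iff_eventuallyEq.1 hp'
      have : g =ᶠ[𝓝 p] fun _ => 0 := by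
        filter_upwards [(continuous_snd.tendsto p).eventually h0] with q hq
        simp only [hg, hq, zero_mul]
      exact contMDiffAt_const.congr_of_eventuallyEq this
  have hgG : g =ᶠ[𝓝 ((t : ℝ), φ.symm y)] G ∘ θ := by
    filter_upwards [(continuous_snd.tendsto ((t : ℝ), φ.symm y)).eventually hχ1] with q hq
    simp only [hg, hq, one_mul, Function.comp]
  have hθp : θ ((t : ℝ), φ.symm y) = ((t : ℝ), y) := by
    simp only [hθ, Prod.map_apply, id, φ.right_inv hy]
  have hGd : HasMFDerivAt (𝓘(ℝ, ℝ).prod 𝓘(ℝ, E)) 𝓘(ℝ, ℝ) G (θ ((t : ℝ), φ.symm y))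
      (fderiv ℝ G ((t : ℝ), y)) := by
    rw [hθp, ← modelWithCornersSelf_prod, chartedSpaceSelf_prod]
    exact (hG.differentiable one_ne_zero _).hasFDerivAt.hasMFDerivAt
  have hφd : MDifferentiableAt 𝓘(ℝ, E) 𝓘(ℝ, E) φ (φ.symm y) :=
    (mdifferentiable_chartAt x₀).mdifferentiableAt hx
  have hθd : HasMFDerivAt (𝓘(ℝ, ℝ).prod 𝓘(ℝ, E)) (𝓘(ℝ, ℝ).prod 𝓘(ℝ, E)) θ
      ((t : ℝ), φ.symm y) ((ContinuousLinearMap.id ℝ ℝ).prodMap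
        (mfderiv 𝓘(ℝ, E) 𝓘(ℝ, E) φ (φ.symm y))) :=
    hasMFDerivAt_id_prodMap _ hφd
  have hgd := (HasMFDerivAt.comp _ hGd hθd).congr_of_eventuallyEq hgG
  set ζ := fderiv ℝ G ((t : ℝ), y) with hζ
  have hsup : IsSuperdifferential u t (φ.symm y) (ζ (1, 0))
      ((ζ ∘L ContinuousLinearMap.inr ℝ ℝ E) ∘L (mfderiv 𝓘(ℝ, E) 𝓘(ℝ, E) φ (φ.symm y))) := by
    refine ⟨g, hgC.contMDiffOn, ?_, fun s v => ?_⟩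
    · have hc : Tendsto (fun p : ℝ≥0 × M => ((p.1 : ℝ), φ p.2)) (𝓝 (t, φ.symm y))
          (𝓝 ((t : ℝ), y)) := by
        have h1 : Tendsto (fun p : ℝ≥0 × M => (p.1 : ℝ)) (𝓝 (t, φ.symm y)) (𝓝 (t : ℝ)) :=
          (NNReal.continuous_coe.comp continuous_fst).tendsto _
        have h2 : Tendsto (fun p : ℝ≥0 × M => φ p.2) (𝓝 (t, φ.symm y)) (𝓝 y) := by
          have := (φ.continuousAt hx).tendsto
          rw [φ.right_inv hy] at this
          exact this.comp (continuous_snd.tendsto (t, φ.symm y))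
        exact h1.prodMk_nhds h2
      have hm := hc.eventually hmax
      have hs := (continuous_snd.tendsto (t, φ.symm y)).eventually hsrc
      have h1 := (continuous_snd.tendsto (t, φ.symm y)).eventually hχ1
      filter_upwards [hm, hs, h1] with p hp hps hp1
      have e1 : chartFun x₀ u ((p.1 : ℝ), φ p.2) = u p := by
        simp only [chartFun, Real.toNNReal_coe]
        rw [φ.left_inv hps]
      have e2 : chartFun x₀ u ((t : ℝ), y) = u (t, φ.symm y) := by
        simp only [chartFun, Real.toNNReal_coe]; rfl
      rw [e1, e2] at hp
      simp only [hg, hp1, hχ1.self_of_nhds, one_mul, hθp]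
      exact hp
    · rw [hgd.mfderiv]
      exact ζ.apply_real_prod s (mfderiv 𝓘(ℝ, E) 𝓘(ℝ, E) φ (φ.symm y) v)
  have := h _ _ hsup
  rw [F.dualNorm_symm x₀ hy _ (ℓ := ζ ∘L ContinuousLinearMap.inr ℝ ℝ E) (fun v => ?_)] at this
  · simpa only [chartHam, Real.toNNReal_coe] using this
  · exact congrArg (ζ ∘L ContinuousLinearMap.inr ℝ ℝ E) (mfderiv_chartAt_symm_apply x₀ hy v).symm

theorem isSubsolutionAt_symm (F : PalaisFinsler E M) {b : E → ℝ}
    {K : ℝ≥0} (hb : IsUnitBump b K) {H : ℝ≥0 × M × ℝ → ℝ} {u : ℝ≥0 × M → ℝ} {t : ℝ≥0} (ht : 0 < t) {x₀ : M}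
    {y : E} (hy : y ∈ (chartAt E x₀).target)
    (h : ∀ G : ℝ × E → ℝ, ContDiff ℝ 1 G →
        IsLocalMax (fun q => chartFun x₀ u q - G q) ((t : ℝ), y) →
        F.chartHam H x₀ ((t : ℝ), y) (fderiv ℝ G ((t : ℝ), y)) ≤ 0) :
    F.IsSubsolutionAt H u t ((chartAt E x₀).symm y) := by
  set φ := chartAt E x₀ with hφ
  have hx : φ.symm y ∈ φ.source := φ.map_target hy
  rintro α Δ ⟨g, hg, hmax, hdiff⟩
  set θ : ℝ × E → ℝ × M := Prod.map id φ.symm with hθ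
  have hto : (Ioi (0 : ℝ) ×ˢ (univ : Set M)) ∈ 𝓝 (θ ((t : ℝ), y)) :=
    (isOpen_Ioi.prod isOpen_univ).mem_nhds ⟨ht, mem_univ _⟩
  have hgat := hg.contMDiffAt hto
  have hθc : ContMDiffAt (𝓘(ℝ, ℝ).prod 𝓘(ℝ, E)) (𝓘(ℝ, ℝ).prod 𝓘(ℝ, E)) 1 θ ((t : ℝ), y) :=
    ContMDiffAt.prodMap' contMDiffAt_id
      ((contMDiffOn_chart_symm (I := 𝓘(ℝ, E)) (n := 1) (x := x₀)).contMDiffAt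
        (φ.open_target.mem_nhds hy))
  have hG₀ : ContDiffAt ℝ 1 (g ∘ θ) ((t : ℝ), y) := by
    have := hgat.comp _ hθc
    rw [← modelWithCornersSelf_prod, chartedSpaceSelf_prod] at this
    exact this.contDiffAt
  obtain ⟨br, Kr, hbr⟩ := hasC1LipschitzBump_real.exists_isUnitBump
  obtain ⟨G, hG, hGe⟩ := (hbr.prod hb).exists_contDiff_eventuallyEq hG₀
  have hφd : MDifferentiableAt 𝓘(ℝ, E) 𝓘(ℝ, E) φ.symm y :=
    (mdifferentiable_chartAt x₀).mdifferentiableAt_symm hy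
  have hθd : HasMFDerivAt (𝓘(ℝ, ℝ).prod 𝓘(ℝ, E)) (𝓘(ℝ, ℝ).prod 𝓘(ℝ, E)) θ
      ((t : ℝ), y) ((ContinuousLinearMap.id ℝ ℝ).prodMap
        (mfderiv 𝓘(ℝ, E) 𝓘(ℝ, E) φ.symm y)) :=
    hasMFDerivAt_id_prodMap _ hφd
  have hd := HasMFDerivAt.comp _ (hgat.mdifferentiableAt one_ne_zero).hasMFDerivAt hθd
  rw [← modelWithCornersSelf_prod, chartedSpaceSelf_prod] at hd
  have hd' : HasFDerivAt (g ∘ θ) (_ : ℝ × E →L[ℝ] ℝ) ((t : ℝ), y) := hd.hasFDerivAt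
  have hGd : ∀ s v, fderiv ℝ G ((t : ℝ), y) (s, v) =
      s * α + Δ (mfderiv 𝓘(ℝ, E) 𝓘(ℝ, E) φ.symm y v) := by
    intro s v
    rw [hGe.fderiv_eq, hd'.fderiv]
    exact hdiff s _
  have hlm : IsLocalMax (fun q => chartFun x₀ u q - G q) ((t : ℝ), y) := by
    have hc : Tendsto (fun q : ℝ × E => (q.1.toNNReal, φ.symm q.2)) (𝓝 ((t : ℝ), y))
        (𝓝 (t, φ.symm y)) := by
      have h1 : Tendsto (fun q : ℝ × E => q.1.toNNReal) (𝓝 ((t : ℝ), y)) (𝓝 t) := by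
        have := (continuous_real_toNNReal.comp continuous_fst).tendsto ((t : ℝ), y)
        simpa [Function.comp_def] using this
      have h2 : Tendsto (fun q : ℝ × E => φ.symm q.2) (𝓝 ((t : ℝ), y)) (𝓝 (φ.symm y)) :=
        (φ.continuousAt_symm hy).tendsto.comp (continuous_snd.tendsto ((t : ℝ), y))
      exact h1.prodMk_nhds h2
    -- `toNNReal` loses nothing at positive times, so the maximum on `[0, ∞) × M` transfers to `ℝ ×
    -- E`.
    have hpos : ∀ᶠ q : ℝ × E in 𝓝 ((t : ℝ), y), 0 < q.1 :=
      (continuous_fst.tendsto ((t : ℝ), y)).eventually (lt_mem_nhds (NNReal.coe_pos.2 ht))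
    filter_upwards [hc.eventually hmax, hpos, hGe] with q hq hq0 hqe
    rw [hqe, hGe.self_of_nhds]
    simp only [Real.coe_toNNReal _ hq0.le] at hq
    simp only [chartFun, Real.toNNReal_coe]
    exact hq
  have := h G hG hlm
  simp only [chartHam, Real.toNNReal_coe] at this
  rw [F.dualNorm_symm x₀ hy Δ (ℓ := fderiv ℝ G ((t : ℝ), y) ∘L ContinuousLinearMap.inr ℝ ℝ E)
    (fun v => ?_)]
  · have h1 : fderiv ℝ G ((t : ℝ), y) (1, 0) = α := by
      rw [hGd, one_mul]
      have : Δ (mfderiv 𝓘(ℝ, E) 𝓘(ℝ, E) φ.symm y (0 : E)) = 0 :=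
         (Δ.comp (mfderiv 𝓘(ℝ, E) 𝓘(ℝ, E) φ.symm y)).map_zero
      rw [this, add_zero]
    rwa [h1] at this
  · change fderiv ℝ G ((t : ℝ), y) (0, v) = _
    rw [hGd, zero_mul, zero_add]

end PalaisFinsler

/-! ### Semicontinuous envelopes -/

section Envelope

variable {X : Type*} [TopologicalSpace X] {u : X → ℝ}

theorem uscEnvelope_le {v : X → ℝ} (hv : Continuous v) (h : ∀ q, u q ≤ v q) (p : X) :
    uscEnvelope u p ≤ v p :=
  csInf_le ⟨u p, by rintro _ ⟨w, -, hw, rfl⟩; exact hw p⟩ ⟨v, hv, h, rfl⟩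

theorem le_uscEnvelope {m : X → ℝ} (hm : Continuous m) (h : ∀ q, u q ≤ m q) (p : X) :
    u p ≤ uscEnvelope u p :=
  le_csInf ⟨m p, m, hm, h, rfl⟩ (by rintro _ ⟨w, -, hw, rfl⟩; exact hw p)

theorem upperSemicontinuous_uscEnvelope {m : X → ℝ} (hm : Continuous m) (h : ∀ q, u q ≤ m q) :
    UpperSemicontinuous (uscEnvelope u) := by
  intro p c hc
  obtain ⟨_, ⟨v, hv, hvu, rfl⟩, hlt⟩ :=
    exists_lt_of_csInf_lt (s := {r : ℝ | ∃ v : X → ℝ, Continuous v ∧ (∀ q, u q ≤ v q) ∧ r = v p})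
      ⟨m p, m, hm, h, rfl⟩ hc
  filter_upwards [hv.continuousAt.eventually (gt_mem_nhds hlt)] with q hq
  exact (uscEnvelope_le hv hvu q).trans_lt hq

/-- Complete regularity gives a continuous majorant equal to `c` at `p` and at least `m` off the
neighbourhood. Thus the envelope, though defined by global majorants, depends only on `u` near `p`.
-/
theorem uscEnvelope_le_of_eventually_le [CompletelyRegularSpace X] {m : X → ℝ}
    (hm : Continuous m) (h : ∀ q, u q ≤ m q) {p : X} {c : ℝ} (hc : ∀ᶠ q in 𝓝 p, u q ≤ c) :
    uscEnvelope u p ≤ c := by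
  obtain ⟨V, hV, hVo, hp⟩ := eventually_nhds_iff.1 hc
  obtain ⟨f, hf, hf0, hf1⟩ := CompletelyRegularSpace.completely_regular_isOpen p V hVo hp
  have hv : Continuous fun q => c + (f q : ℝ) * max (m q - c) 0 :=
    continuous_const.add ((continuous_subtype_val.comp hf).mul
      ((hm.sub continuous_const).max continuous_const))
  refine (uscEnvelope_le hv (fun q => ?_) p).trans_eq (by simp [hf0])
  by_cases hq : q ∈ V
  · exact (hV q hq).trans (le_add_of_nonneg_right (mul_nonneg (f q).2.1 (le_max_right _ _)))
  · have : (f q : ℝ) = 1 := by rw [hf1 hq]; rfl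
    rw [this, one_mul]
    linarith [h q, le_max_left (m q - c) 0]

theorem lscEnvelope_eq_neg (u : X → ℝ) (p : X) :
    lscEnvelope u p = -uscEnvelope (fun q => -u q) p := by
  unfold lscEnvelope uscEnvelope
  rw [Real.sInf_def, neg_neg]
  congr 1
  ext r
  rw [Set.mem_neg]
  constructor
  · rintro ⟨v, hv, hvu, rfl⟩
    exact ⟨fun q => -v q, hv.neg, fun q => neg_le_neg (hvu q), rfl⟩
  · rintro ⟨v, hv, hvu, hr⟩
    exact ⟨fun q => -v q, hv.neg, fun q => neg_le.1 (hvu q), by simp only; linarith⟩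

end Envelope

/-! ### Symmetry of sub- and supersolutions, and Lipschitz bounds -/

/-- Lets statements on supersolutions be deduced from those on subsolutions: the sign of `u` passes
to the differentials, and the dual norm is even. -/
theorem isSubdifferential_iff_neg {E : Type*} [NormedAddCommGroup E] [NormedSpace ℝ E]
    {M : Type*} [TopologicalSpace M] [ChartedSpace E M] {u : ℝ≥0 × M → ℝ} {t : ℝ≥0} {x : M}
    {α : ℝ} {Δ : TangentSpace 𝓘(ℝ, E) x →L[ℝ] ℝ} :
    IsSubdifferential u t x α Δ ↔ IsSuperdifferential (fun p => -u p) t x (-α) (-Δ) := by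
  have hd : ∀ (g : ℝ × M → ℝ) (α : ℝ) (Δ : TangentSpace 𝓘(ℝ, E) x →L[ℝ] ℝ),
      IsDiffPair g t x α Δ → IsDiffPair (-g) t x (-α) (-Δ) := by
    intro g α Δ h s v
    rw [mfderiv_neg]
    have := congrArg Neg.neg (h s v)
    rw [_root_.neg_apply, mul_neg, ← neg_add]
    exact this
  constructor
  · rintro ⟨g, hg, hm, hdiff⟩
    refine ⟨-g, hg.neg, ?_, hd g α Δ hdiff⟩
    filter_upwards [hm] with p hp
    simp only [Pi.neg_apply]
    linarith
  · rintro ⟨g, hg, hm, hdiff⟩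
    refine ⟨-g, hg.neg, ?_, ?_⟩
    · filter_upwards [hm] with p hp
      simp only [Pi.neg_apply]
      linarith
    · have := hd g _ _ hdiff
      rwa [neg_neg, neg_neg] at this

/-- A one-sided bound on the increments of a function which is touched from above by `G` bounds
the derivative of `G`. -/
theorem neg_le_of_isLocalMax_sub {Z : Type*} [NormedAddCommGroup Z] [NormedSpace ℝ Z]
    {f G : Z → ℝ} {q : Z} (hG : DifferentiableAt ℝ G q) (hmax : IsLocalMax (fun z => f z - G z) q)
    {w : Z} {c : ℝ} (hf : ∀ᶠ τ : ℝ in 𝓝[>] 0, f q - f (q + τ • w) ≤ τ * c) :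
    -c ≤ fderiv ℝ G q w := by
  have h1 : HasDerivAt (fun τ : ℝ => G (q + τ • w)) (fderiv ℝ G q w) 0 :=
    hG.hasFDerivAt.hasLineDerivAt w
  have h2 := h1.tendsto_slope_zero_right
  have hc : Tendsto (fun τ : ℝ => q + τ • w) (𝓝[>] 0) (𝓝 q) := by
    have : Continuous fun τ : ℝ => q + τ • w := by fun_prop
    have := (this.tendsto 0).mono_left (nhdsWithin_le_nhds (s := Ioi 0))
    simpa using this
  refine ge_of_tendsto h2 ?_
  filter_upwards [hc.eventually hmax, hf, self_mem_nhdsWithin] with τ h3 h4 h5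
  have hτ : (0 : ℝ) < τ := h5
  rw [zero_smul, add_zero, zero_add, smul_eq_mul, ← div_eq_inv_mul, le_div_iff₀ hτ]
  linarith

namespace PalaisFinsler

variable {E : Type*} [NormedAddCommGroup E] [NormedSpace ℝ E]
  {M : Type*} [TopologicalSpace M] [ChartedSpace E M] [IsManifold 𝓘(ℝ, E) 1 M]

theorem dualNorm_neg (F : PalaisFinsler E M) (x : M) (Δ : TangentSpace 𝓘(ℝ, E) x →L[ℝ] ℝ) :
    F.dualNorm x (-Δ) = F.dualNorm x Δ := by
  simp only [dualNorm, _root_.neg_apply, abs_neg]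

/-- Supersolutions are the opposites of subsolutions of the opposite equation. -/
theorem isViscositySupersolution_iff_neg {F : PalaisFinsler E M} {H : ℝ≥0 × M × ℝ → ℝ}
    {h : M → ℝ} {u : ℝ≥0 × M → ℝ} : F.IsViscositySupersolution H h u ↔
      F.IsViscositySubsolution (fun p => -H p) (fun x => -h x) (fun p => -u p) := by
  have hneg : Continuous fun r : ℝ => -r := continuous_neg
  have hanti : Antitone fun r : ℝ => -r := fun a b h => neg_le_neg h
  refine and_congr ⟨fun hu => hneg.comp_lowerSemicontinuous_antitone hu hanti, fun hu => ?_⟩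
    (and_congr (forall₃_congr fun t x ht => ?_) (forall_congr' fun x => neg_le_neg_iff.symm))
  · have := hneg.comp_upperSemicontinuous_antitone hu hanti
    simpa [Function.comp_def] using this
  · constructor
    · intro hs α Δ hsup
      have := hs (-α) (-Δ) (isSubdifferential_iff_neg.2 (by rwa [neg_neg, neg_neg]))
      rw [dualNorm_neg] at this
      simp only
      linarith
    · intro hs α Δ hsub
      have := hs _ _ (isSubdifferential_iff_neg.1 hsub)
      rw [dualNorm_neg] at this
      simp only at this
      linarith

/-- Lipschitz bounds are inherited by superdifferentials. -/
theorem abs_le_and_chartDual_le (F : PalaisFinsler E M) {x₀ : M} {q : ℝ × E}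
    (hq : q.2 ∈ (chartAt E x₀).target) {f G : ℝ × E → ℝ} (hG : DifferentiableAt ℝ G q)
    (hmax : IsLocalMax (fun z => f z - G z) q) {A L : ℝ} (hL : 0 ≤ L)
    (hf : ∀ᶠ z in 𝓝 q, f q - f z ≤ A * |z.1 - q.1| +
      L * F.fdist ((chartAt E x₀).symm q.2) ((chartAt E x₀).symm z.2)) :
    |fderiv ℝ G q (1, 0)| ≤ A ∧
      F.chartDual x₀ q.2 (fderiv ℝ G q ∘L ContinuousLinearMap.inr ℝ ℝ E) ≤ L := by
  have hline : ∀ w : ℝ × E, Tendsto (fun τ : ℝ => q + τ • w) (𝓝[>] 0) (𝓝 q) := fun w => by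
    have : Continuous fun τ : ℝ => q + τ • w := by fun_prop
    have := (this.tendsto 0).mono_left (nhdsWithin_le_nhds (s := Ioi 0))
    simpa using this
  constructor
  · have key : ∀ s : ℝ, |s| = 1 → -A ≤ fderiv ℝ G q (s, 0) := by
      intro s hs
      refine neg_le_of_isLocalMax_sub hG hmax ?_
      filter_upwards [(hline (s, 0)).eventually hf, self_mem_nhdsWithin] with τ h1 h2
      have h2' : (0 : ℝ) < τ := h2
      simp only [Prod.fst_add, Prod.smul_fst, Prod.snd_add, Prod.smul_snd, smul_zero, add_zero,
        fdist_self, mul_zero, add_sub_cancel_left, smul_eq_mul, abs_mul, hs, mul_one,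
        abs_of_pos h2'] at h1
      linarith
    have h1 := key 1 abs_one
    have h2 := key (-1) (by simp)
    rw [ContinuousLinearMap.apply_real_prod, show ((0 : ℝ), (0 : E)) = 0 from rfl, map_zero] at h2
    rw [abs_le]
    constructor <;> linarith
  -- By (P2) the Finsler distance along the line is at most `1 + ε` times the norm at the base
  -- point; `ε` goes to `0` only after the derivative has been bounded.
  · have key : ∀ ε > 0, ∀ v, -(L * ((1 + ε) * F.chartNorm x₀ q.2 v)) ≤ fderiv ℝ G q (0, v) := by
      intro ε hε v
      obtain ⟨δ, hδ, -, hb⟩ := F.exists_fdist_symm_le x₀ hq hε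
      refine neg_le_of_isLocalMax_sub hG hmax ?_
      have hb' : ∀ᶠ z : ℝ × E in 𝓝 q, z.2 ∈ Metric.ball q.2 δ :=
        (continuous_snd.tendsto q).eventually (Metric.ball_mem_nhds _ hδ)
      filter_upwards [(hline (0, v)).eventually hf, (hline (0, v)).eventually hb',
        self_mem_nhdsWithin] with τ h1 h3 h2
      have h2' : (0 : ℝ) < τ := h2
      have h4 := hb _ (Metric.mem_ball_self hδ) _ h3
      simp only [Prod.fst_add, Prod.smul_fst, Prod.snd_add, Prod.smul_snd, smul_zero, add_zero,
        sub_self, abs_zero, mul_zero, zero_add, add_sub_cancel_left] at h1 h4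
      rw [chartNorm_smul, abs_of_pos h2'] at h4
      have := mul_le_mul_of_nonneg_left h4 hL
      linarith
    have key' : ∀ v, -(L * F.chartNorm x₀ q.2 v) ≤ fderiv ℝ G q (0, v) := by
      intro v
      have hc : Tendsto (fun ε : ℝ => -(L * ((1 + ε) * F.chartNorm x₀ q.2 v))) (𝓝[>] 0)
          (𝓝 (-(L * F.chartNorm x₀ q.2 v))) := by
        have : Continuous fun ε : ℝ => -(L * ((1 + ε) * F.chartNorm x₀ q.2 v)) := by fun_prop
        have := (this.tendsto 0).mono_left (nhdsWithin_le_nhds (s := Ioi 0))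
        simpa using this
      refine le_of_tendsto hc ?_
      filter_upwards [self_mem_nhdsWithin] with ε hε using key ε hε v
    refine F.chartDual_le hL fun v => ?_
    have h1 := key' v
    have h2 := key' (-v)
    have h3 : F.chartNorm x₀ q.2 (-v) = F.chartNorm x₀ q.2 v := by
      have := F.chartNorm_smul x₀ q.2 v (-1)
      rwa [neg_one_smul, abs_neg, abs_one, one_mul] at this
    have h4 : fderiv ℝ G q (0, -v) = -fderiv ℝ G q (0, v) := by
      rw [← map_neg]; simp
    rw [h3, h4] at h2
    change |fderiv ℝ G q (0, v)| ≤ _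
    rw [abs_le]
    constructor <;> linarith

end PalaisFinsler

section Chart

variable {E : Type*} [NormedAddCommGroup E] {M : Type*} [TopologicalSpace M] [ChartedSpace E M]

theorem tendsto_chartAt_prod (x₀ : M) {p : ℝ≥0 × M} (hp : p.2 ∈ (chartAt E x₀).source) :
    Tendsto (fun p : ℝ≥0 × M => ((p.1 : ℝ), chartAt E x₀ p.2)) (𝓝 p)
      (𝓝 ((p.1 : ℝ), chartAt E x₀ p.2)) :=
  ((NNReal.continuous_coe.comp continuous_fst).tendsto p).prodMk_nhds
    (((chartAt E x₀).continuousAt hp).tendsto.comp (continuous_snd.tendsto p))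

theorem continuousAt_chartAt_symm_prod (x₀ : M) {q : ℝ × E} (hq : q.2 ∈ (chartAt E x₀).target) :
    ContinuousAt (fun q : ℝ × E => (q.1.toNNReal, (chartAt E x₀).symm q.2)) q :=
  ((continuous_real_toNNReal.comp continuous_fst).tendsto q).prodMk_nhds
    (((chartAt E x₀).continuousAt_symm hq).tendsto.comp (continuous_snd.tendsto q))

theorem chartFun_chartAt (x₀ : M) (u : ℝ≥0 × M → ℝ) {p : ℝ≥0 × M}
    (hp : p.2 ∈ (chartAt E x₀).source) : chartFun x₀ u ((p.1 : ℝ), chartAt E x₀ p.2) = u p := by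
  simp only [chartFun, Real.toNNReal_coe]
  rw [(chartAt E x₀).left_inv hp]

theorem upperSemicontinuousOn_chartFun (x₀ : M) {u : ℝ≥0 × M → ℝ} (hu : UpperSemicontinuous u)
    {S : Set (ℝ × E)} (hS : ∀ q ∈ S, q.2 ∈ (chartAt E x₀).target) :
    UpperSemicontinuousOn (chartFun x₀ u) S := fun q hq c hc =>
  ((continuousAt_chartAt_symm_prod x₀ (hS q hq)).eventually (hu _ c hc)).filter_mono
    nhdsWithin_le_nhds

end Chart

/-! ### Perron's method -/

namespace PalaisFinsler

variable {E : Type*} [NormedAddCommGroup E] [NormedSpace ℝ E]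
  {M : Type*} [TopologicalSpace M] [ChartedSpace E M] [IsManifold 𝓘(ℝ, E) 1 M]

theorem chartHam_neg (F : PalaisFinsler E M) (H : ℝ≥0 × M × ℝ → ℝ) (x₀ : M) (q : ℝ × E)
    (ζ : ℝ × E →L[ℝ] ℝ) :
    F.chartHam H x₀ q (-ζ) = -F.chartHam (fun p => -H p) x₀ q ζ := by
  simp only [chartHam, ContinuousLinearMap.neg_comp, chartDual_neg, _root_.neg_apply]
  ring

/-- The subsolution condition at a point of `M`, tested in a chart around this point. -/
theorem isSubsolutionAt_of_chart (F : PalaisFinsler E M) {b : E → ℝ} {K : ℝ≥0}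
    (hb : IsUnitBump b K) {H : ℝ≥0 × M × ℝ → ℝ} {u : ℝ≥0 × M → ℝ} {t : ℝ≥0} (ht : 0 < t)
    {x₀ x : M} (hx : x ∈ (chartAt E x₀).source)
    (h : ∀ G : ℝ × E → ℝ, ContDiff ℝ 1 G →
        IsLocalMax (fun q => chartFun x₀ u q - G q) ((t : ℝ), chartAt E x₀ x) →
        F.chartHam H x₀ ((t : ℝ), chartAt E x₀ x)
          (fderiv ℝ G ((t : ℝ), chartAt E x₀ x)) ≤ 0) :
    F.IsSubsolutionAt H u t x := by
  have := F.isSubsolutionAt_symm hb ht ((chartAt E x₀).map_source hx) h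
  rwa [(chartAt E x₀).left_inv hx] at this

/-- After subtracting `c t`, a test function touches a function of `x` alone that is `L`-Lipschitz:
its time derivative is `0` and its covector has dual norm at most `L`. The cases `c = -K₁`, and `c =
K₀` for `-H`, are the two barriers. -/
theorem isSubsolutionAt_mul_add (F : PalaisFinsler E M) {b : E → ℝ} {K : ℝ≥0}
    (hb : IsUnitBump b K) {H : ℝ≥0 × M × ℝ → ℝ} {h : M → ℝ} {L c : ℝ} (hL : 0 ≤ L)
    (hLip : F.IsLipschitz L h)
    (hc : ∀ (t : ℝ≥0) (x : M) (r : ℝ), 0 < t → |r| ≤ L → c + H (t, x, r) ≤ 0)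
    {t : ℝ≥0} (ht : 0 < t) (x : M) :
    F.IsSubsolutionAt H (fun p => c * (p.1 : ℝ) + h p.2) t x := by
  refine F.isSubsolutionAt_of_chart hb ht (mem_chart_source E x) fun G hG hmax => ?_
  set q : ℝ × E := ((t : ℝ), chartAt E x x) with hq
  have hyt : q.2 ∈ (chartAt E x).target := mem_chart_target E x
  set G' : ℝ × E → ℝ := fun z => G z - c * z.1 with hG'
  have hd : HasFDerivAt G' (fderiv ℝ G q - c • ContinuousLinearMap.fst ℝ ℝ E) q :=
    (hG.differentiable one_ne_zero q).hasFDerivAt.sub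
      ((ContinuousLinearMap.fst ℝ ℝ E).hasFDerivAt.const_mul c)
  have hpos : ∀ᶠ z : ℝ × E in 𝓝 q, 0 < z.1 :=
    (continuous_fst.tendsto q).eventually (lt_mem_nhds (NNReal.coe_pos.2 ht))
  have hmax' : IsLocalMax (fun z => h ((chartAt E x).symm z.2) - G' z) q := by
    filter_upwards [hmax, hpos] with z hz hz0
    simp only [chartFun, Real.coe_toNNReal _ hz0.le,
      Real.coe_toNNReal _ hpos.self_of_nhds.le] at hz
    simp only [hG']
    linarith
  have key := F.abs_le_and_chartDual_le hyt hd.differentiableAt hmax' (A := 0) hL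
    (Eventually.of_forall fun z => by
      rw [zero_mul, zero_add]
      exact (le_abs_self _).trans (hLip _ _))
  rw [hd.fderiv] at key
  have e1 : fderiv ℝ G q (1, 0) = c := by
    have := abs_nonpos_iff.1 key.1
    simp only [_root_.sub_apply, _root_.smul_apply, ContinuousLinearMap.coe_fst', smul_eq_mul,
      mul_one] at this
    linarith
  have e2 : (fderiv ℝ G q - c • ContinuousLinearMap.fst ℝ ℝ E) ∘L ContinuousLinearMap.inr ℝ ℝ E =
      fderiv ℝ G q ∘L ContinuousLinearMap.inr ℝ ℝ E := by
    ext v; simp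
  rw [e2] at key
  rw [chartHam, e1]
  refine hc _ _ _ (Real.toNNReal_pos.2 hpos.self_of_nhds) ?_
  rw [abs_of_nonneg (F.chartDual_nonneg _ _ _)]
  exact key.2

theorem exists_ball_chartHam_pos (F : PalaisFinsler E M) {H : ℝ≥0 × M × ℝ → ℝ} (hH : Continuous H)
    (x₀ : M) {q : ℝ × E} (hq : q.2 ∈ (chartAt E x₀).target) {ζ : ℝ × E →L[ℝ] ℝ}
    (hpos : 0 < F.chartHam H x₀ q ζ) :
    ∃ δ > 0, ∀ z ∈ Metric.ball q δ, ∀ ξ, ‖ξ - ζ‖ < δ → 0 < F.chartHam H x₀ z ξ := by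
  obtain ⟨δ, hδ, h⟩ := Metric.eventually_nhds_iff_ball.1
    ((F.continuousAt_chartHam hH x₀ hq ζ).eventually (lt_mem_nhds hpos))
  refine ⟨δ, hδ, fun z hz ξ hξ => h (z, ξ) ?_⟩
  rw [← ball_prod_same]
  exact ⟨hz, mem_ball_iff_norm.2 hξ⟩

/-- The upper envelope of a supremum of subsolutions is a subsolution. -/
theorem isSubsolutionAt_uscEnvelope [RegularSpace M] [CompletelyRegularSpace M] [CompleteSpace E]
    (F : PalaisFinsler E M)
    {b : E → ℝ} {K : ℝ≥0} (hb : IsUnitBump b K) {H : ℝ≥0 × M × ℝ → ℝ} (hH : Continuous H)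
    {u m : ℝ≥0 × M → ℝ} (hm : Continuous m) (hum : ∀ p, u p ≤ m p)
    (hsup : ∀ p, ∀ c < u p, ∃ w : ℝ≥0 × M → ℝ, UpperSemicontinuous w ∧ (∀ p, w p ≤ u p) ∧
      (∀ (t : ℝ≥0) (x : M), 0 < t → F.IsSubsolutionAt H w t x) ∧ c < w p)
    {t : ℝ≥0} (ht : 0 < t) (x : M) : F.IsSubsolutionAt H (uscEnvelope u) t x := by
  have hx := mem_chart_source E x
  refine F.isSubsolutionAt_of_chart hb ht hx fun G hG hmax => ?_
  set φ := chartAt E x with hφ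
  set U := uscEnvelope u with hU
  have huU : ∀ p, u p ≤ U p := le_uscEnvelope hm hum
  set q₀ : ℝ × E := ((t : ℝ), φ x) with hq₀
  by_contra hcon
  rw [not_le] at hcon
  obtain ⟨δ, hδ, hδH⟩ := F.exists_ball_chartHam_pos hH x (q := q₀) (mem_chart_target E x) hcon
  set c₀ := chartFun x U q₀ - G q₀ with hc₀
  have hdG : Continuous (fderiv ℝ G) := hG.continuous_fderiv one_ne_zero
  have hgood : ∀ᶠ q in 𝓝 q₀, (q.2 ∈ φ.target ∧ 0 < q.1 ∧ chartFun x U q - G q ≤ c₀) ∧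
      ‖fderiv ℝ G q - fderiv ℝ G q₀‖ < δ / 3 ∧ q ∈ Metric.ball q₀ δ := by
    refine (Filter.Eventually.and ?_ (Filter.Eventually.and ?_ hmax)).and
      (Filter.Eventually.and ?_ (Metric.ball_mem_nhds _ hδ))
    · exact (continuous_snd.tendsto q₀).eventually
        (φ.open_target.mem_nhds (mem_chart_target E x))
    · exact (continuous_fst.tendsto q₀).eventually (lt_mem_nhds (NNReal.coe_pos.2 ht))
    · have : Continuous fun q => ‖fderiv ℝ G q - fderiv ℝ G q₀‖ :=
        (hdG.sub continuous_const).norm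
      exact this.continuousAt.eventually (gt_mem_nhds (by simp only [sub_self, norm_zero]; linarith))
  obtain ⟨r, hr, hball⟩ := Metric.nhds_basis_closedBall.mem_iff.1 hgood
  obtain ⟨br, Kr, hbr⟩ := hasC1LipschitzBump_real.exists_isUnitBump
  have hB := hbr.prod hb
  set Λ : ℝ := r⁻¹ * (Kr + K : ℝ≥0) with hΛ
  have hΛ0 : 0 ≤ Λ := by positivity
  set β : ℝ × E → ℝ := fun q => br (r⁻¹ • (q - q₀)).1 * b (r⁻¹ • (q - q₀)).2 with hβ
  have hβd : ContDiff ℝ 1 β := hB.contDiff_rescale r⁻¹ q₀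
  have hβΛ : ∀ q, ‖fderiv ℝ β q‖ ≤ Λ := hB.norm_fderiv_rescale_le (by positivity) q₀
  have hβ1 : ∀ q, β q ≤ 1 := fun q => hB.le_one _
  have hβe : ∀ᶠ q in 𝓝 q₀, β q = 1 := by
    have : Continuous fun q => r⁻¹ • (q - q₀) := by fun_prop
    have := this.tendsto q₀
    rw [sub_self, smul_zero] at this
    exact this.eventually hB.eventually_eq_one
  -- Three errors must add up to less than `δ`: the variation of `fderiv ℝ G` and the derivative of
  -- `ψ`, each at most `δ / 3`, and the derivative of the bump, at most `η * Λ`.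
  set η : ℝ := δ / (4 * (Λ + 1)) with hη
  have hη0 : 0 < η := by positivity
  have hηΛ : η * Λ < δ / 3 := by
    have : η * (4 * (Λ + 1)) = δ := by rw [hη]; field_simp
    nlinarith
  -- a member of the family which is almost maximal near the point
  have hV : ∀ᶠ q in 𝓝 q₀, β q = 1 ∧ G q < G q₀ + η / 8 ∧ q ∈ Metric.closedBall q₀ r :=
    hβe.and ((hG.continuous.continuousAt.eventually (gt_mem_nhds (by linarith))).and
      (Metric.closedBall_mem_nhds _ hr))
  have hV' := ((tendsto_chartAt_prod (E := E) x (p := (t, x)) hx).eventually hV).and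
    ((continuous_snd.tendsto (t, x)).eventually (φ.open_source.mem_nhds hx))
  -- Otherwise `u ≤ U (t, x) - η / 8` near `(t, x)`, and the envelope would satisfy the same bound
  -- at `(t, x)`.
  have hex : ∃ p, ((β ((p.1 : ℝ), φ p.2) = 1 ∧ G ((p.1 : ℝ), φ p.2) < G q₀ + η / 8 ∧
      ((p.1 : ℝ), φ p.2) ∈ Metric.closedBall q₀ r) ∧ p.2 ∈ φ.source) ∧ U (t, x) - η / 8 < u p := by
    by_contra hno
    push Not at hno
    have := uscEnvelope_le_of_eventually_le hm hum (hV'.mono fun p hp => hno p hp)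
    linarith
  obtain ⟨p', ⟨⟨hp1, hp2, hp3⟩, hps⟩, hp4⟩ := hex
  obtain ⟨w, hw, hwu, hws, hwp⟩ := hsup p' _ hp4
  set q' : ℝ × E := ((p'.1 : ℝ), φ p'.2) with hq'
  have hUq₀ : chartFun x U q₀ = U (t, x) := chartFun_chartAt x U (p := (t, x)) hx
  have hwq' : chartFun x w q' = w p' := chartFun_chartAt x w hps
  -- The bump gives an advantage `η` at `q'`, more than the three losses `η / 8` from `w`, `G` and
  -- `ψ`. Where the bump vanishes, `f` is at most `c₀`; so the perturbed maximum is interior and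
  -- yields a test function for `w`.
  set f : ℝ × E → ℝ := fun q => chartFun x w q + (η * β q - G q) with hf
  have hwU : ∀ q : ℝ × E, chartFun x w q ≤ chartFun x U q := fun q => (hwu _).trans (huU _)
  have hfc : Continuous fun q => η * β q - G q :=
    (continuous_const.mul hβd.continuous).sub hG.continuous
  have hfu : UpperSemicontinuousOn f (Metric.closedBall q₀ r) :=
    (upperSemicontinuousOn_chartFun x hw fun q hq => (hball hq).1.1).add
      (hfc.upperSemicontinuous.upperSemicontinuousOn _)
  have hfb : BddAbove (f '' Metric.closedBall q₀ r) := by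
    refine ⟨c₀ + η, ?_⟩
    rintro _ ⟨q, hq, rfl⟩
    have h1 := (hball hq).1.2.2
    have h2 := hwU q
    have h3 := mul_le_mul_of_nonneg_left (hβ1 q) hη0.le
    simp only [hf]
    linarith
  obtain ⟨ψ, hψ, hψε, hψd, q, hq, hqmax⟩ := hB.exists_perturbation_isMaxOn
    Metric.isClosed_closedBall ⟨q', hp3⟩ hfu hfb (ε := min (η / 8) (δ / 3)) (by positivity)
  have hval : c₀ < f q := by
    have h1 := hqmax q' hp3
    have h2 := (hψε q').1
    have h3 := (hψε q).2.trans (min_le_left _ _)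
    simp only [hf] at h1 ⊢
    rw [hwq', hp1] at h1
    rw [hc₀, hUq₀]
    linarith
  have hβq : β q ≠ 0 := by
    intro h0
    have h1 := (hball hq).1.2.2
    have h2 := hwU q
    simp only [hf, h0] at hval
    linarith
  have hqr : ‖q - q₀‖ < r := by
    by_contra hno
    refine hβq (hB.eq_zero _ ?_)
    rw [norm_smul, Real.norm_of_nonneg (by positivity), ← div_eq_inv_mul, le_div_iff₀ hr, one_mul]
    exact not_lt.1 hno
  obtain ⟨⟨hqt, hq0, -⟩, hqd, hqδ⟩ := hball hq
  have hG2 : ContDiff ℝ 1 fun z => G z - η * β z - ψ z :=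
    (hG.sub (contDiff_const.mul hβd)).sub hψ
  have hlm : IsLocalMax (fun z => chartFun x w z - (G z - η * β z - ψ z)) q := by
    filter_upwards [Metric.isOpen_ball.mem_nhds (mem_ball_iff_norm.2 hqr)] with z hz
    have := hqmax z (Metric.ball_subset_closedBall hz)
    simp only [hf] at this
    linarith
  have hq1 : ((q.1.toNNReal : ℝ), q.2) = q := by rw [Real.coe_toNNReal _ hq0.le]
  have hle := (hws q.1.toNNReal (φ.symm q.2) (Real.toNNReal_pos.2 hq0)).chartHam_le hb hqt hG2
    (by rw [hq1]; exact hlm)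
  rw [hq1] at hle
  refine absurd hle (not_le.2 (hδH q hqδ _ ?_))
  have hder : fderiv ℝ (fun z => G z - η * β z - ψ z) q =
      fderiv ℝ G q - η • fderiv ℝ β q - fderiv ℝ ψ q :=
    (((hG.differentiable one_ne_zero q).hasFDerivAt.sub
      ((hβd.differentiable one_ne_zero q).hasFDerivAt.const_mul η)).sub
      (hψ.differentiable one_ne_zero q).hasFDerivAt).fderiv
  rw [hder, show fderiv ℝ G q - η • fderiv ℝ β q - fderiv ℝ ψ q - fderiv ℝ G q₀ =
    (fderiv ℝ G q - fderiv ℝ G q₀) - η • fderiv ℝ β q - fderiv ℝ ψ q by abel]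
  have h1 : ‖η • fderiv ℝ β q‖ ≤ η * Λ := by
    rw [norm_smul, Real.norm_of_nonneg hη0.le]
    exact mul_le_mul_of_nonneg_left (hβΛ q) hη0.le
  have h2 := (hψd q).trans (min_le_right _ _)
  have h3 := norm_sub_le (fderiv ℝ G q - fderiv ℝ G q₀ - η • fderiv ℝ β q) (fderiv ℝ ψ q)
  have h4 := norm_sub_le (fderiv ℝ G q - fderiv ℝ G q₀) (η • fderiv ℝ β q)
  linarith

/-- Perron's bump argument: the lower envelope of a maximal subsolution is a supersolution. -/
theorem isSubsolutionAt_neg_uscEnvelope_neg [RegularSpace M] [CompletelyRegularSpace M]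
    (F : PalaisFinsler E M) {b : E → ℝ} {K : ℝ≥0} (hb : IsUnitBump b K) {H : ℝ≥0 × M × ℝ → ℝ}
    (hH : Continuous H) {U l m : ℝ≥0 × M → ℝ} (hl : Continuous l) (hm : Continuous m)
    (hlU : ∀ p, l p ≤ U p) (hUm : ∀ p, U p ≤ m p) (hUusc : UpperSemicontinuous U)
    (hUsub : ∀ (t : ℝ≥0) (x : M), 0 < t → F.IsSubsolutionAt H U t x)
    (hmsup : ∀ (t : ℝ≥0) (x : M), 0 < t →
      F.IsSubsolutionAt (fun p => -H p) (fun p => -m p) t x)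
    (hmaxl : ∀ w : ℝ≥0 × M → ℝ, UpperSemicontinuous w →
      (∀ (t : ℝ≥0) (x : M), 0 < t → F.IsSubsolutionAt H w t x) → (∀ p, U p ≤ w p) →
      (∀ p, w p ≤ m p) → (∀ x, w (0, x) = U (0, x)) → ∀ p, w p ≤ U p)
    {t : ℝ≥0} (ht : 0 < t) (x : M) :
    F.IsSubsolutionAt (fun p => -H p) (uscEnvelope fun p => -U p) t x := by
  classical
  have hx := mem_chart_source E x
  have hyt := mem_chart_target E x
  set n := uscEnvelope fun p => -U p with hn
  have hUl : ∀ p, -U p ≤ -l p := fun p => neg_le_neg (hlU p)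
  have hnU : ∀ p, -U p ≤ n p := le_uscEnvelope hl.neg hUl
  have hnm : ∀ p, -m p ≤ n p := fun p => (neg_le_neg (hUm p)).trans (hnU p)
  -- Here `-n` is the lower envelope of `U`. Where it meets `m`, a test function for `n` also tests
  -- `-m`, and the barrier is already known to satisfy the inequality. The bump needs room below
  -- `m`.
  rcases (hnm (t, x)).eq_or_lt with heq | hlt
  · rintro α Δ ⟨g, hg, hmax, hdiff⟩
    refine hmsup t x ht α Δ ⟨g, hg, ?_, hdiff⟩
    filter_upwards [hmax] with p hp
    linarith [hnm p]
  refine F.isSubsolutionAt_of_chart hb ht hx fun G hG hmax => ?_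
  set φ := chartAt E x with hφ
  set q₀ : ℝ × E := ((t : ℝ), φ x) with hq₀
  by_contra hcon
  rw [not_le] at hcon
  have hnq₀ : chartFun x n q₀ = n (t, x) := chartFun_chartAt (E := E) x n (p := (t, x)) hx
  have hmq₀ : chartFun x m q₀ = m (t, x) := chartFun_chartAt (E := E) x m (p := (t, x)) hx
  set c₀ := n (t, x) - G q₀ with hc₀
  obtain ⟨δ, hδ, hδH⟩ := F.exists_ball_chartHam_pos (H := fun p => -H p) hH.neg x (q := q₀) hyt hcon
  have hdG : Continuous (fderiv ℝ G) := hG.continuous_fderiv one_ne_zero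
  -- Half of the gap between `-n` and `m` at the point: the height to which a bump may rise.
  set η₀ := (m (t, x) + n (t, x)) / 2 with hη₀
  have hη₀0 : 0 < η₀ := by rw [hη₀]; linarith
  obtain ⟨N, ⟨hN, hNc⟩, hNs⟩ := (closed_nhds_basis x).mem_iff.1 (φ.open_source.mem_nhds hx)
  have hgood : ∀ᶠ q in 𝓝 q₀, (q.2 ∈ φ.target ∧ 0 < q.1 ∧ φ.symm q.2 ∈ N) ∧
      chartFun x n q - G q ≤ c₀ ∧ -G q - c₀ + η₀ < chartFun x m q ∧
      ‖fderiv ℝ G q - fderiv ℝ G q₀‖ < δ / 2 ∧ q ∈ Metric.ball q₀ δ := by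
    refine (Filter.Eventually.and ?_ (Filter.Eventually.and ?_ ?_)).and
      (Filter.Eventually.and ?_ (Filter.Eventually.and ?_ (Filter.Eventually.and ?_
        (Metric.ball_mem_nhds _ hδ))))
    · exact (continuous_snd.tendsto q₀).eventually (φ.open_target.mem_nhds hyt)
    · exact (continuous_fst.tendsto q₀).eventually (lt_mem_nhds (NNReal.coe_pos.2 ht))
    · have h1 : φ.symm ⁻¹' N ∈ 𝓝 (φ x) :=
        (φ.continuousAt_symm hyt).preimage_mem_nhds (by rwa [φ.left_inv hx])
      exact (continuous_snd.tendsto q₀).eventually h1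
    · filter_upwards [hmax] with q hq
      rw [hnq₀] at hq
      exact hq
    · have h1 : ContinuousAt (chartFun x m) q₀ :=
        hm.continuousAt.comp (continuousAt_chartAt_symm_prod x (q := q₀) hyt)
      have h2 : ContinuousAt (fun q => -G q - c₀ + η₀) q₀ :=
        ((hG.continuous.neg.sub continuous_const).add continuous_const).continuousAt
      refine h2.eventually_lt h1 ?_
      rw [hmq₀]
      linarith
    · have : Continuous fun q => ‖fderiv ℝ G q - fderiv ℝ G q₀‖ :=
        (hdG.sub continuous_const).norm
      exact this.continuousAt.eventually (gt_mem_nhds (by simp only [sub_self, norm_zero]; linarith))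
  obtain ⟨r, hr, hball⟩ := Metric.nhds_basis_ball.mem_iff.1 hgood
  obtain ⟨br, Kr, hbr⟩ := hasC1LipschitzBump_real.exists_isUnitBump
  have hB := hbr.prod hb
  have hr2 : 0 < r / 2 := by linarith
  set Λ : ℝ := (r / 2)⁻¹ * (Kr + K : ℝ≥0) with hΛ
  have hΛ0 : 0 ≤ Λ := by positivity
  set β : ℝ × E → ℝ := fun q => br ((r / 2)⁻¹ • (q - q₀)).1 * b ((r / 2)⁻¹ • (q - q₀)).2 with hβ
  have hβd : ContDiff ℝ 1 β := hB.contDiff_rescale (r / 2)⁻¹ q₀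
  have hβΛ : ∀ q, ‖fderiv ℝ β q‖ ≤ Λ := hB.norm_fderiv_rescale_le (by positivity) q₀
  have hβ1 : ∀ q, β q ≤ 1 := fun q => hB.le_one _
  have hβ0 : ∀ q, q ∉ Metric.closedBall q₀ (r / 2) → β q = 0 := by
    intro q hq
    rw [mem_closedBall_iff_norm, not_le] at hq
    refine hB.eq_zero _ ?_
    rw [norm_smul, Real.norm_of_nonneg (by positivity), ← div_eq_inv_mul, le_div_iff₀ hr2, one_mul]
    exact hq.le
  have hβe : ∀ᶠ q in 𝓝 q₀, β q = 1 := by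
    have : Continuous fun q => (r / 2)⁻¹ • (q - q₀) := by fun_prop
    have := this.tendsto q₀
    rw [sub_self, smul_zero] at this
    exact this.eventually hB.eventually_eq_one
  set η : ℝ := min η₀ (δ / (4 * (Λ + 1))) with hη
  have hη0 : 0 < η := by positivity
  have hηη₀ : η ≤ η₀ := min_le_left _ _
  have hηΛ : η * Λ < δ / 2 := by
    have h1 : η ≤ δ / (4 * (Λ + 1)) := min_le_right _ _
    rw [le_div_iff₀ (by positivity)] at h1
    nlinarith
  -- `-G - c₀` touches `-n` from below at `q₀` and is a strict classical subsolution nearby, since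
  -- `G` violates the opposite inequality strictly. The bump lifts it by `η` at `q₀` and keeps it a
  -- subsolution.
  set Ψ : ℝ × E → ℝ := fun q => -G q - c₀ + η * β q with hΨ
  have hΨd : ContDiff ℝ 1 Ψ := (hG.neg.sub contDiff_const).add (contDiff_const.mul hβd)
  set θ : ℝ≥0 × M → ℝ × E := fun p => ((p.1 : ℝ), φ p.2) with hθ
  set O : Set (ℝ≥0 × M) := {p | p.2 ∈ φ.source ∧ θ p ∈ Metric.ball q₀ r} with hO
  -- The closed neighbourhood `N` inside the chart domain makes `D` closed in the whole space, not
  -- only in the chart. As `w = U` off `D`, the pasting is then upper semicontinuous.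
  set D : Set (ℝ≥0 × M) := {p | p.2 ∈ N ∧ θ p ∈ Metric.closedBall q₀ (r / 2)} with hD
  have hOo : IsOpen O := isOpen_iff_mem_nhds.2 fun p hp =>
    ((continuous_snd.tendsto p).eventually (φ.open_source.mem_nhds hp.1)).and
      ((tendsto_chartAt_prod (E := E) x hp.1).eventually (Metric.isOpen_ball.mem_nhds hp.2))
  have hDc : IsClosed D := by
    have : ContinuousOn θ (Prod.snd ⁻¹' N) := fun p hp =>
      (tendsto_chartAt_prod (E := E) x (hNs hp)).mono_left nhdsWithin_le_nhds
    exact this.preimage_isClosed_of_isClosed (hNc.preimage continuous_snd)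
      Metric.isClosed_closedBall
  have hDO : D ⊆ O := fun p hp =>
    ⟨hNs hp.1, Metric.closedBall_subset_ball (by linarith) hp.2⟩
  have hΨU : ∀ p ∈ O, p ∉ D → Ψ (θ p) ≤ U p := by
    intro p hp hpD
    obtain ⟨⟨h1, h2, h3⟩, h4, -⟩ := hball hp.2
    have hpN : p.2 ∈ N := by rwa [φ.left_inv hp.1] at h3
    have h5 := hβ0 (θ p) fun h => hpD ⟨hpN, h⟩
    have h6 : chartFun x n (θ p) = n p := chartFun_chartAt (E := E) x n hp.1
    rw [h6] at h4
    simp only [hΨ, h5]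
    linarith [hnU p]
  set w : ℝ≥0 × M → ℝ := fun p => if p ∈ O then max (U p) (Ψ (θ p)) else U p with hw
  have hwO : ∀ p ∈ O, w p = max (U p) (Ψ (θ p)) := fun p hp => if_pos hp
  have hwD : ∀ p, p ∉ D → w p = U p := by
    intro p hp
    by_cases hpO : p ∈ O
    · rw [hwO p hpO, max_eq_left (hΨU p hpO hp)]
    · exact if_neg hpO
  have hUw : ∀ p, U p ≤ w p := by
    intro p
    by_cases hpO : p ∈ O
    · rw [hwO p hpO]; exact le_max_left _ _
    · exact (if_neg hpO).ge
  have hwm : ∀ p, w p ≤ m p := by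
    intro p
    by_cases hpO : p ∈ O
    · rw [hwO p hpO]
      refine max_le (hUm p) ?_
      have h1 := (hball hpO.2).2.2.1
      have h6 : chartFun x m (θ p) = m p := chartFun_chartAt (E := E) x m hpO.1
      rw [h6] at h1
      have := mul_le_mul_of_nonneg_left (hβ1 (θ p)) hη0.le
      simp only [hΨ]
      linarith
    · exact (if_neg hpO).le.trans (hUm p)
  have hw0 : ∀ z, w (0, z) = U (0, z) := by
    intro z
    refine if_neg fun h => ?_
    exact absurd (hball h.2).1.2.1 (by simp [hθ])
  have hwusc : UpperSemicontinuous w := by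
    intro p c hc
    by_cases hpD : p ∈ D
    · have hpO := hDO hpD
      rw [hwO p hpO, max_lt_iff] at hc
      have h1 : Tendsto (fun p => Ψ (θ p)) (𝓝 p) (𝓝 (Ψ (θ p))) :=
        (hΨd.continuous.tendsto _).comp (tendsto_chartAt_prod (E := E) x hpO.1)
      filter_upwards [hOo.mem_nhds hpO, hUusc p c hc.1, h1.eventually (gt_mem_nhds hc.2)]
        with z hz h2 h3
      rw [hwO z hz]
      exact max_lt h2 h3
    · rw [hwD p hpD] at hc
      filter_upwards [hDc.isOpen_compl.mem_nhds hpD, hUusc p c hc] with z hz h2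
      rwa [hwD z hz]
  -- Where `w = U`, a test function for `w` also tests `U`, because `U ≤ w`. Elsewhere `w` agrees at
  -- the point with the smooth minorant `Ψ`, and every test function has the derivative of `Ψ`
  -- there.
  have hwsub : ∀ (s : ℝ≥0) (z : M), 0 < s → F.IsSubsolutionAt H w s z := by
    intro s z hs
    by_cases hwU : w (s, z) = U (s, z)
    · rintro α Δ ⟨g, hg, hmx, hdiff⟩
      refine hUsub s z hs α Δ ⟨g, hg, ?_, hdiff⟩
      filter_upwards [hmx] with p hp
      simp only [hwU] at hp ⊢
      linarith [hUw p]
    · have hpO : (s, z) ∈ O := by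
        by_contra h
        exact hwU (if_neg h)
      have hwΨ : w (s, z) = Ψ (θ (s, z)) := by
        rw [hwO _ hpO] at hwU ⊢
        rcases max_choice (U (s, z)) (Ψ (θ (s, z))) with h | h
        · exact absurd h hwU
        · exact h
      refine F.isSubsolutionAt_of_chart hb hs hpO.1 fun G' hG' hmx => ?_
      set q : ℝ × E := θ (s, z) with hq
      obtain ⟨⟨hqt, hq0, -⟩, -, -, hqd, hqδ⟩ := hball hpO.2
      have hlm : IsLocalMax (fun z => Ψ z - G' z) q := by
        have hev : ∀ᶠ z in 𝓝 q, z ∈ Metric.ball q₀ r := Metric.isOpen_ball.mem_nhds hpO.2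
        filter_upwards [hmx, hev] with z' h1 h2
        have e1 : chartFun x w (θ (s, z)) = w (s, z) := chartFun_chartAt (E := E) x w hpO.1
        have h1' : chartFun x w z' - G' z' ≤ chartFun x w (θ (s, z)) - G' q := h1
        rw [e1, hwΨ] at h1'
        obtain ⟨⟨h3, h4, -⟩, -⟩ := hball h2
        have e2 : θ (z'.1.toNNReal, φ.symm z'.2) = z' := by
          simp only [hθ, Real.coe_toNNReal _ h4.le, φ.right_inv h3]
        have h5 : (z'.1.toNNReal, φ.symm z'.2) ∈ O := ⟨φ.map_target h3, by rw [e2]; exact h2⟩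
        have h6 : Ψ z' ≤ chartFun x w z' := by
          have := hwO _ h5
          rw [e2] at this
          have h7 : chartFun x w z' = w (z'.1.toNNReal, φ.symm z'.2) := rfl
          rw [h7, this]
          exact le_max_right _ _
        linarith
      have hder : fderiv ℝ Ψ q = -fderiv ℝ G q + η • fderiv ℝ β q :=
        ((((hG.differentiable one_ne_zero q).hasFDerivAt.neg).sub_const c₀).add
          ((hβd.differentiable one_ne_zero q).hasFDerivAt.const_mul η)).fderiv
      have heq : fderiv ℝ Ψ q - fderiv ℝ G' q = 0 := by
        rw [← hlm.fderiv_eq_zero]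
        exact ((hΨd.differentiable one_ne_zero q).hasFDerivAt.sub
          (hG'.differentiable one_ne_zero q).hasFDerivAt).fderiv.symm
      rw [sub_eq_zero] at heq
      change F.chartHam H x q (fderiv ℝ G' q) ≤ 0
      have h1 := hδH q hqδ (-fderiv ℝ Ψ q) (by
        rw [hder, neg_add, neg_neg, add_sub_right_comm]
        refine (norm_add_le _ _).trans_lt ?_
        rw [norm_neg, norm_smul, Real.norm_of_nonneg hη0.le]
        have := mul_le_mul_of_nonneg_left (hβΛ q) hη0.le
        linarith)
      have h2 := F.chartHam_neg H x q (-fderiv ℝ Ψ q)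
      rw [neg_neg] at h2
      rw [← heq, h2]
      linarith
  have hfin := hmaxl w hwusc hwsub hUw hwm hw0
  -- Maximality puts the lifted `Ψ` below `U`; this lowers `-U` near the point by a fixed amount
  -- under the value of its own envelope.
  have hend : ∀ᶠ p in 𝓝 (t, x), -U p ≤ n (t, x) - η / 2 := by
    have h1 : ∀ᶠ q in 𝓝 q₀, β q = 1 ∧ G q < G q₀ + η / 2 :=
      hβe.and (hG.continuous.continuousAt.eventually (gt_mem_nhds (by linarith)))
    have hpO : (t, x) ∈ O := ⟨hx, Metric.mem_ball_self hr⟩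
    filter_upwards [(tendsto_chartAt_prod (E := E) x (p := (t, x)) hx).eventually h1,
      hOo.mem_nhds hpO] with p h2 h3
    have h4 := hfin p
    rw [hwO p h3] at h4
    have h5 := (le_max_right (U p) (Ψ (θ p))).trans h4
    have h2' : β (θ p) = 1 ∧ G (θ p) < G q₀ + η / 2 := h2
    simp only [hΨ, h2'.1] at h5
    linarith [h2'.2]
  have := uscEnvelope_le_of_eventually_le hl.neg hUl hend
  linarith

end PalaisFinsler

/-! ### Ekeland's principle -/

/-- Ekeland's variational principle. -/
theorem exists_le_and_forall_le_add_mul {X : Type*} {ρ : X → X → ℝ} (hself : ∀ x, ρ x x = 0)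
    (hsymm : ∀ x y, ρ x y = ρ y x) (htri : ∀ x y z, ρ x z ≤ ρ x y + ρ y z)
    (hnn : ∀ x y, 0 ≤ ρ x y) {A : Set X} {Φ : X → ℝ} (hbd : BddAbove (Φ '' A))
    (hcomp : ∀ s : ℕ → X, (∀ n, s n ∈ A) →
      (∀ ε > 0, ∃ N, ∀ m ≥ N, ∀ n ≥ N, ρ (s m) (s n) < ε) →
      ∃ x ∈ A, Tendsto (fun n => ρ (s n) x) atTop (𝓝 0) ∧
        ∀ c, Φ x < c → ∀ᶠ n in atTop, Φ (s n) < c)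
    {ε : ℝ} (hε : 0 < ε) {x₀ : X} (hx₀ : x₀ ∈ A) :
    ∃ x ∈ A, Φ x₀ ≤ Φ x ∧ ∀ y ∈ A, Φ y ≤ Φ x + ε * ρ x y := by
  -- Greedy choice: among the points whose gain over `x` pays `ε` times their distance to `x`, one
  -- that is best up to `2⁻ⁿ`.
  have step : ∀ (n : ℕ) (x : A), ∃ y : A, Φ x + ε * ρ x y ≤ Φ y ∧
      ∀ z ∈ A, Φ x + ε * ρ x z ≤ Φ z → Φ z ≤ Φ y + (1 / 2) ^ n := by
    intro n x
    set S : Set X := {z | z ∈ A ∧ Φ x + ε * ρ x z ≤ Φ z} with hS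
    have hxS : (x : X) ∈ S := ⟨x.2, by rw [hself, mul_zero, add_zero]⟩
    have hSb : BddAbove (Φ '' S) := hbd.mono (image_mono fun z hz => hz.1)
    obtain ⟨_, ⟨y, hy, rfl⟩, hlt⟩ := exists_lt_of_lt_csSup (⟨_, mem_image_of_mem Φ hxS⟩)
      (sub_lt_self (sSup (Φ '' S)) (by positivity : (0 : ℝ) < (1 / 2) ^ n))
    refine ⟨⟨y, hy.1⟩, hy.2, fun z hz hz2 => ?_⟩
    have := le_csSup hSb (mem_image_of_mem Φ (show z ∈ S from ⟨hz, hz2⟩))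
    simp only
    linarith
  choose nxt hn1 hn2 using step
  let s : ℕ → A := fun n => Nat.rec (motive := fun _ => A) ⟨x₀, hx₀⟩ (fun n x => nxt n x) n
  have hs1 : ∀ n, Φ (s n) + ε * ρ (s n) (s (n + 1)) ≤ Φ (s (n + 1)) := fun n => hn1 n (s n)
  have hs2 : ∀ n, ∀ z ∈ A, Φ (s n) + ε * ρ (s n) z ≤ Φ z → Φ z ≤ Φ (s (n + 1)) + (1 / 2) ^ n :=
    fun n => hn2 n (s n)
  have htrans : ∀ x y z, Φ x + ε * ρ x y ≤ Φ y → Φ y + ε * ρ y z ≤ Φ z →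
      Φ x + ε * ρ x z ≤ Φ z := by
    intro x y z h1 h2
    have := mul_le_mul_of_nonneg_left (htri x y z) hε.le
    linarith
  have hs3 : ∀ n k, Φ (s n) + ε * ρ (s n) (s (n + k)) ≤ Φ (s (n + k)) := by
    intro n k
    induction k with
    | zero => simp [hself]
    | succ k ih => exact htrans _ _ _ ih (hs1 (n + k))
  have hmono : Monotone fun n => Φ (s n) := monotone_nat_of_le_succ fun n => by
    have := hs1 n
    have := mul_nonneg hε.le (hnn (s n) (s (n + 1)))
    linarith
  have hbs : BddAbove (range fun n => Φ (s n)) :=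
    hbd.mono (by rintro _ ⟨n, rfl⟩; exact mem_image_of_mem Φ (s n).2)
  have hlim := tendsto_atTop_ciSup hmono hbs
  set a := ⨆ n, Φ (s n) with ha
  have hle : ∀ n, Φ (s n) ≤ a := fun n => le_ciSup hbs n
  have hcau : ∀ δ > 0, ∃ N, ∀ m ≥ N, ∀ n ≥ N, ρ (s m) (s n) < δ := by
    intro δ hδ
    obtain ⟨N, hN⟩ := eventually_atTop.1 (hlim.eventually (lt_mem_nhds
      (sub_lt_self a (by positivity : 0 < ε * δ))))
    have key : ∀ m ≥ N, ∀ n ≥ m, ρ (s m) (s n) < δ := by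
      intro m hm n hn
      obtain ⟨k, rfl⟩ := Nat.exists_eq_add_of_le hn
      have h1 := hs3 m k
      have h2 := hle (m + k)
      have h3 := hN m hm
      have : ε * ρ (s m) (s (m + k)) < ε * δ := by linarith
      exact lt_of_mul_lt_mul_left this hε.le
    refine ⟨N, fun m hm n hn => ?_⟩
    rcases le_total m n with h | h
    · exact key m hm n h
    · rw [hsymm]; exact key n hn m h
  obtain ⟨x, hx, hρ, husc⟩ := hcomp (fun n => s n) (fun n => (s n).2) hcau
  have hax : a ≤ Φ x := by
    refine le_of_forall_pos_le_add fun δ hδ => ?_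
    refine le_of_tendsto hlim ?_
    filter_upwards [husc (Φ x + δ) (by linarith)] with n hn using hn.le
  have hnx : ∀ n, Φ (s n) + ε * ρ (s n) x ≤ Φ x := by
    intro n
    refine le_trans ?_ hax
    have h1 : Tendsto (fun m => a + ε * ρ (s m) x) atTop (𝓝 (a + ε * 0)) :=
      tendsto_const_nhds.add (tendsto_const_nhds.mul hρ)
    rw [mul_zero, add_zero] at h1
    refine ge_of_tendsto h1 ?_
    filter_upwards [eventually_ge_atTop n] with m hm
    obtain ⟨k, rfl⟩ := Nat.exists_eq_add_of_le hm
    have h2 := mul_le_mul_of_nonneg_left (htri (s n) (s (n + k)) x) hε.le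
    linarith [hs3 n k, hle (n + k)]
  refine ⟨x, hx, ?_, fun y hy => ?_⟩
  · have := hnx 0
    have := mul_nonneg hε.le (hnn (s 0) x)
    change Φ (s 0) ≤ Φ x
    linarith
  · by_contra hcon
    rw [not_le] at hcon
    -- By `htrans`, a point improving on `x` is an admissible competitor at every stage, so it
    -- exceeds `Φ x` by at most `2⁻ⁿ`.
    have h1 : ∀ n : ℕ, Φ y ≤ Φ x + (1 / 2) ^ n := by
      intro n
      have h2 := hs2 n y hy (htrans _ _ _ (hnx n) hcon.le)
      have h3 := hnx (n + 1)
      have := mul_nonneg hε.le (hnn (s (n + 1)) x)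
      linarith
    have h2 : Tendsto (fun n : ℕ => Φ x + (1 / 2 : ℝ) ^ n) atTop (𝓝 (Φ x + 0)) :=
      tendsto_const_nhds.add (tendsto_pow_atTop_nhds_zero_of_lt_one (by norm_num) (by norm_num))
    rw [add_zero] at h2
    have h3 := ge_of_tendsto' h2 h1
    have := mul_nonneg hε.le (hnn x y)
    linarith

/-! ### Doubling of variables and the comparison principle -/

namespace PalaisFinsler

variable {E : Type*} [NormedAddCommGroup E] [NormedSpace ℝ E]
  {M : Type*} [TopologicalSpace M] [ChartedSpace E M] [IsManifold 𝓘(ℝ, E) 1 M]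

/-- Doubling of variables near an almost maximum of `f₁ + f₂ - θ`, where `f₁` and `f₂` are
subsolutions of the equations with Hamiltonians `H` and `-H`, and `f₂` is Lipschitz near this
point. -/
theorem exists_almost_opposite_superdifferentials [ConnectedSpace M] [RegularSpace M]
    [CompleteSpace E]
    (F : PalaisFinsler E M) {b : E → ℝ} {K : ℝ≥0} (hb : IsUnitBump b K) {H : ℝ≥0 × M × ℝ → ℝ}
    {f₁ f₂ : ℝ≥0 × M → ℝ} (hf₁ : UpperSemicontinuous f₁)
    (hs₁ : ∀ (t : ℝ≥0) (x : M), 0 < t → F.IsSubsolutionAt H f₁ t x)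
    (hs₂ : ∀ (t : ℝ≥0) (x : M), 0 < t → F.IsSubsolutionAt (fun p => -H p) f₂ t x)
    (hf₂ : F.IsLocallyLipschitz f₂) {t : ℝ≥0} (ht : 0 < t) (x : M) {θ : ℝ → ℝ}
    (hθ : ContDiffAt ℝ 1 θ t) {ε : ℝ} (hε : 0 < ε)
    (hmax : ∀ᶠ p in 𝓝 (t, x), f₁ p + f₂ p - θ p.1 ≤
      f₁ (t, x) + f₂ (t, x) - θ t + ε * (|(p.1 : ℝ) - t| + F.fdist x p.2)) :
    ∃ R : ℝ, 0 ≤ R ∧ ∀ σ > 0, ∃ (t₁ t₂ : ℝ≥0) (x₁ x₂ : M) (α₁ α₂ N₁ N₂ : ℝ),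
      α₁ + H (t₁, x₁, N₁) ≤ 0 ∧ α₂ - H (t₂, x₂, N₂) ≤ 0 ∧ |(t₁ : ℝ) - t₂| ≤ σ ∧
      F.fdist x₁ x₂ ≤ σ ∧ |N₁ - N₂| ≤ 4 * ε + σ ∧ |N₁| ≤ R ∧ |N₂| ≤ R ∧
      deriv θ t - 2 * ε - σ ≤ α₁ + α₂ := by
  have hx := mem_chart_source E x
  have hyt := mem_chart_target E x
  set φ := chartAt E x with hφ
  set q₀ : ℝ × E := ((t : ℝ), φ x) with hq₀
  obtain ⟨br, Kr, hbr⟩ := hasC1LipschitzBump_real.exists_isUnitBump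
  have hB := hbr.prod hb
  obtain ⟨K₀', V, hV, hK₀'⟩ := hf₂ (t, x)
  set K₀ := |K₀'| with hK₀
  have hK₀0 : 0 ≤ K₀ := abs_nonneg _
  have hK : ∀ q ∈ V, ∀ q' ∈ V,
      |f₂ q - f₂ q'| ≤ K₀ * (|(q.1 : ℝ) - (q'.1 : ℝ)| + F.fdist q.2 q'.2) := fun q hq q' hq' =>
    (hK₀' q hq q' hq').trans (mul_le_mul_of_nonneg_right (le_abs_self _)
      (add_nonneg (abs_nonneg _) (F.fdist_nonneg _ _)))
  obtain ⟨k, hk1, hk⟩ := F.chartNorm_equiv x hyt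
  obtain ⟨k', hk'1, hk'⟩ := F.exists_chartDual_le_norm x hyt
  obtain ⟨δ₁, hδ₁, -, hfd⟩ := F.exists_fdist_symm_le x hyt one_pos
  have hfd' : ∀ z ∈ Metric.ball (φ x) δ₁, ∀ z' ∈ Metric.ball (φ x) δ₁,
      F.fdist (φ.symm z) (φ.symm z') ≤ 2 * k * ‖z - z'‖ := by
    intro z hz z' hz'
    refine (hfd z hz z' hz').trans ?_
    have := (hk (z' - z)).2
    rw [norm_sub_rev] at this
    linarith
  -- The bound depends on the Lipschitz constant and `ε` but not on `σ`, which can therefore be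
  -- chosen after it. It comes from `N₁ ≤ 2 * a₁` and `a₁ ≤ 2 * K₀ + 5 * ε`.
  refine ⟨4 * K₀ + 10 * ε, by positivity, fun σ hσ => ?_⟩
  set s := min σ ε with hs
  have hs0 : 0 < s := by positivity
  have hsσ : s ≤ σ := min_le_left _ _
  have hsε : s ≤ ε := min_le_right _ _
  -- Makes the multiplicative errors of (P2), applied to norms controlled by `K₀` and `ε`, at most
  -- `s / 2`.
  set μ := min 1 (s / (2 * (6 * K₀ + 10 * ε))) with hμ
  have hμ0 : 0 < μ := by positivity
  have hμ1 : μ ≤ 1 := min_le_left _ _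
  have hμs : μ * (6 * K₀ + 10 * ε) ≤ s / 2 := by
    have : μ ≤ s / (2 * (6 * K₀ + 10 * ε)) := min_le_right _ _
    rw [le_div_iff₀ (by positivity)] at this
    linarith
  set τ := s / (4 * (k + k')) with hτ
  have hτ0 : 0 < τ := by positivity
  have hτs : 4 * k * τ + 4 * k' * τ = s := by rw [hτ]; field_simp
  have hkτ : τ ≤ k * τ := le_mul_of_one_le_left hτ0.le hk1
  have hk'τ : τ ≤ k' * τ := le_mul_of_one_le_left hτ0.le hk'1
  -- a global smooth function which agrees with `θ`
  obtain ⟨Θ, hΘ, hΘe⟩ := hB.exists_contDiff_eventuallyEq (G := fun q : ℝ × E => θ q.1) (p := q₀)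
    (hθ.comp q₀ contDiffAt_fst)
  have hθd : HasFDerivAt Θ (deriv θ t • ContinuousLinearMap.fst ℝ ℝ E) q₀ := by
    have h1 : HasFDerivAt (fun q : ℝ × E => θ q.1) (deriv θ t • ContinuousLinearMap.fst ℝ ℝ E) q₀ :=
      HasDerivAt.comp_hasFDerivAt q₀ (hθ.differentiableAt one_ne_zero).hasDerivAt hasFDerivAt_fst
    exact h1.congr_of_eventuallyEq hΘe
  -- The point is maximal up to slope `ε`; subtracting slope `2 * ε` leaves a strong maximum, with
  -- gap `ε` times the distance, as the fuzzy sum rule requires. The superdifferentials of `f₃` have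
  -- components of size at most `2 * ε`.
  set f₃ : ℝ × E → ℝ := fun q => -(2 * ε * (|q.1 - t| + F.fdist x (φ.symm q.2))) with hf₃
  have hcs := continuousAt_chartAt_symm_prod (E := E) x (q := q₀) hyt
  have hback : ((q₀.1.toNNReal, φ.symm q₀.2) : ℝ≥0 × M) = (t, x) := by
    simp only [hq₀, Real.toNNReal_coe, φ.left_inv hx]
  rw [ContinuousAt, hback] at hcs
  have hgood : ∀ᶠ q in 𝓝 q₀, (q.2 ∈ φ.target ∧ 0 < q.1 ∧ q.2 ∈ Metric.ball (φ x) δ₁ ∧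
      (q.1.toNNReal, φ.symm q.2) ∈ interior V) ∧
      (Θ q = θ q.1 ∧ ‖fderiv ℝ Θ q - fderiv ℝ Θ q₀‖ < τ ∧ Θ q₀ - 1 < Θ q) ∧
      (chartFun x f₁ q < f₁ (t, x) + 1) ∧
      (chartFun x f₁ q + chartFun x f₂ q - θ q.1 ≤ f₁ (t, x) + f₂ (t, x) - θ t +
        ε * (|q.1 - t| + F.fdist x (φ.symm q.2))) ∧
      ∀ ℓ : E →L[ℝ] ℝ, F.chartDual x (φ x) ℓ ≤ (1 + μ) * F.chartDual x q.2 ℓ ∧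
      F.chartDual x q.2 ℓ ≤ (1 + μ) * F.chartDual x (φ x) ℓ := by
    have hpos : ∀ᶠ q : ℝ × E in 𝓝 q₀, 0 < q.1 :=
      (continuous_fst.tendsto q₀).eventually (lt_mem_nhds (NNReal.coe_pos.2 ht))
    refine (Filter.Eventually.and ?_ (hpos.and (Filter.Eventually.and ?_ ?_))).and
      (Filter.Eventually.and (hΘe.and (Filter.Eventually.and ?_ ?_))
      (Filter.Eventually.and ?_ (Filter.Eventually.and ?_ ?_)))
    · exact (continuous_snd.tendsto q₀).eventually (φ.open_target.mem_nhds hyt)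
    · exact (continuous_snd.tendsto q₀).eventually (Metric.ball_mem_nhds _ hδ₁)
    · exact hcs.eventually (interior_mem_nhds.2 hV)
    · have : Continuous fun q => ‖fderiv ℝ Θ q - fderiv ℝ Θ q₀‖ :=
        ((hΘ.continuous_fderiv one_ne_zero).sub continuous_const).norm
      exact this.continuousAt.eventually (gt_mem_nhds (by simp only [sub_self, norm_zero]; exact hτ0))
    · exact hΘ.continuous.continuousAt.eventually (lt_mem_nhds (by linarith))
    · exact hcs.eventually (hf₁ (t, x) _ (by linarith))
    · filter_upwards [hcs.eventually hmax, hpos] with q h1 h2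
      simp only [Real.coe_toNNReal _ h2.le] at h1
      exact h1
    · exact (continuous_snd.tendsto q₀).eventually (F.eventually_chartDual_le x hyt hμ0)
  obtain ⟨r, hr, hball⟩ := Metric.nhds_basis_closedBall.mem_iff.1 hgood
  set L : ℝ := (K₀ + 2 * ε) * (1 + 2 * k) with hL
  have hL0 : 0 ≤ L := by positivity
  have hrho : ∀ z ∈ Metric.closedBall q₀ r, ∀ z' ∈ Metric.closedBall q₀ r,
      |z.1 - z'.1| + F.fdist (φ.symm z.2) (φ.symm z'.2) ≤ (1 + 2 * k) * ‖z - z'‖ := by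
    intro z hz z' hz'
    have h1 : |z.1 - z'.1| ≤ ‖z - z'‖ := norm_fst_le (z - z')
    have h2 : ‖z.2 - z'.2‖ ≤ ‖z - z'‖ := norm_snd_le (z - z')
    have h3 := hfd' _ (hball hz).1.2.2.1 _ (hball hz').1.2.2.1
    have h4 : 2 * k * ‖z.2 - z'.2‖ ≤ 2 * k * ‖z - z'‖ := by gcongr
    linarith
  have hL₂ : LipschitzOnWith L.toNNReal (chartFun x f₂) (Metric.closedBall q₀ r) := by
    refine LipschitzOnWith.of_dist_le_mul fun z hz z' hz' => ?_
    rw [Real.coe_toNNReal _ hL0, Real.dist_eq, dist_eq_norm]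
    obtain ⟨⟨-, hz0, -, hzV⟩, -⟩ := hball hz
    obtain ⟨⟨-, hz0', -, hzV'⟩, -⟩ := hball hz'
    have h1 := hK _ (interior_subset hzV) _ (interior_subset hzV')
    simp only [Real.coe_toNNReal _ hz0.le, Real.coe_toNNReal _ hz0'.le] at h1
    refine h1.trans ?_
    have h2 := mul_le_mul_of_nonneg_left (hrho z hz z' hz') hK₀0
    refine h2.trans ?_
    rw [hL, mul_assoc]
    gcongr
    linarith
  have hL₃ : LipschitzOnWith L.toNNReal f₃ (Metric.closedBall q₀ r) := by
    refine LipschitzOnWith.of_dist_le_mul fun z hz z' hz' => ?_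
    rw [Real.coe_toNNReal _ hL0, Real.dist_eq, dist_eq_norm]
    have h1 := hrho z hz z' hz'
    have h2 := abs_abs_sub_abs_le_abs_sub (z.1 - t) (z'.1 - t)
    rw [sub_sub_sub_cancel_right] at h2
    have h3 : |F.fdist x (φ.symm z.2) - F.fdist x (φ.symm z'.2)| ≤
        F.fdist (φ.symm z.2) (φ.symm z'.2) := by
      have e1 := F.fdist_triangle x (φ.symm z.2) (φ.symm z'.2)
      have e2 := F.fdist_triangle x (φ.symm z'.2) (φ.symm z.2)
      rw [F.fdist_comm (φ.symm z'.2)] at e2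
      rw [abs_sub_le_iff]
      constructor <;> linarith
    have h4 : |f₃ z - f₃ z'| ≤ 2 * ε * (|z.1 - z'.1| + F.fdist (φ.symm z.2) (φ.symm z'.2)) := by
      have : f₃ z - f₃ z' = -(2 * ε * ((|z.1 - t| - |z'.1 - t|) +
          (F.fdist x (φ.symm z.2) - F.fdist x (φ.symm z'.2)))) := by
        simp only [hf₃]; ring
      rw [this, abs_neg, abs_mul, abs_of_pos (by positivity : 0 < 2 * ε)]
      gcongr
      exact (abs_add_le _ _).trans (add_le_add h2 h3)
    refine h4.trans ?_
    have h5 := mul_le_mul_of_nonneg_left h1 (by positivity : 0 ≤ 2 * ε)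
    refine h5.trans ?_
    rw [hL, mul_assoc (K₀ + 2 * ε)]
    gcongr
    linarith
  -- The smooth term joins `f₁`; its derivative is restored in `ζ₁`.
  set g₁ : ℝ × E → ℝ := fun q => chartFun x f₁ q + -Θ q with hg₁
  have hg₁u : UpperSemicontinuousOn g₁ (Metric.closedBall q₀ r) :=
    (upperSemicontinuousOn_chartFun x hf₁ fun q hq => (hball hq).1.1).add
      ((continuous_neg.comp hΘ.continuous).upperSemicontinuous.upperSemicontinuousOn _)
  have hg₁b : BddAbove (g₁ '' Metric.closedBall q₀ r) := by
    refine ⟨f₁ (t, x) + 1 + (1 - Θ q₀), ?_⟩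
    rintro _ ⟨q, hq, rfl⟩
    obtain ⟨-, ⟨-, -, h1⟩, h2, -⟩ := hball hq
    simp only [hg₁]
    linarith
  have hq₀b : q₀ ∈ Metric.closedBall q₀ r := Metric.mem_closedBall_self hr.le
  have hstrong : ∀ s > 0, ∃ κ > 0, ∀ q ∈ Metric.closedBall q₀ r, s ≤ ‖q - q₀‖ →
      g₁ q + chartFun x f₂ q + f₃ q ≤ g₁ q₀ + chartFun x f₂ q₀ + f₃ q₀ - κ := by
    intro s hs
    have hU : φ.source ∩ φ ⁻¹' Metric.ball (φ x) s ∈ 𝓝 x :=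
      inter_mem (φ.open_source.mem_nhds hx)
        ((φ.continuousAt hx).preimage_mem_nhds (Metric.ball_mem_nhds _ hs))
    obtain ⟨d, hd, hdU⟩ := F.exists_fdist_lt_imp_mem hb hU
    refine ⟨ε * min s d, by positivity, fun q hq hqs => ?_⟩
    obtain ⟨⟨hqt, -, -, -⟩, ⟨h1, -, -⟩, -, h2, -⟩ := hball hq
    have h3 : min s d ≤ |q.1 - t| + F.fdist x (φ.symm q.2) := by
      rw [Prod.norm_def, le_max_iff] at hqs
      rcases hqs with h | h
      · exact (min_le_left _ _).trans (h.trans (le_add_of_nonneg_right (F.fdist_nonneg _ _)))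
      · refine (min_le_right _ _).trans (le_trans ?_ (le_add_of_nonneg_left (abs_nonneg _)))
        by_contra hcon
        have h4 := (hdU _ (not_le.1 hcon)).2
        rw [mem_preimage, φ.right_inv hqt, mem_ball_iff_norm] at h4
        exact absurd h (not_le.2 h4)
    have h4 := mul_le_mul_of_nonneg_left h3 hε.le
    have e1 : chartFun x f₁ q₀ = f₁ (t, x) := chartFun_chartAt (E := E) x f₁ (p := (t, x)) hx
    have e2 : chartFun x f₂ q₀ = f₂ (t, x) := chartFun_chartAt (E := E) x f₂ (p := (t, x)) hx
    have e3 : f₃ q₀ = 0 := by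
      simp only [hf₃, hq₀, sub_self, abs_zero, φ.left_inv hx, fdist_self]; ring
    have e4 : Θ q₀ = θ t := hΘe.self_of_nhds
    simp only [hg₁, e1, e2, e3, e4, h1]
    simp only [hf₃]
    linarith
  obtain ⟨q₁, q₂, q₃, G₁, G₂, G₃, ⟨hq₁, hG₁, hm₁⟩, ⟨hq₂, hG₂, hm₂⟩, ⟨hq₃, hG₃, hm₃⟩, hsum⟩ :=
    hB.fuzzy_sum_rule hr hg₁u hg₁b hL₂ hL₃ hstrong (σ := min τ r) (by positivity)
  have hin : ∀ q ∈ Metric.ball q₀ (min τ r), q ∈ Metric.closedBall q₀ r := fun q hq =>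
    Metric.ball_subset_closedBall (Metric.ball_subset_ball (min_le_right _ _) hq)
  have hinτ : ∀ q ∈ Metric.ball q₀ (min τ r), ‖q - q₀‖ ≤ τ := fun q hq =>
    (mem_ball_iff_norm.1 hq).le.trans (min_le_left _ _)
  obtain ⟨⟨hq₁t, hq₁0, hq₁δ, -⟩, ⟨-, hq₁Θ, -⟩, -, -, hq₁D⟩ := hball (hin _ hq₁)
  obtain ⟨⟨hq₂t, hq₂0, hq₂δ, hq₂V⟩, -, -, -, hq₂D⟩ := hball (hin _ hq₂)
  obtain ⟨⟨hq₃t, hq₃0, hq₃δ, -⟩, -, -, -, hq₃D⟩ := hball (hin _ hq₃)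
  have hcoe₁ : ((q₁.1.toNNReal : ℝ), q₁.2) = q₁ := by rw [Real.coe_toNNReal _ hq₁0.le]
  have hcoe₂ : ((q₂.1.toNNReal : ℝ), q₂.2) = q₂ := by rw [Real.coe_toNNReal _ hq₂0.le]
  set ζ₂ := fderiv ℝ G₂ q₂ with hζ₂
  set ζ₃ := fderiv ℝ G₃ q₃ with hζ₃
  have hd₁ : HasFDerivAt (fun q => G₁ q + Θ q) (fderiv ℝ G₁ q₁ + fderiv ℝ Θ q₁) q₁ :=
    (hG₁.differentiable one_ne_zero q₁).hasFDerivAt.add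
      (hΘ.differentiable one_ne_zero q₁).hasFDerivAt
  set ζ₁ := fderiv ℝ G₁ q₁ + fderiv ℝ Θ q₁ with hζ₁
  have hham₁ : F.chartHam H x q₁ ζ₁ ≤ 0 := by
    have h1 : IsLocalMax (fun q => chartFun x f₁ q - (G₁ q + Θ q)) q₁ := by
      filter_upwards [hm₁] with q hq
      simp only [hg₁] at hq ⊢
      linarith
    have := (hs₁ q₁.1.toNNReal (φ.symm q₁.2) (Real.toNNReal_pos.2 hq₁0)).chartHam_le hb hq₁t
      (hG₁.add hΘ) (by rw [hcoe₁]; exact h1)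
    rw [hcoe₁] at this
    rwa [← hd₁.fderiv]
  have hham₂ : F.chartHam (fun p => -H p) x q₂ ζ₂ ≤ 0 := by
    have := (hs₂ q₂.1.toNNReal (φ.symm q₂.2) (Real.toNNReal_pos.2 hq₂0)).chartHam_le hb hq₂t
      hG₂ (by rw [hcoe₂]; exact hm₂)
    rwa [hcoe₂] at this
  -- `f₁` has no Lipschitz bound: `ζ₁` is controlled only through the bounds on `ζ₂` and `ζ₃` and
  -- the near-cancellation of the sum.
  have hb₂ := F.abs_le_and_chartDual_le hq₂t (hG₂.differentiable one_ne_zero q₂) hm₂ hK₀0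
    (A := K₀) (by
      have hV' : ∀ᶠ z : ℝ × E in 𝓝 q₂, (z.1.toNNReal, φ.symm z.2) ∈ interior V :=
        (continuousAt_chartAt_symm_prod (E := E) x hq₂t).eventually
          (isOpen_interior.mem_nhds hq₂V)
      have hpos : ∀ᶠ z : ℝ × E in 𝓝 q₂, 0 < z.1 :=
        (continuous_fst.tendsto q₂).eventually (lt_mem_nhds hq₂0)
      filter_upwards [hV', hpos] with z h1 h2
      have h3 := hK _ (interior_subset hq₂V) _ (interior_subset h1)
      simp only [Real.coe_toNNReal _ hq₂0.le, Real.coe_toNNReal _ h2.le] at h3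
      rw [abs_sub_comm z.1, ← mul_add]
      exact (le_abs_self _).trans h3)
  have hb₃ := F.abs_le_and_chartDual_le hq₃t (hG₃.differentiable one_ne_zero q₃) hm₃
    (A := 2 * ε) (L := 2 * ε) (by positivity) (Eventually.of_forall fun z => by
      have h1 := F.fdist_triangle x (φ.symm q₃.2) (φ.symm z.2)
      have h2 : |z.1 - t| ≤ |z.1 - q₃.1| + |q₃.1 - t| := abs_sub_le _ _ _
      have h3 := mul_le_mul_of_nonneg_left (add_le_add h1 h2) (by positivity : 0 ≤ 2 * ε)
      simp only [hf₃]
      linarith)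
  -- comparison of the three derivatives
  set e := ζ₁ + ζ₂ + ζ₃ - fderiv ℝ Θ q₀ with he
  have hen : ‖e‖ ≤ 2 * τ := by
    have : e = (fderiv ℝ G₁ q₁ + ζ₂ + ζ₃) + (fderiv ℝ Θ q₁ - fderiv ℝ Θ q₀) := by
      rw [he, hζ₁]; abel
    rw [this]
    have h1 := norm_add_le (fderiv ℝ G₁ q₁ + ζ₂ + ζ₃) (fderiv ℝ Θ q₁ - fderiv ℝ Θ q₀)
    have h2 := hsum.trans (min_le_left _ _)
    linarith
  rw [hθd.fderiv] at he
  have hα : deriv θ t - 2 * ε - 2 * τ ≤ ζ₁ (1, 0) + ζ₂ (1, 0) := by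
    have h1 : |e (1, 0)| ≤ 2 * τ := by
      refine (e.le_opNorm _).trans ?_
      have : ‖((1 : ℝ), (0 : E))‖ = 1 := by simp [Prod.norm_def]
      rw [this, mul_one]
      exact hen
    have h2 : e (1, 0) = ζ₁ (1, 0) + ζ₂ (1, 0) + ζ₃ (1, 0) - deriv θ t := by
      rw [he]; simp
    rw [h2] at h1
    have h3 := (abs_le.1 h1).1
    have h4 := (abs_le.1 hb₃.1).2
    linarith
  set ι := ContinuousLinearMap.inr ℝ ℝ E with hι
  have heι : ζ₁ ∘L ι + ζ₂ ∘L ι + ζ₃ ∘L ι = e ∘L ι := by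
    rw [he]; ext v; simp [hι]
  have heN : F.chartDual x (φ x) (e ∘L ι) ≤ s / 2 := by
    refine (hk' _).trans ?_
    have h1 : ‖e ∘L ι‖ ≤ 2 * τ := by
      refine ContinuousLinearMap.opNorm_le_bound _ (by positivity) fun v => ?_
      have : ‖ι v‖ = ‖v‖ := by simp [hι, Prod.norm_def]
      change ‖e (ι v)‖ ≤ _
      calc ‖e (ι v)‖ ≤ ‖e‖ * ‖ι v‖ := e.le_opNorm _
        _ ≤ 2 * τ * ‖v‖ := by rw [this]; gcongr
    have h2 := mul_le_mul_of_nonneg_left h1 (by linarith : 0 ≤ k')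
    have h3 : 0 ≤ k * τ := by positivity
    linarith
  -- The covectors live at three different points, while the triangle inequality needs one norm. All
  -- are measured at `φ x`, and each change of point costs a factor `1 + μ`.
  set a₁ := F.chartDual x (φ x) (ζ₁ ∘L ι) with ha₁
  set a₂ := F.chartDual x (φ x) (ζ₂ ∘L ι) with ha₂
  set a₃ := F.chartDual x (φ x) (ζ₃ ∘L ι) with ha₃
  have h12 : a₁ ≤ a₂ + a₃ + s / 2 := by
    have e1 : ζ₁ ∘L ι = e ∘L ι + (-(ζ₂ ∘L ι) + -(ζ₃ ∘L ι)) := by rw [← heι]; abel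
    have h1 := F.chartDual_add_le x hyt (e ∘L ι) (-(ζ₂ ∘L ι) + -(ζ₃ ∘L ι))
    have h2 := F.chartDual_add_le x hyt (-(ζ₂ ∘L ι)) (-(ζ₃ ∘L ι))
    rw [chartDual_neg, chartDual_neg] at h2
    rw [← e1] at h1
    linarith
  have h21 : a₂ ≤ a₁ + a₃ + s / 2 := by
    have e1 : ζ₂ ∘L ι = e ∘L ι + (-(ζ₁ ∘L ι) + -(ζ₃ ∘L ι)) := by rw [← heι]; abel
    have h1 := F.chartDual_add_le x hyt (e ∘L ι) (-(ζ₁ ∘L ι) + -(ζ₃ ∘L ι))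
    have h2 := F.chartDual_add_le x hyt (-(ζ₁ ∘L ι)) (-(ζ₃ ∘L ι))
    rw [chartDual_neg, chartDual_neg] at h2
    rw [← e1] at h1
    linarith
  set N₁ := F.chartDual x q₁.2 (ζ₁ ∘L ι) with hN₁
  set N₂ := F.chartDual x q₂.2 (ζ₂ ∘L ι) with hN₂
  have hN₁0 : 0 ≤ N₁ := F.chartDual_nonneg _ _ _
  have hN₂0 : 0 ≤ N₂ := F.chartDual_nonneg _ _ _
  have ha₁0 : 0 ≤ a₁ := F.chartDual_nonneg _ _ _
  have ha₂0 : 0 ≤ a₂ := F.chartDual_nonneg _ _ _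
  have hN₂K : N₂ ≤ K₀ := hb₂.2
  have d₁ : a₁ ≤ (1 + μ) * N₁ ∧ N₁ ≤ (1 + μ) * a₁ := hq₁D (ζ₁ ∘L ι)
  have d₂ : a₂ ≤ (1 + μ) * N₂ ∧ N₂ ≤ (1 + μ) * a₂ := hq₂D (ζ₂ ∘L ι)
  have ha₂K : a₂ ≤ 2 * K₀ := d₂.1.trans (mul_le_mul (by linarith) hN₂K hN₂0 (by norm_num))
  have ha₃ε : a₃ ≤ 4 * ε := by
    refine (hq₃D (ζ₃ ∘L ι)).1.trans ?_
    calc _ ≤ 2 * (2 * ε) := mul_le_mul (by linarith) hb₃.2 (F.chartDual_nonneg _ _ _) (by norm_num)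
      _ = 4 * ε := by ring
  have ha₁R : a₁ ≤ 2 * K₀ + 5 * ε := by linarith
  have hN₁a : N₁ ≤ 2 * a₁ := d₁.2.trans (mul_le_mul_of_nonneg_right (by linarith) ha₁0)
  have m1 : μ * a₁ ≤ μ * (2 * K₀ + 5 * ε) := mul_le_mul_of_nonneg_left ha₁R hμ0.le
  have m2 : μ * N₂ ≤ μ * K₀ := mul_le_mul_of_nonneg_left hN₂K hμ0.le
  have m3 : μ * a₂ ≤ μ * (2 * K₀) := mul_le_mul_of_nonneg_left ha₂K hμ0.le
  have m4 : μ * N₁ ≤ μ * (2 * a₁) := mul_le_mul_of_nonneg_left hN₁a hμ0.le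
  have m5 : 0 ≤ μ * K₀ := by positivity
  have m6 : 0 ≤ μ * ε := by positivity
  refine ⟨q₁.1.toNNReal, q₂.1.toNNReal, φ.symm q₁.2, φ.symm q₂.2, ζ₁ (1, 0), ζ₂ (1, 0), N₁, N₂,
    hham₁, ?_, ?_, ?_, ?_, ?_, ?_, ?_⟩
  · have : ζ₂ (1, 0) + -H (q₂.1.toNNReal, φ.symm q₂.2, N₂) ≤ 0 := hham₂
    linarith
  · rw [Real.coe_toNNReal _ hq₁0.le, Real.coe_toNNReal _ hq₂0.le]
    have h1 : |q₁.1 - q₂.1| ≤ ‖q₁ - q₂‖ := norm_fst_le (q₁ - q₂)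
    have h2 := norm_sub_le_norm_sub_add_norm_sub q₁ q₀ q₂
    rw [norm_sub_rev q₀] at h2
    linarith [hinτ _ hq₁, hinτ _ hq₂]
  · have h1 : ‖q₁.2 - q₂.2‖ ≤ ‖q₁ - q₂‖ := norm_snd_le (q₁ - q₂)
    have h2 := norm_sub_le_norm_sub_add_norm_sub q₁ q₀ q₂
    rw [norm_sub_rev q₀] at h2
    have h3 : ‖q₁.2 - q₂.2‖ ≤ 2 * τ := by linarith [hinτ _ hq₁, hinτ _ hq₂]
    have h4 := mul_le_mul_of_nonneg_left h3 (by linarith : 0 ≤ 2 * k)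
    linarith [hfd' _ hq₁δ _ hq₂δ]
  · rw [abs_le]
    constructor <;> linarith [d₁.1, d₁.2, d₂.1, d₂.2]
  · rw [abs_of_nonneg hN₁0]; linarith
  · rw [abs_of_nonneg hN₂0]; linarith
  · linarith

theorem IsLocallyLipschitz.continuous (F : PalaisFinsler E M) {f : ℝ≥0 × M → ℝ}
    (hf : F.IsLocallyLipschitz f) : Continuous f := by
  refine continuous_iff_continuousAt.2 fun p => ?_
  obtain ⟨K, V, hV, hK⟩ := hf p
  have h1 : Tendsto (fun q : ℝ≥0 × M => K * (|(p.1 : ℝ) - (q.1 : ℝ)| + F.fdist p.2 q.2)) (𝓝 p)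
      (𝓝 (K * (0 + 0))) := by
    refine tendsto_const_nhds.mul (Tendsto.add ?_ ?_)
    · have : Continuous fun q : ℝ≥0 × M => |(p.1 : ℝ) - (q.1 : ℝ)| := by fun_prop
      simpa using this.tendsto p
    · exact (F.tendsto_fdist_nhds p.2).comp continuous_snd.continuousAt
  rw [add_zero, mul_zero] at h1
  refine tendsto_iff_dist_tendsto_zero.2 (squeeze_zero' (.of_forall fun _ => dist_nonneg) ?_ h1)
  filter_upwards [hV] with q hq
  rw [dist_comm]
  exact hK p (mem_of_mem_nhds hV) q hq

theorem ConditionA.neg {F : PalaisFinsler E M} {H : ℝ≥0 × M × ℝ → ℝ} (hA : F.ConditionA H) :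
    F.ConditionA fun p => -H p := by
  obtain ⟨C, w, hC, hw, hw0, h⟩ := hA
  refine ⟨C, w, hC, hw, hw0, fun t₁ t₂ x₁ x₂ r₁ r₂ => ?_⟩
  have := h t₁ t₂ x₁ x₂ r₁ r₂
  rw [← abs_neg] at this
  convert this using 2
  ring

/-- Ekeland's principle on `[0, T'] × M`. -/
theorem exists_strip_forall_le_add_mul [ConnectedSpace M] [RegularSpace M]
    (F : PalaisFinsler E M) {b : E → ℝ} {K : ℝ≥0} (hb : IsUnitBump b K)
    (hcomplete : F.IsComplete) {Φ : ℝ≥0 × M → ℝ} {T' : ℝ≥0}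
    (hbd : BddAbove (Φ '' {p | p.1 ≤ T'}))
    (husc : ∀ p : ℝ≥0 × M, p.1 ≤ T' → UpperSemicontinuousAt Φ p) {ε : ℝ} (hε : 0 < ε)
    {p₀ : ℝ≥0 × M} (hp₀ : p₀.1 ≤ T') :
    ∃ p : ℝ≥0 × M, p.1 ≤ T' ∧ Φ p₀ ≤ Φ p ∧ ∀ q : ℝ≥0 × M, q.1 ≤ T' →
      Φ q ≤ Φ p + ε * (|(q.1 : ℝ) - p.1| + F.fdist p.2 q.2) := by
  refine exists_le_and_forall_le_add_mul (A := {p : ℝ≥0 × M | p.1 ≤ T'})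
    (ρ := fun p q : ℝ≥0 × M => |(q.1 : ℝ) - p.1| + F.fdist p.2 q.2)
    (fun p => by simp [fdist_self])
    (fun p q => by rw [abs_sub_comm, F.fdist_comm])
    (fun p q r => by
      have h1 := F.fdist_triangle p.2 q.2 r.2
      have h2 := abs_sub_le (r.1 : ℝ) q.1 p.1
      linarith)
    (fun p q => add_nonneg (abs_nonneg _) (F.fdist_nonneg _ _)) hbd (fun s hs hcau => ?_) hε hp₀
  have hc1 : CauchySeq fun n => (s n).1 := by
    refine Metric.cauchySeq_iff.2 fun δ hδ => ?_
    obtain ⟨N, hN⟩ := hcau δ hδ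
    refine ⟨N, fun m hm n hn => ?_⟩
    have h1 := hN m hm n hn
    have h2 := F.fdist_nonneg (s m).2 (s n).2
    rw [dist_comm, NNReal.dist_eq]
    linarith
  obtain ⟨t, ht⟩ := cauchySeq_tendsto_of_complete hc1
  obtain ⟨x, hx⟩ := hcomplete (fun n => (s n).2) fun δ hδ => by
    obtain ⟨N, hN⟩ := hcau δ hδ
    refine ⟨N, fun m hm n hn => ?_⟩
    have h1 := hN m hm n hn
    have h2 := abs_nonneg (((s n).1 : ℝ) - (s m).1)
    linarith
  -- Completeness gives convergence for the distance; semicontinuity is stated for the topology of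
  -- `M`.
  have hx' := F.tendsto_of_tendsto_fdist hb hx
  have hst : Tendsto s atTop (𝓝 (t, x)) := ht.prodMk_nhds hx'
  have htT : t ≤ T' := le_of_tendsto' ht hs
  refine ⟨(t, x), htT, ?_, fun c hc => hst.eventually (husc (t, x) htT c hc)⟩
  have h1 : Tendsto (fun n => |(t : ℝ) - ((s n).1 : ℝ)|) atTop (𝓝 0) := by
    have : Continuous fun r : ℝ≥0 => |(t : ℝ) - (r : ℝ)| := by fun_prop
    simpa [Function.comp_def] using (this.tendsto t).comp ht
  simpa using h1.add hx

/-- The comparison principle: if `f₁` is a subsolution and `-f₂` a locally Lipschitz supersolution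
with `f₁ ≤ -f₂` for `t = 0`, then `f₁ ≤ -f₂` everywhere. -/
theorem add_nonpos_of_isSubsolutionAt [ConnectedSpace M] [RegularSpace M] [CompleteSpace E]
    (F : PalaisFinsler E M) {b : E → ℝ} {K : ℝ≥0} (hb : IsUnitBump b K)
    (hcomplete : F.IsComplete) {H : ℝ≥0 × M × ℝ → ℝ} (hA : F.ConditionA H)
    {f₁ f₂ : ℝ≥0 × M → ℝ} (hf₁ : UpperSemicontinuous f₁)
    (hs₁ : ∀ (t : ℝ≥0) (x : M), 0 < t → F.IsSubsolutionAt H f₁ t x)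
    (hs₂ : ∀ (t : ℝ≥0) (x : M), 0 < t → F.IsSubsolutionAt (fun p => -H p) f₂ t x)
    (hf₂ : F.IsLocallyLipschitz f₂) (h0 : ∀ x, f₁ (0, x) + f₂ (0, x) ≤ 0)
    (hbd : ∀ T : ℝ, 0 < T → ∃ B : ℝ, ∀ (t : ℝ≥0) (x : M), (t : ℝ) < T →
      f₁ (t, x) + f₂ (t, x) ≤ B) (p : ℝ≥0 × M) : f₁ p + f₂ p ≤ 0 := by
  by_contra hcon
  rw [not_le] at hcon
  set a := f₁ p + f₂ p with ha
  set T : ℝ := p.1 + 1 with hT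
  have hT1 : 1 ≤ T := by have := p.1.2; simp only [hT]; linarith [p.1.coe_nonneg]
  obtain ⟨B, hB⟩ := hbd T (by linarith)
  have haB : a ≤ B := hB p.1 p.2 (by linarith)
  have hB0 : 0 < B := hcon.trans_le haB
  set η := a / 2 with hη
  have hη0 : 0 < η := by positivity
  have hηB : η / B ≤ 1 / 2 := by rw [div_le_iff₀ hB0]; linarith
  have hηB0 : 0 < η / B := by positivity
  obtain ⟨T', hT'⟩ : ∃ T' : ℝ≥0, (T' : ℝ) = T - η / B := ⟨⟨T - η / B, by linarith⟩, rfl⟩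
  have hlt : ∀ t : ℝ≥0, t ≤ T' → η / B ≤ T - t := by
    intro t ht
    have : (t : ℝ) ≤ T' := by exact_mod_cast ht
    linarith
  -- The penalty equals `η = a / 2` at time `p.1`, so `Φ p` stays positive, and `B` at time `T'`, so
  -- `Φ` is not positive there. Its slope on `[0, T)` is at least `η / T ^ 2`.
  set θ : ℝ → ℝ := fun s => η / (T - s) with hθ
  have hθ0 : ∀ t : ℝ≥0, t ≤ T' → 0 < θ t := fun t ht => div_pos hη0 (by linarith [hlt t ht])
  have hθd : ∀ t : ℝ, t < T → ContDiffAt ℝ 1 θ t ∧ deriv θ t = η / (T - t) ^ 2 := by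
    intro t ht
    have hne : T - t ≠ 0 := by linarith
    refine ⟨contDiffAt_const.div (contDiffAt_const.sub contDiffAt_id) hne, ?_⟩
    have h1 : HasDerivAt (fun s => T - s) (-1) t := by
      simpa using (hasDerivAt_id t).const_sub T
    have h2 := (hasDerivAt_const t η).div h1 hne
    have h3 := h2.deriv
    simp only [zero_mul, mul_neg, mul_one, sub_neg_eq_add, zero_add] at h3
    exact h3
  have hcf₂ := hf₂.continuous
  set Φ : ℝ≥0 × M → ℝ := fun q => f₁ q + f₂ q - θ q.1 with hΦ
  have husc : ∀ q : ℝ≥0 × M, q.1 ≤ T' → UpperSemicontinuousAt Φ q := by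
    intro q hq c hc
    have hg : ContinuousAt (fun q : ℝ≥0 × M => f₂ q - θ q.1) q := by
      refine hcf₂.continuousAt.sub ?_
      have h1 : ContinuousAt θ (q.1 : ℝ) := (hθd q.1 (by linarith [hlt q.1 hq])).1.continuousAt
      exact ContinuousAt.comp (f := fun q : ℝ≥0 × M => (q.1 : ℝ)) h1
        (by fun_prop)
    have he : 0 < (c - Φ q) / 2 := by linarith
    have h1 := hf₁ q (f₁ q + (c - Φ q) / 2) (by linarith)
    have h2 := hg.eventually (gt_mem_nhds (show f₂ q - θ q.1 < f₂ q - θ q.1 + (c - Φ q) / 2 by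
      linarith))
    filter_upwards [h1, h2] with r hr1 hr2
    have : Φ q = f₁ q + f₂ q - θ q.1 := rfl
    change f₁ r + f₂ r - θ r.1 < c
    linarith
  have hbdA : BddAbove (Φ '' {q | q.1 ≤ T'}) := by
    refine ⟨B, ?_⟩
    rintro _ ⟨q, hq, rfl⟩
    have h1 := hB q.1 q.2 (by linarith [hlt q.1 hq])
    have h2 := hθ0 q.1 hq
    change f₁ q + f₂ q - θ q.1 ≤ B
    change f₁ q + f₂ q ≤ B at h1
    linarith
  have hpT : p.1 ≤ T' := by
    have : (p.1 : ℝ) ≤ T' := by rw [hT']; linarith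
    exact_mod_cast this
  have hΦp : 0 < Φ p := by
    have : θ p.1 = η := by simp [hθ, hT]
    change 0 < a - θ p.1
    rw [this]; linarith
  obtain ⟨C, w, hC, hw, hw0, hHA⟩ := hA
  set κ := η / T ^ 2 with hκ
  have hκ0 : 0 < κ := by positivity
  have hwev : ∀ᶠ z in 𝓝 ((0 : ℝ≥0), (0 : ℝ), (0 : ℝ)), w z < κ / 4 := by
    refine (hw.tendsto _).eventually (gt_mem_nhds ?_)
    rw [hw0]; positivity
  obtain ⟨δ, hδ, hwδ⟩ := Metric.eventually_nhds_iff.1 hwev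
  set ε := min (κ / 16) (δ / 16) with hε
  have hε0 : 0 < ε := by positivity
  have hεκ : ε ≤ κ / 16 := min_le_left _ _
  have hεδ : ε ≤ δ / 16 := min_le_right _ _
  obtain ⟨⟨t, x⟩, htT', hle, hmax⟩ :=
    F.exists_strip_forall_le_add_mul hb hcomplete hbdA husc hε0 hpT
  simp only at htT' hmax
  have hpos : 0 < f₁ (t, x) + f₂ (t, x) - θ t := hΦp.trans_le hle
  -- At `T'` the maximum would be one-sided in time, and at time `0` there is no equation to use;
  -- both are excluded by the sign of `Φ`.
  have htlt : t < T' := by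
    refine lt_of_le_of_ne htT' ?_
    rintro rfl
    have h1 : θ t = B := by
      simp only [hθ, hT']
      rw [sub_sub_cancel, div_div_cancel₀ hη0.ne']
    have := hB t x (by linarith)
    linarith
  have ht0 : 0 < t := by
    refine pos_iff_ne_zero.2 ?_
    rintro rfl
    linarith [h0 x, hθ0 0 htT']
  have htT : (t : ℝ) < T := by linarith [hlt t htT']
  obtain ⟨hθc, hθ'⟩ := hθd t htT
  obtain ⟨R, hR, hdbl⟩ := F.exists_almost_opposite_superdifferentials hb hf₁ hs₁ hs₂ hf₂ ht0 x
    hθc hε0 (by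
      have : ∀ᶠ q : ℝ≥0 × M in 𝓝 (t, x), q.1 < T' :=
        (continuous_fst.tendsto (t, x)).eventually (gt_mem_nhds htlt)
      filter_upwards [this] with q hq using hmax q hq.le)
  have hκθ : κ ≤ deriv θ t := by
    rw [hθ', hκ]
    have : T - t ≤ T := by linarith [t.coe_nonneg]
    have h2 : 0 < T - t := by linarith
    gcongr
  -- `ε` was fixed first, with `4 * ε ≤ δ / 4`; since `R` depends on it, `σ` comes last, so that `2
  -- C R σ ≤ κ / 8`.
  set σ := min (κ / 16) (min (δ / 2) (κ / (16 * (C * R + 1)))) with hσ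
  have hσ0 : 0 < σ := by positivity
  have hσκ : σ ≤ κ / 16 := min_le_left _ _
  have hσδ : σ ≤ δ / 2 := (min_le_right _ _).trans (min_le_left _ _)
  have hσR : σ * (16 * (C * R + 1)) ≤ κ := by
    rw [← le_div_iff₀ (by positivity)]
    exact (min_le_right _ _).trans (min_le_right _ _)
  obtain ⟨t₁, t₂, x₁, x₂, α₁, α₂, N₁, N₂, g1, g2, g3, g4, g5, g6, g7, g8⟩ := hdbl σ hσ0
  have hHd := hHA t₁ t₂ x₁ x₂ N₁ N₂
  have hd0 := F.fdist_nonneg x₁ x₂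
  have hwz : w (nndist t₁ t₂, F.fdist x₁ x₂, N₁ - N₂) < κ / 4 := by
    refine hwδ ?_
    simp only [Prod.dist_eq, max_lt_iff]
    refine ⟨?_, ?_, ?_⟩
    · rw [NNReal.dist_eq]
      simp only [coe_nndist, NNReal.coe_zero, sub_zero, abs_abs, NNReal.dist_eq]
      linarith
    · rw [Real.dist_eq, sub_zero, abs_of_nonneg hd0]; linarith
    · rw [Real.dist_eq, sub_zero]; linarith
  have hCR : C * max |N₁| |N₂| * (|(t₁ : ℝ) - (t₂ : ℝ)| + F.fdist x₁ x₂) ≤ C * R * (σ + σ) := by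
    have := max_le g6 g7
    gcongr
  -- The slopes give `α₁ + α₂ ≥ κ - 3κ/16`, whereas the two inequalities and condition (A) give `α₁
  -- + α₂ < κ/4 + κ/8`.
  have := (abs_le.1 hHd).1
  nlinarith

end PalaisFinsler

/-! ### Uniqueness and the main theorem -/

theorem uscEnvelope_eq_of_continuous {X : Type*} [TopologicalSpace X] {u : X → ℝ}
    (hu : Continuous u) : uscEnvelope u = u :=
  funext fun p => (uscEnvelope_le hu (fun _ => le_rfl) p).antisymm
    (le_uscEnvelope hu (fun _ => le_rfl) p)

namespace PalaisFinsler

variable {E : Type*} [NormedAddCommGroup E] [NormedSpace ℝ E]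
  {M : Type*} [TopologicalSpace M] [ChartedSpace E M] [IsManifold 𝓘(ℝ, E) 1 M]

theorem IsLipschitz.neg {F : PalaisFinsler E M} {L : ℝ} {h : M → ℝ} (hh : F.IsLipschitz L h) :
    F.IsLipschitz L fun x => -h x := fun y z => by
  rw [neg_sub_neg, abs_sub_comm]
  exact hh y z

theorem IsLocallyLipschitz.neg {F : PalaisFinsler E M} {u : ℝ≥0 × M → ℝ}
    (hu : F.IsLocallyLipschitz u) : F.IsLocallyLipschitz fun p => -u p := fun p => by
  obtain ⟨K, V, hV, hK⟩ := hu p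
  refine ⟨K, V, hV, fun q hq q' hq' => ?_⟩
  rw [neg_sub_neg, abs_sub_comm]
  exact hK q hq q' hq'

/-- A locally Lipschitz viscosity solution which is bounded on strips is the only one. -/
theorem IsViscositySolution.eq_of_isLocallyLipschitz [ConnectedSpace M] [RegularSpace M]
    [CompleteSpace E] {F : PalaisFinsler E M} {b : E → ℝ} {K : ℝ≥0} (hb : IsUnitBump b K)
    (hcomplete : F.IsComplete) {H : ℝ≥0 × M × ℝ → ℝ} (hA : F.ConditionA H) {h : M → ℝ}
    {u w : ℝ≥0 × M → ℝ} (hu : F.IsViscositySolution H h u) (hw : F.IsViscositySolution H h w)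
    (hLip : F.IsLocallyLipschitz u) (hub : BoundedOnStrips u) (hwb : BoundedOnStrips w) :
    w = u := by
  obtain ⟨⟨-, hu₁, hu₀⟩, hu'⟩ := hu
  obtain ⟨⟨hwusc, hw₁, hw₀⟩, hw'⟩ := hw
  obtain ⟨-, hu₁', hu₀'⟩ := isViscositySupersolution_iff_neg.1 hu'
  obtain ⟨hwusc', hw₁', hw₀'⟩ := isViscositySupersolution_iff_neg.1 hw'
  funext p
  have h1 : w p + -u p ≤ 0 := by
    refine F.add_nonpos_of_isSubsolutionAt hb hcomplete hA hwusc hw₁ hu₁' hLip.neg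
      (fun x => by linarith [hw₀ x, hu₀' x]) (fun T hT => ?_) p
    obtain ⟨B, hB⟩ := hub T hT
    obtain ⟨B', hB'⟩ := hwb T hT
    exact ⟨B' + B, fun t x ht => add_le_add ((le_abs_self _).trans (hB' t x ht))
      ((neg_le_abs _).trans (hB t x ht))⟩
  have h2 : -w p + u p ≤ 0 := by
    -- The comparison is applied to `-H`: now `-w` is the semicontinuous subsolution, and `u` is
    -- again the locally Lipschitz function.
    refine F.add_nonpos_of_isSubsolutionAt hb hcomplete hA.neg hwusc' hw₁'
      (by simp only [neg_neg]; exact hu₁) hLip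
      (fun x => by linarith [hw₀' x, hu₀ x]) (fun T hT => ?_) p
    obtain ⟨B, hB⟩ := hub T hT
    obtain ⟨B', hB'⟩ := hwb T hT
    exact ⟨B' + B, fun t x ht => add_le_add ((neg_le_abs _).trans (hB' t x ht))
      ((le_abs_self _).trans (hB t x ht))⟩
  linarith

/-- The family constrains positive times only; at time `0` the bound is the initial condition. -/
theorem le_of_mem_perronFamily {F : PalaisFinsler E M} {H : ℝ≥0 × M × ℝ → ℝ} {h : M → ℝ}
    {K₀ K₁ : ℝ} {w : ℝ≥0 × M → ℝ} (hw : w ∈ F.perronFamily H h K₀ K₁) (p : ℝ≥0 × M) :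
    w p ≤ -K₀ * (p.1 : ℝ) + h p.2 := by
  obtain ⟨t, x⟩ := p
  rcases eq_zero_or_pos t with rfl | ht
  · simpa using hw.1.2.2 x
  · exact (hw.2 t x ht).2

theorem le_perronSup {F : PalaisFinsler E M} {H : ℝ≥0 × M × ℝ → ℝ} {h : M → ℝ}
    {K₀ K₁ : ℝ} {w : ℝ≥0 × M → ℝ} (hw : w ∈ F.perronFamily H h K₀ K₁) (p : ℝ≥0 × M) :
    w p ≤ F.perronSup H h K₀ K₁ p :=
  le_csSup ⟨-K₀ * (p.1 : ℝ) + h p.2, by rintro _ ⟨v, hv, rfl⟩; exact le_of_mem_perronFamily hv p⟩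
    ⟨w, hw, rfl⟩

end PalaisFinsler

open PalaisFinsler

theorem mainTheorem12
    {E : Type*} [NormedAddCommGroup E] [NormedSpace ℝ E] [CompleteSpace E]
    (hbump : HasC1LipschitzBump E)
    {M : Type*} [TopologicalSpace M] [T2Space M] [ParacompactSpace M] [ConnectedSpace M]
    [ChartedSpace E M] [IsManifold 𝓘(ℝ, E) 1 M]
    (F : PalaisFinsler E M) (hcomplete : F.IsComplete)
    (H : ℝ≥0 × M × ℝ → ℝ) (hH : Continuous H) (hA : F.ConditionA H)
    (h : M → ℝ) (L : ℝ) (hL : 0 ≤ L) (hLip : F.IsLipschitz L h)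
    (hbdd : ∃ B : ℝ, ∀ x : M, |h x| ≤ B)
    (K₀ K₁ : ℝ)
    (hK₀ : IsGLB {r : ℝ | ∃ (t : ℝ≥0) (x : M) (m : ℝ), 0 < t ∧ |m| ≤ L ∧ r = H (t, x, m)} K₀)
    (hK₁ : IsLUB {r : ℝ | ∃ (t : ℝ≥0) (x : M) (m : ℝ), 0 < t ∧ |m| ≤ L ∧ r = H (t, x, m)} K₁)
    (u uUp uUpLow : ℝ≥0 × M → ℝ)
    (hu : u = F.perronSup H h K₀ K₁)
    (huUp : uUp = uscEnvelope u)
    (huUpLow : uUpLow = lscEnvelope uUp) :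
    F.IsViscositySubsolution H h uUp ∧
    F.IsViscositySupersolution H h uUpLow ∧
    (Continuous uUp → uUp = uUpLow ∧ F.IsViscositySolution H h uUp) ∧
    (F.IsLocallyLipschitz uUp →
      F.IsViscositySolution H h uUp ∧ BoundedOnStrips uUp ∧
      ∀ w : ℝ≥0 × M → ℝ, F.IsViscositySolution H h w → BoundedOnStrips w → w = uUp) := by
  obtain ⟨b, K, hb⟩ := hbump.exists_isUnitBump
  have hhc := hLip.continuous
  set m : ℝ≥0 × M → ℝ := fun p => -K₀ * (p.1 : ℝ) + h p.2 with hm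
  set l : ℝ≥0 × M → ℝ := fun p => -K₁ * (p.1 : ℝ) + h p.2 with hl
  have hmc : Continuous m := by fun_prop
  have hlc : Continuous l := by fun_prop
  have hK₀H : ∀ (t : ℝ≥0) (x : M) (r : ℝ), 0 < t → |r| ≤ L → K₀ ≤ H (t, x, r) :=
    fun t x r ht hr => hK₀.1 ⟨t, x, r, ht, hr, rfl⟩
  have hK₁H : ∀ (t : ℝ≥0) (x : M) (r : ℝ), 0 < t → |r| ≤ L → H (t, x, r) ≤ K₁ :=
    fun t x r ht hr => hK₁.1 ⟨t, x, r, ht, hr, rfl⟩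
  obtain ⟨x₀⟩ := (inferInstance : Nonempty M)
  have hKK : K₀ ≤ K₁ := (hK₀H 1 x₀ 0 one_pos (by simpa)).trans (hK₁H 1 x₀ 0 one_pos (by simpa))
  have hlm : ∀ p, l p ≤ m p := fun p => by
    have := mul_le_mul_of_nonneg_right hKK p.1.coe_nonneg
    simp only [hl, hm]
    linarith
  -- The lower barrier is itself a member, so the supremum is over a nonempty set.
  have hlF : l ∈ F.perronFamily H h K₀ K₁ :=
    ⟨⟨hlc.upperSemicontinuous, fun t x ht => F.isSubsolutionAt_mul_add hb hL hLip
      (fun t x r ht hr => by linarith [hK₁H t x r ht hr]) ht x, fun x => by simp [hl]⟩,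
      fun t x _ => ⟨le_rfl, hlm (t, x)⟩⟩
  have hlu : ∀ p, l p ≤ u p := fun p => hu ▸ le_perronSup hlF p
  have hum : ∀ p, u p ≤ m p := fun p => by
    rw [hu]
    exact csSup_le ⟨_, l, hlF, rfl⟩
      (by rintro _ ⟨w, hw, rfl⟩; exact le_of_mem_perronFamily hw p)
  have huU : ∀ p, u p ≤ uUp p := huUp ▸ le_uscEnvelope hmc hum
  have hUm : ∀ p, uUp p ≤ m p := huUp ▸ uscEnvelope_le hmc hum
  have hlU : ∀ p, l p ≤ uUp p := fun p => (hlu p).trans (huU p)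
  -- Both barriers are continuous and equal `h` at time `0`, so taking envelopes cannot change the
  -- initial value.
  have hU0 : ∀ x, uUp (0, x) = h x := fun x => le_antisymm (by simpa [hm] using hUm (0, x))
    (by simpa [hl] using hlU (0, x))
  have hUusc : UpperSemicontinuous uUp := huUp ▸ upperSemicontinuous_uscEnvelope hmc hum
  have hUsub : ∀ (t : ℝ≥0) (x : M), 0 < t → F.IsSubsolutionAt H uUp t x := by
    intro t x ht
    rw [huUp]
    refine F.isSubsolutionAt_uscEnvelope hb hH hmc hum (fun p c hc => ?_) ht x
    rw [hu] at hc
    obtain ⟨_, ⟨w, hw, rfl⟩, hcw⟩ := exists_lt_of_lt_csSup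
      (s := {r : ℝ | ∃ w ∈ F.perronFamily H h K₀ K₁, r = w p}) ⟨_, l, hlF, rfl⟩ hc
    exact ⟨w, hw.1.1, fun p => hu ▸ le_perronSup hw p, hw.1.2.1, hcw⟩
  have hsub : F.IsViscositySubsolution H h uUp := ⟨hUusc, hUsub, fun x => (hU0 x).le⟩
  have hUl : ∀ p, -uUp p ≤ -l p := fun p => neg_le_neg (hlU p)
  have hneg : (fun p => -uUpLow p) = uscEnvelope fun p => -uUp p := by
    funext p
    rw [huUpLow, lscEnvelope_eq_neg, neg_neg]
  have hsup : F.IsViscositySupersolution H h uUpLow := by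
    rw [isViscositySupersolution_iff_neg, hneg]
    refine ⟨upperSemicontinuous_uscEnvelope hlc.neg hUl, fun t x ht => ?_, fun x => ?_⟩
    · refine F.isSubsolutionAt_neg_uscEnvelope_neg hb hH hlc hmc hlU hUm hUusc hUsub
        (fun t x ht => ?_) (fun w hw hws hUw hwm hw0 p => ?_) ht x
      · have := F.isSubsolutionAt_mul_add hb (H := fun p => -H p) (c := K₀) hL hLip.neg
          (fun t x r ht hr => by linarith [hK₀H t x r ht hr]) ht x
        convert this using 1
        funext p
        simp only [hm]
        ring
      -- A subsolution between `uUp` and the upper barrier with the same initial values belongs to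
      -- the family, hence lies below `u`: this is the maximality of `uUp`.
      · have hwF : w ∈ F.perronFamily H h K₀ K₁ :=
          ⟨⟨hw, hws, fun x => ((hw0 x).trans (hU0 x)).le⟩,
            fun t x _ => ⟨(hlU (t, x)).trans (hUw (t, x)), hwm (t, x)⟩⟩
        exact (hu ▸ le_perronSup hwF p).trans (huU p)
    · simpa [hl] using uscEnvelope_le hlc.neg hUl (0, x)
  have hcont : Continuous uUp → uUp = uUpLow ∧ F.IsViscositySolution H h uUp := by
    intro hc
    have heq : uUp = uUpLow := by
      rw [uscEnvelope_eq_of_continuous (u := fun p => -uUp p) hc.neg] at hneg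
      funext p
      exact (neg_injective (congrFun hneg p)).symm
    exact ⟨heq, hsub, heq ▸ hsup⟩
  refine ⟨hsub, hsup, hcont, fun hUL => ?_⟩
  have hsol := (hcont hUL.continuous).2
  obtain ⟨B, hB⟩ := hbdd
  have hbs : BoundedOnStrips uUp := by
    intro T hT
    refine ⟨(|K₀| + |K₁|) * T + B, fun t x ht => ?_⟩
    have h1 := abs_le.1 (hB x)
    have hK : ∀ k : ℝ, |k * t| ≤ |k| * T := fun k => by
      rw [abs_mul, abs_of_nonneg t.coe_nonneg]
      gcongr
    have h2 := hlU (t, x)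
    have h3 := hUm (t, x)
    have h4 := abs_le.1 (hK K₀)
    have h5 := abs_le.1 (hK K₁)
    simp only [hl, hm] at h2 h3
    have h6 : 0 ≤ |K₀| * T := by positivity
    have h7 : 0 ≤ |K₁| * T := by positivity
    exact abs_le.2 ⟨by linarith [h5.2], by linarith [h4.1]⟩
  exact ⟨hsol, hbs, fun w hw hwb => hsol.eq_of_isLocallyLipschitz hb hcomplete hA hw hUL hbs hwb⟩
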